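/- **Setting.** Let $M$ and $N$ be smooth manifolds (Hausdorff, second countable) of dimension $n\ge 1$. Fields on $M$ are finite families $\varphi=(\varphi_i)_i$ of differential forms on $M$ of given degrees $r_i$ (gauge potentials, matter fields, coframes, in components). A Lagrangian is a first-order functional expression $L(\varphi)=\tilde L(\varphi;d\varphi)$ with values in $n$-forms, where $\tilde L$ is smooth on an open set of values of $(\varphi,d\varphi)$ at a point and does not depend on the linear frame in which it is evaluated (no background structure). The field space $\Phi$ is a set of smooth fields in the domain of $L$ that is stable under $\varphi\mapsto\psi^*\varphi$, $\psi\in\mathrm{Diff}(M)$, and open under compactly supported smooth perturbations. Tangent vectors of $\Phi$ are represented by smooth curves $\varphi_\tau$ in $\Phi$, with variation $\delta\varphi=\frac{d}{d\tau}\varphi_\tau|_{\tau=0}$; a map $\Phi\to\mathrm{Diff}(N,M)$ is smooth if it sends smooth curves to smooth curves. Integration by parts, $dL_{|\varphi}(\delta\varphi)=E(\delta\varphi;\varphi)+d\theta(\delta\varphi;\varphi)$, defines the presymplectic potential current $\theta$ and the field-equation form $E(\delta\varphi;\varphi)=\sum_i\delta\varphi_i\wedge e_i(\varphi)$; put $E(\iota_X\varphi;\varphi)=\sum_i\iota_X\varphi_i\wedge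 e_i(\varphi)$ for a vector field $X$ on $M$. Let $\mathcal S=\{\varphi\in\Phi: E_{|\varphi}=0\}$. Regions $U$ are smooth singular cubical $n$-chains in $M$ with integer coefficients, $\langle\omega,U\rangle=\int_U\omega$, and $S=\langle L,U\rangle$ is the action; $dS$ is its variation at fixed $U$. For smooth $\psi:\Phi\to\mathrm{Diff}(M)$ put $\Xi(\varphi)=\psi(\varphi)^*\varphi$. For a form $\alpha$ on $\Phi$ put $\alpha^\psi=\Xi^*\alpha$, and let $\boldsymbol{d\psi\circ\psi^{-1}}$ be the 1-form on $\Phi$ whose value on the tangent vector of $\varphi_\tau$ is the vector field $y\mapsto\frac{d}{d\tau}\psi(\varphi_\tau)\big(\psi(\varphi_0)^{-1}(y)\big)|_{\tau=0}$ on $M$. For quantities integrated over $U$, the transformed quantity is integrated over $\psi(\varphi)^{-1}(U)$ (at fixed domain when $S$ is varied). **Then:** 1. $L(\psi^*\varphi)=\psi^*L(\varphi)$ for all $\psi\in\mathrm{Diff}(M)$, $\varphi\in\Phi$; and $dL=E+d\theta$, $dS=\langle dL,U\rangle$ on $\Phi$. 2. For every smooth field-dependent diffeomorphism $\psi:\Phi\to\mathrm{Diff}(M)$: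 $\Xi$ maps $\Phi$ into $\Phi$ and smooth curves to smooth curves, $L^\psi=\psi^*L$, $S^\psi=S$, and $$E^\psi=\psi^*\big(E+dE(\iota_{d\psi\circ\psi^{-1}}\varphi;\varphi)\big),$$ $$(dL)^\psi=d(L^\psi)=\psi^*\big(dL+\mathfrak L_{d\psi\circ\psi^{-1}}L\big),$$ $$(dS)^\psi=dS+\langle\mathfrak L_{d\psi\circ\psi^{-1}}L,U\rangle=dS+\langle d\,\iota_{d\psi\circ\psi^{-1}}L,U\rangle=dS+\langle\iota_{d\psi\circ\psi^{-1}}L,\partial U\rangle,$$ $$\langle E^\psi+d\theta^\psi,\psi^{-1}(U)\rangle=\langle dL+\mathfrak L_{d\psi\circ\psi^{-1}}L,U\rangle=\langle (dL)^\psi,\psi^{-1}(U)\rangle=(dS)^\psi .$$ 3. The space of solutions is preserved: for $\varphi\in\Phi$, $\varphi\in\mathcal S\iff\Xi(\varphi)\in\mathcal S$, and $E_{|\varphi}=0$ implies $E^\psi_{|\varphi}=0$. If $\Xi\in\mathrm{Diff}_v(\Phi)$, i.e. $\Xi$ has a smooth inverse on $\Phi$, then $\Xi(\mathcal S)=\mathcal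 S$ and $\{\varphi\in\Phi:E^\psi_{|\varphi}=0\}=\mathcal S$. 4. Let $u:\Phi\to\mathrm{Diff}(N,M)$ be a dressing field, i.e. a smooth map with $u(\psi^*\varphi)=\psi^{-1}\circ u(\varphi)$ for $\psi\in\mathrm{Diff}(M)$, let $\varphi^u=u(\varphi)^*\varphi$ be the dressed field on $N$, and let $\alpha^u$ denote pullback along $\varphi\mapsto\varphi^u$. Then all formulas of item 2 hold with $u$ in place of $\psi$ (in particular $L^u=u^*L$, $E^u=u^*(E+dE(\iota_{du\circ u^{-1}}\varphi;\varphi))$ and $(dS)^u=dS+\langle\iota_{du\circ u^{-1}}L,\partial U\rangle$). For $\varphi\in\Phi$, $\varphi\in\mathcal S$ if and only if $\varphi^u$ solves the same field equations on $N$, i.e. belongs to the solution space $\mathcal S_N$ of $L$ in the field space $\{v^*\varphi:v\in\mathrm{Diff}(N,M),\varphi\in\Phi\}$. The space of dressed solutions $\mathcal S^u=\{\varphi^u:\varphi\in\mathcal S\}$ equals $\{\varphi^u:\varphi\in\Phi\}\cap\mathcal S_N$, and $\varphi^u=\varphi'^u$ if and only if $\varphi'=\psi^*\varphi$ for some $\psi\in\mathrm{Diff}(M)$;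 so $\mathcal S^u$ is $\mathcal S$ modulo $\mathrm{Diff}(M)$. Moreover $E_{|\varphi}=0$ implies $E^u_{|\varphi}=0$, and if $u$ is locally built (on every open $V\subset M$, the frame $u(\varphi)^{-1}:M\to N$ depends only on $\varphi_{|V}$), then $\{\varphi\in\Phi:E^u_{|\varphi}=0\}=\mathcal S$. 5. The transformation $(dS)^\psi=dS+\langle\iota_{d\psi\circ\psi^{-1}}L,\partial U\rangle$, with $\langle\iota_{d\psi\circ\psi^{-1}}L,\partial U\rangle=\langle\mathfrak L_{d\psi\circ\psi^{-1}}L,U\rangle=\langle d\,\iota_{d\psi\circ\psi^{-1}}L,U\rangle$, and $S^\psi=S$, hold for every smooth $\mathrm{Diff}(M)$-covariant Lagrangian (of any order) on any smooth space of fields of any kind with a smooth right action of $\mathrm{Diff}(M)$. -/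

import Mathlib

open scoped Manifold ContDiff Topology
open Set Filter MeasureTheory

noncomputable section

namespace FieldDiff

/-! ### Differential forms, chains and integration on a manifold `M` of dimension `m + 1` -/

/-- The model space `ℝ^(m+1)`. -/
abbrev Model (m : ℕ) : Type := EuclideanSpace ℝ (Fin (m + 1))

/-- Alternating `k`-forms on `ℝ^(m+1)`. -/
abbrev Alt (m k : ℕ) : Type := Model m [⋀^Fin k]→L[ℝ] ℝ

/-- Diffeomorphisms between manifolds of dimension `m + 1`. -/
abbrev Diffeo (m : ℕ) (N M : Type*) [TopologicalSpace N] [ChartedSpace (Model m) N]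
    [TopologicalSpace M] [ChartedSpace (Model m) M] : Type _ :=
  Diffeomorph 𝓘(ℝ, Model m) 𝓘(ℝ, Model m) N M ∞

/-- (Not necessarily smooth) differential `k`-forms on `M`: recall that `TangentSpace _ x` is, by
definition, the model space, identified with the tangent space through the preferred chart
at `x`. -/
abbrev MForm (m : ℕ) (M : Type*) (k : ℕ) : Type _ := M → Alt m k

section Forms

variable {m k : ℕ} {M : Type*} [TopologicalSpace M] [ChartedSpace (Model m) M]
  {N : Type*} [TopologicalSpace N] [ChartedSpace (Model m) N]

/-- The tangent map of `f` at `x`. -/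
def tmap (m : ℕ) {M N : Type*} [TopologicalSpace M] [ChartedSpace (Model m) M]
    [TopologicalSpace N] [ChartedSpace (Model m) N] (f : N → M) (x : N) :
    Model m →L[ℝ] Model m :=
  mfderiv 𝓘(ℝ, Model m) 𝓘(ℝ, Model m) f x

/-- Pullback `f^* η`. -/
def pullback (f : N → M) (η : MForm m M k) : MForm m N k :=
  fun x => (η (f x)).compContinuousLinearMap (tmap m f x)

/-- The expression of a form in the preferred chart at `x₀`. -/
def inChart (x₀ : M) (η : MForm m M k) : MForm m (Model m) k :=
  pullback (extChartAt 𝓘(ℝ, Model m) x₀).symm η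

def IsSmoothForm (η : MForm m M k) : Prop :=
  ∀ x₀ : M, ContDiffOn ℝ ∞ (inChart x₀ η) (extChartAt 𝓘(ℝ, Model m) x₀).target

/-- `η τ` depends smoothly on `(τ, x) ∈ ℝ × M` jointly, i.e. `η` is a smooth curve in the space
of forms. -/
def IsSmoothFamily (η : ℝ → MForm m M k) : Prop :=
  ∀ x₀ : M, ContDiffOn ℝ ∞ (fun p : ℝ × Model m => inChart x₀ (η p.1) p.2)
    (univ ×ˢ (extChartAt 𝓘(ℝ, Model m) x₀).target)

/-- The de Rham differential, computed at `x` in the preferred chart at `x`. -/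
def extD (η : MForm m M k) : MForm m M (k + 1) := fun x =>
  (extDeriv (inChart x η) (extChartAt 𝓘(ℝ, Model m) x x)).compContinuousLinearMap
    (tmap m (extChartAt 𝓘(ℝ, Model m) x) x)

/-- The interior product `ι_X η` with a vector field `X` on `M`. -/
def interior (X : M → Model m) (η : MForm m M (k + 1)) : MForm m M k :=
  fun x => (η x).curryLeft (X x)

/-- The Lie derivative `𝔏_X = ι_X d + d ι_X`. -/
def lieD (X : M → Model m) (η : MForm m M (k + 1)) : MForm m M (k + 1) :=
  interior X (extD η) + extD (interior X η)

end Forms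

/-- Smooth singular `k`-cubes. -/
structure Cube (m : ℕ) (M : Type*) [TopologicalSpace M] [ChartedSpace (Model m) M]
    (k : ℕ) where
  toFun : (Fin k → ℝ) → M
  smooth : ContMDiff 𝓘(ℝ, Fin k → ℝ) 𝓘(ℝ, Model m) ∞ toFun

section Chains

variable {m k : ℕ} {M : Type*} [TopologicalSpace M] [ChartedSpace (Model m) M]
  {N : Type*} [TopologicalSpace N] [ChartedSpace (Model m) N]

/-- `∫_σ η`, the integral of `σ^* η` over `[0,1]^k`. -/
def Cube.integral (σ : Cube m M k) (η : MForm m M k) : ℝ :=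
  ∫ t in Set.Icc (0 : Fin k → ℝ) 1, η (σ.toFun t) (fun i =>
    (mfderiv 𝓘(ℝ, Fin k → ℝ) 𝓘(ℝ, Model m) σ.toFun t :
      (Fin k → ℝ) →L[ℝ] Model m) (Pi.single i 1))

lemma contDiff_insertNth (i : Fin (k + 1)) (a : ℝ) :
    ContDiff ℝ ∞ (fun t : Fin k → ℝ => (i.insertNth a t : Fin (k + 1) → ℝ)) := by
  rw [contDiff_pi]
  intro j
  refine Fin.succAboveCases i ?_ (fun j' => ?_) j
  · simpa using contDiff_const
  · simpa using contDiff_apply ℝ ℝ j'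

/-- The face of `σ` on which the `i`-th coordinate equals `a`. -/
def Cube.face (σ : Cube m M (k + 1)) (i : Fin (k + 1)) (a : ℝ) : Cube m M k where
  toFun := fun t => σ.toFun (i.insertNth a t)
  smooth := σ.smooth.comp (contDiff_insertNth i a).contMDiff

/-- The image of a cube under a diffeomorphism. -/
def Cube.map (f : Diffeo m M N) (σ : Cube m M k) : Cube m N k where
  toFun := fun t => f (σ.toFun t)
  smooth := f.contMDiff.comp σ.smooth

/-- Integration domains: finite integral combinations of smooth singular `k`-cubes. -/
abbrev Chain (m : ℕ) (M : Type*) [TopologicalSpace M] [ChartedSpace (Model m) M] (k : ℕ) :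
    Type _ := Cube m M k →₀ ℤ

/-- The integration pairing `⟨η, U⟩ = ∫_U η`. -/
def pair (η : MForm m M k) (U : Chain m M k) : ℝ :=
  U.sum fun σ a => (a : ℝ) * σ.integral η

/-- The boundary `∂U`. -/
def boundary (U : Chain m M (k + 1)) : Chain m M k :=
  U.sum fun σ a => a • ∑ i : Fin (k + 1), (-1 : ℤ) ^ (i : ℕ) •
    (Finsupp.single (σ.face i 1) 1 - Finsupp.single (σ.face i 0) 1)

/-- `f⁻¹(U)` for a diffeomorphism `f : N → M` and a domain `U` in `M`. -/
def preim (f : Diffeo m N M) (U : Chain m M k) : Chain m N k :=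
  U.mapDomain (Cube.map f.symm)

end Chains

/-! ### Smooth families of diffeomorphisms -/

section Diffeos

variable {m : ℕ} {M : Type*} [TopologicalSpace M] [ChartedSpace (Model m) M]
  {N : Type*} [TopologicalSpace N] [ChartedSpace (Model m) N]

/-- Smooth curves in `Diff(N, M)`. -/
def IsDiffFamily (g : ℝ → Diffeo m N M) : Prop :=
  ContMDiff (𝓘(ℝ, ℝ).prod 𝓘(ℝ, Model m)) 𝓘(ℝ, Model m) ∞ (fun p : ℝ × N => g p.1 p.2)

/-- The vector field `ġ ∘ g⁻¹` on `M` at `τ = 0`: at `y` it is the velocity of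
`τ ↦ g_τ (g₀⁻¹ y)`. For `g_τ = ψ(φ_τ)` this is `(dψ ∘ ψ⁻¹)` evaluated on the variation `φ_τ`. -/
def generator (g : ℝ → Diffeo m N M) : M → Model m := fun y =>
  (mfderiv 𝓘(ℝ, ℝ) 𝓘(ℝ, Model m) (fun τ : ℝ => g τ ((g 0).symm y)) 0 : ℝ →L[ℝ] Model m) 1

end Diffeos

/-! ### Fields, first-order natural Lagrangians, field equations, presymplectic potential -/

/-- A collection of fields: `φ i` is a form of degree `r i` on `M`. -/
abbrev Field (m : ℕ) (M : Type*) {ι : Type*} (r : ι → ℕ) : Type _ :=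
  (i : ι) → MForm m M (r i)

/-- The fibre in which `(φ, dφ)` takes values at a point. -/
abbrev Jet (m : ℕ) {ι : Type*} (r : ι → ℕ) : Type _ :=
  ((i : ι) → Alt m (r i)) × ((i : ι) → Alt m (r i + 1))

/-- Linear change of frame on the fibre. -/
def Jet.pull {m : ℕ} {ι : Type*} {r : ι → ℕ} (A : Model m →L[ℝ] Model m) (ξ : Jet m r) :
    Jet m r :=
  (fun i => (ξ.1 i).compContinuousLinearMap A, fun i => (ξ.2 i).compContinuousLinearMap A)

/-- A first-order Lagrangian without background structure: a smooth functional expression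
`L̃(φ; dφ)` with values in top forms, defined on an open set of values of `(φ, dφ)` (such as
nondegenerate coframes), which does not depend on the frame in which it is evaluated. -/
structure NaturalLagrangian (m : ℕ) {ι : Type*} [Fintype ι] (r : ι → ℕ) where
  dom : Set (Jet m r)
  isOpen_dom : IsOpen dom
  toFun : Jet m r → Alt m (m + 1)
  contDiffOn : ContDiffOn ℝ ∞ toFun dom
  pull_mem : ∀ (A : Model m ≃L[ℝ] Model m), ∀ ξ ∈ dom, Jet.pull (A : Model m →L[ℝ] Model m) ξ ∈ dom
  map_pull : ∀ (A : Model m ≃L[ℝ] Model m), ∀ ξ ∈ dom,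
    toFun (Jet.pull (A : Model m →L[ℝ] Model m) ξ) =
      (toFun ξ).compContinuousLinearMap (A : Model m →L[ℝ] Model m)

section FibreAlgebra

variable {m : ℕ} {ι : Type*} {r : ι → ℕ}

/-- `α ∧ a` for a covector `α`. -/
def wedgeOne {k : ℕ} (α : Model m →L[ℝ] ℝ) (a : Alt m k) : Alt m (k + 1) :=
  ContinuousAlternatingMap.alternatizeUncurryFin (α.smulRight a)

/-- `α ∧ ι_X a`, with `ι_X a = 0` in degree `0`. -/
def wedgeContract (α : Model m →L[ℝ] ℝ) (X : Model m) : {k : ℕ} → Alt m k → Alt m k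
  | 0, _ => 0
  | _ + 1, a => wedgeOne α (a.curryLeft X)

/-- The coordinate vectors `e_j`. -/
def vec (m : ℕ) (j : Fin (m + 1)) : Model m := EuclideanSpace.single j 1

/-- The coordinate covectors `e^j`. -/
def covec (m : ℕ) (j : Fin (m + 1)) : Model m →L[ℝ] ℝ := EuclideanSpace.proj j

/-- A linear map `T` from forms of degrees `r i + 1` to top forms has the form
`T(a) = ∑ i, a i ∧ t i`, hence also acts on forms of degrees `r i`, with values in
`m`-forms: `b ↦ ∑ i, b i ∧ t i`. This is the unique `T♭` with `α ∧ T♭(b) = T(α ∧ b)` for all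
covectors `α`; explicitly `T♭(b) = ∑ j, ι_{e_j} T(e^j ∧ b)`. -/
def lower (T : ((i : ι) → Alt m (r i + 1)) → Alt m (m + 1)) (b : (i : ι) → Alt m (r i)) :
    Alt m m :=
  ∑ j : Fin (m + 1), (T fun i => wedgeOne (covec m j) (b i)).curryLeft (vec m j)

/-- In the same way, for `T(a) = ∑ i, a i ∧ t i` on forms of degrees `r i`, the `m`-form
`T♭(ι_X a) = ∑ i, ι_X (a i) ∧ t i`, characterised by `α ∧ T♭(ι_X a) = T(α ∧ ι_X a)`. -/
def lowerContract (T : ((i : ι) → Alt m (r i)) → Alt m (m + 1)) (X : Model m)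
    (a : (i : ι) → Alt m (r i)) : Alt m m :=
  ∑ j : Fin (m + 1), (T fun i => wedgeContract (covec m j) X (a i)).curryLeft (vec m j)

end FibreAlgebra

section Theory

variable {m : ℕ} {ι : Type*} [Fintype ι] {r : ι → ℕ}
  {M : Type*} [TopologicalSpace M] [ChartedSpace (Model m) M]
  {N : Type*} [TopologicalSpace N] [ChartedSpace (Model m) N]

/-- Pullback of all fields: `f^* φ`. -/
def pullField (f : N → M) (φ : Field m M r) : Field m N r := fun i => pullback f (φ i)

/-- `(φ, dφ)` at `x`. -/
def jet (φ : Field m M r) (x : M) : Jet m r := (fun i => φ i x, fun i => extD (φ i) x)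

/-- The Lagrangian top form `L(φ) = L̃(φ; dφ)`. -/
def lagr (Λ : NaturalLagrangian m r) (φ : Field m M r) : MForm m M (m + 1) :=
  fun x => Λ.toFun (jet φ x)

/-- The variation `dL_{|φ}(δφ) = L̃₀(δφ) + L̃₁(d δφ)`. -/
def varLagr (Λ : NaturalLagrangian m r) (φ δ : Field m M r) : MForm m M (m + 1) :=
  fun x => fderiv ℝ Λ.toFun (jet φ x) (jet δ x)

/-- The presymplectic potential current `θ(δφ; φ) = L̃₁(δφ)`: the `m`-form obtained from
`L̃₁ : F ↦ ∂L̃/∂(dφ) · F`, `F = ∑ F i ∧ p i`, by inserting `δφ` in place of `F`. -/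
def theta (Λ : NaturalLagrangian m r) (φ δ : Field m M r) : MForm m M m :=
  fun x => lower (fun F => fderiv ℝ Λ.toFun (jet φ x) (0, F)) (fun i => δ i x)

/-- The fields, defined near `x`, with constant components `a` in the preferred chart at `x`. -/
def chartConst (x : M) (a : (i : ι) → Alt m (r i)) : Field m M r := fun i y =>
  (a i).compContinuousLinearMap (tmap m (extChartAt 𝓘(ℝ, Model m) x) y)

/-- The Euler-Lagrange expression at `x`, an algebraic function `a ↦ E(a; φ)_x` of the value `a`
of `δφ` at `x`: what remains of `dL_{|φ}(δφ)` after integration by parts, `dL - dθ`, evaluated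
on the extension of `a` with constant components. -/
def eulerLagrange (Λ : NaturalLagrangian m r) (φ : Field m M r) (x : M)
    (a : (i : ι) → Alt m (r i)) : Alt m (m + 1) :=
  varLagr Λ φ (chartConst x a) x - extD (theta Λ φ (chartConst x a)) x

/-- The field-equation form `E(δφ; φ)`. -/
def fieldEq (Λ : NaturalLagrangian m r) (φ δ : Field m M r) : MForm m M (m + 1) :=
  fun x => eulerLagrange Λ φ x (fun i => δ i x)

/-- The `m`-form `E(ι_X φ; φ)`. -/
def fieldEqContract (Λ : NaturalLagrangian m r) (φ : Field m M r) (X : M → Model m) :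
    MForm m M m :=
  fun x => lowerContract (eulerLagrange Λ φ x) (X x) (fun i => φ i x)

/-- A field space `Φ`: an open (for compactly supported perturbations) and `Diff(M)`-stable set
of smooth fields, on which the Lagrangian is defined. -/
structure IsFieldSpace (Λ : NaturalLagrangian m r) (Φ : Set (Field m M r)) : Prop where
  smooth : ∀ φ ∈ Φ, ∀ i, IsSmoothForm (φ i)
  jet_mem : ∀ φ ∈ Φ, ∀ x, jet φ x ∈ Λ.dom
  stable : ∀ (ψ : Diffeo m M M), ∀ φ ∈ Φ, pullField ψ φ ∈ Φ
  perturb : ∀ φ ∈ Φ, ∀ δ : Field m M r, (∀ i, IsSmoothForm (δ i)) →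
    (∃ K : Set M, IsCompact K ∧ ∀ x ∉ K, ∀ i, δ i x = 0) →
    ∀ᶠ τ : ℝ in 𝓝 0, φ + τ • δ ∈ Φ

/-- The same kind of fields on another manifold `N`: all pullbacks of elements of `Φ` along
diffeomorphisms `N → M`. -/
def transport (N : Type*) [TopologicalSpace N] [ChartedSpace (Model m) N]
    (Φ : Set (Field m M r)) : Set (Field m N r) :=
  {χ | ∃ v : Diffeo m N M, ∃ φ ∈ Φ, χ = pullField v φ}

/-- Smooth curves in `Φ`. A curve `c` represents the tangent vector to `Φ` at `c 0` with
components `velocity c`. -/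
def IsCurveIn (Φ : Set (Field m M r)) (c : ℝ → Field m M r) : Prop :=
  (∀ τ, c τ ∈ Φ) ∧ ∀ i, IsSmoothFamily (fun τ => c τ i)

/-- The variation `δφ = d/dτ φ_τ` at `τ = 0`. -/
def velocity (c : ℝ → Field m M r) : Field m M r :=
  fun i x => deriv (fun τ => c τ i x) 0

/-- The space of solutions `{φ ∈ Φ | E_{|φ} = 0}`: the 1-form `E` vanishes on all variations
at `φ`. -/
def solutions (Λ : NaturalLagrangian m r) (Φ : Set (Field m M r)) : Set (Field m M r) :=
  {φ ∈ Φ | ∀ c, IsCurveIn Φ c → c 0 = φ → fieldEq Λ φ (velocity c) = 0}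

/-- The variation `dS` of the action `S = ⟨L, U⟩` along `c`, at fixed domain `U`. -/
def dAction (Λ : NaturalLagrangian m r) (c : ℝ → Field m M r) (U : Chain m M (m + 1)) : ℝ :=
  deriv (fun τ => pair (lagr Λ (c τ)) U) 0

/-- `g : Φ → Diff(N, M)` is smooth: it maps smooth curves to smooth curves. -/
def IsSmoothMap (Φ : Set (Field m M r)) (g : Field m M r → Diffeo m N M) : Prop :=
  ∀ c, IsCurveIn Φ c → IsDiffFamily (fun τ => g (c τ))

/-- `φ ↦ g(φ)^* φ`. For `N = M` it is the map `Ξ` generated by `g`; for a dressing field `g` it is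
the dressing map `φ ↦ φ^g`. -/
def selfPull (g : Field m M r → Diffeo m N M) (φ : Field m M r) : Field m N r :=
  pullField (g φ) φ

/-- The smooth map `ψ : Φ → Diff(M)` generates a vertical diffeomorphism `Ξ(φ) = ψ(φ)^* φ`
of `Φ`. -/
def GeneratesVerticalDiffeo (Φ : Set (Field m M r)) (ψ : Field m M r → Diffeo m M M) : Prop :=
  IsSmoothMap Φ ψ ∧ ∃ Θ : Field m M r → Field m M r,
    MapsTo Θ Φ Φ ∧ (∀ φ ∈ Φ, Θ (selfPull ψ φ) = φ) ∧ (∀ φ ∈ Φ, selfPull ψ (Θ φ) = φ) ∧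
    ∀ c, IsCurveIn Φ c → IsCurveIn Φ (fun τ => Θ (c τ))

/-- A field-dependent dressing field `u : Φ → Diff(N, M)`: smooth, with
`u(ψ^* φ) = ψ⁻¹ ∘ u(φ)`. -/
def IsDressing (Φ : Set (Field m M r)) (u : Field m M r → Diffeo m N M) : Prop :=
  IsSmoothMap Φ u ∧
    ∀ (ψ : Diffeo m M M), ∀ φ ∈ Φ, u (pullField ψ φ) = (u φ).trans ψ.symm

/-- The dressing field is built locally from the fields: the reference frame `u(φ)⁻¹ : M → N` on an
open set of `M` only depends on the values of `φ` there. -/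
def IsLocalDressing (Φ : Set (Field m M r)) (u : Field m M r → Diffeo m N M) : Prop :=
  ∀ φ ∈ Φ, ∀ φ' ∈ Φ, ∀ V : Set M, IsOpen V → (∀ x ∈ V, ∀ i, φ i x = φ' i x) →
    ∀ x ∈ V, (u φ).symm x = (u φ').symm x

end Theory

/-- A smooth space of fields of any kind (tensors, metrics, ...), with its smooth curves and the
right action `R_ψ` of `Diff(M)` by smooth maps. -/
structure DiffSpace (m : ℕ) (M : Type*) [TopologicalSpace M] [ChartedSpace (Model m) M] where
  Point : Type*
  act : Diffeo m M M → Point → Point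
  act_refl : ∀ φ, act (Diffeomorph.refl 𝓘(ℝ, Model m) M ∞) φ = φ
  act_act : ∀ ψ ψ' φ, act ψ' (act ψ φ) = act (ψ'.trans ψ) φ
  curves : Set (ℝ → Point)
  act_curve : ∀ ψ, ∀ c ∈ curves, (fun τ => act ψ (c τ)) ∈ curves

end FieldDiff

end

namespace FieldDiff

open ContinuousAlternatingMap

/-! ### Smooth dependence of pullbacks of alternating forms -/

section AlternatingSmooth

variable {V W : Type*} [NormedAddCommGroup V] [NormedSpace ℝ V] [FiniteDimensional ℝ V]
  [NormedAddCommGroup W] [NormedSpace ℝ W] {k : ℕ}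

/-! Everything follows from frame independence of `L̃`, used once in finite form and once
infinitesimally.

Finite form. Since `d` commutes with pullback (`extD_pullback`), the jet of `f^*φ` at `x` is the jet
of `φ` at `f x` seen in another frame (`jet_pullField`). Hence `L(f^*φ) = f^*L(φ)` for every local
diffeomorphism. Differentiating frame independence in the jet makes `dL` and `θ` natural too. In a
chart the derivatives of `δφ` cancel in `dL - dθ` (`varLagr_sub_extD_theta_model`), so this
difference depends only on the value of `δφ`, and the Euler-Lagrange expression is well defined and
natural.

Infinitesimal form. In the rank-one direction `α ⊗ X` of the frame group it reads `α ∧ ι_X L = L̃₀(α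
∧ ι_X φ) + L̃₁(α ∧ ι_X dφ)`. An `m`-form is determined by its wedge products with covectors, so this
computes `ι_X L` (`NaturalLagrangian.curryLeft_eq`). Substituting it in `E(ι_X φ; φ)`, taking `d`
and using Cartan's formula gives the Noether identity `E(𝔏_X φ; φ) = dE(ι_X φ; φ)` (`noether_model`,
`extD_fieldEqContract`). The second derivatives that appear drop out, being symmetric and paired
with `e^j ∧ e^l`.

The transformation formulas come from one computation (`hasDerivAt_pullback_family`): the derivative
at `τ = 0` of `g_τ^* η_τ` is `g_0^*(η̇ + 𝔏_X η_0)`, with `X` the generator of `g`. Applied to the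
fields, with linearity of `E` and the Noether identity, it gives `E^ψ`; applied to `L(φ_τ)`, it
gives `(dL)^ψ`. Invariance of integrals (`pair_preim`), differentiation under the integral sign
(`hasDerivAt_pair`) and Stokes' theorem on cubes (`pair_extD`) then give `(dS)^ψ`. This last
argument uses only covariance of `L`, whence the version for arbitrary fields.

Solutions. Bump variations show that `φ` is a solution exactly when its Euler-Lagrange expression
vanishes at every point, a condition stable under pullback by diffeomorphisms. Conversely, suppose
that `E^ψ = 0` at `φ`. If `Ξ` is invertible, every curve through `Ξ(φ)` is the image of a curve
through `φ`. If a dressing is local, its generator vanishes off the support of the variation; then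
`E(δφ)` is minus the differential of a compactly supported form, its integral is zero, and the
fundamental lemma of the calculus of variations applies. -/

instance finiteDimensional_continuousMultilinearMap :
    FiniteDimensional ℝ (ContinuousMultilinearMap ℝ (fun _ : Fin k => V) ℝ) := by
  let b := Module.finBasis ℝ V
  let J : ContinuousMultilinearMap ℝ (fun _ : Fin k => V) ℝ →ₗ[ℝ]
      ((Fin k → Fin (Module.finrank ℝ V)) → ℝ) :=
    { toFun := fun f s => f fun i => b (s i)
      map_add' := fun f g => rfl
      map_smul' := fun c f => rfl }
  refine FiniteDimensional.of_injective J fun f g h => ?_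
  apply ContinuousMultilinearMap.toMultilinearMap_injective
  exact Module.Basis.ext_multilinear (fun _ => b) fun s => congrFun h s

/-- For multilinear maps the pullback is polynomial in the linear map. Alternating maps sit inside
multilinear ones, and a linear left inverse of the inclusion, continuous because the space of
multilinear maps is finite-dimensional, carries smoothness back. -/
lemma contDiff_compContinuousLinearMap :
    ContDiff ℝ ∞ (fun p : (W [⋀^Fin k]→L[ℝ] ℝ) × (V →L[ℝ] W) =>
      p.1.compContinuousLinearMap p.2) := by
  obtain ⟨R, hR⟩ := LinearMap.exists_leftInverse_of_injective
    (toContinuousMultilinearMapCLM ℝ : (V [⋀^Fin k]→L[ℝ] ℝ) →L[ℝ] _).toLinearMap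
    (LinearMap.ker_eq_bot.2 toContinuousMultilinearMap_injective)
  have h1 : ContDiff ℝ ∞ (fun p : (W [⋀^Fin k]→L[ℝ] ℝ) × (V →L[ℝ] W) =>
      ContinuousMultilinearMap.compContinuousLinearMapContinuousMultilinear ℝ
        (fun _ : Fin k => V) (fun _ => W) ℝ (fun _ => p.2)
        (toContinuousMultilinearMapCLM ℝ p.1)) := by
    refine ContDiff.clm_apply ?_ ?_
    · exact (ContinuousMultilinearMap.contDiff _).comp (contDiff_pi.2 fun _ => contDiff_snd)
    · exact (ContinuousLinearMap.contDiff _).comp contDiff_fst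
  convert (LinearMap.toContinuousLinearMap R).contDiff.comp h1 using 1
  funext p
  exact (LinearMap.congr_fun hR (p.1.compContinuousLinearMap p.2)).symm

variable {X : Type*} [NormedAddCommGroup X] [NormedSpace ℝ X]

end AlternatingSmooth

/-! ### Fibre algebra -/

section FibreAlgebra

variable {m k : ℕ}

/-- More than `m + 1` vectors are linearly dependent. This is the degree argument that removes `d`
of a top form and `α ∧ L` in what follows. -/
instance subsingleton_alt : Subsingleton (Alt m (m + 2)) := by
  refine ⟨fun a b => ?_⟩
  have h : ∀ c : Alt m (m + 2), c = 0 := fun c => by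
    ext v
    refine c.toAlternatingMap.map_linearDependent v fun hv => ?_
    have := hv.fintype_card_le_finrank
    simp at this
  rw [h a, h b]

lemma wedgeOne_apply (α : Model m →L[ℝ] ℝ) (a : Alt m k) (v : Fin (k + 1) → Model m) :
    wedgeOne α a v = ∑ i : Fin (k + 1), (-1 : ℤ) ^ (i : ℕ) • (α (v i) * a (i.removeNth v)) := by
  simp [wedgeOne, alternatizeUncurryFin_apply]

/-- The wedge product with a covector as a continuous linear map. -/
noncomputable def wedgeOneL : (Model m →L[ℝ] ℝ) →L[ℝ] Alt m k →L[ℝ] Alt m (k + 1) :=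
  (ContinuousLinearMap.compL ℝ (Alt m k) (Model m →L[ℝ] Alt m k) (Alt m (k + 1))
    (alternatizeUncurryFinCLM ℝ (Model m) ℝ)).comp (ContinuousLinearMap.smulRightL ℝ _ _)

@[simp] lemma wedgeOneL_apply (α : Model m →L[ℝ] ℝ) (a : Alt m k) :
    wedgeOneL α a = wedgeOne α a := rfl

/-- `α ∧ ι_X a` as a continuous bilinear map of `X` and `a`. -/
noncomputable def wedgeContractL (α : Model m →L[ℝ] ℝ) :
    {k : ℕ} → Model m →L[ℝ] Alt m k →L[ℝ] Alt m k
  | 0 => 0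
  | _ + 1 => (ContinuousLinearMap.compL ℝ _ _ _ (wedgeOneL α)).comp
      (curryLeftLI (𝕜 := ℝ) (E := Model m) (F := ℝ)).toContinuousLinearMap.flip

@[simp] lemma wedgeContractL_apply (α : Model m →L[ℝ] ℝ) (X : Model m) (a : Alt m k) :
    wedgeContractL α X a = wedgeContract α X a := by
  cases k <;> rfl

/-- `α ∧ (α ∧ a)` is the double antisymmetrisation of `(x, y) ↦ α x • α y • a`, which is symmetric
in `x` and `y`. -/
lemma wedgeOne_wedgeOne_self (α : Model m →L[ℝ] ℝ) (a : Alt m k) :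
    wedgeOne α (wedgeOne α a) = 0 := by
  have := alternatizeUncurryFin_alternatizeUncurryFinCLM_comp_of_symmetric
    (f := α.smulRight (α.smulRight a)) (fun x y => by simp [smul_smul, mul_comm])
  rw [← this]
  unfold wedgeOne
  congr 1
  ext x v
  simp

lemma wedgeOne_add_left (α β : Model m →L[ℝ] ℝ) (a : Alt m k) :
    wedgeOne (α + β) a = wedgeOne α a + wedgeOne β a := by
  simp [← wedgeOneL_apply]

lemma wedgeOne_add (α : Model m →L[ℝ] ℝ) (a b : Alt m k) :
    wedgeOne α (a + b) = wedgeOne α a + wedgeOne α b := by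
  simp [← wedgeOneL_apply]

lemma wedgeOne_sub (α : Model m →L[ℝ] ℝ) (a b : Alt m k) :
    wedgeOne α (a - b) = wedgeOne α a - wedgeOne α b := by
  simp [← wedgeOneL_apply]

lemma wedgeOne_sum {κ : Type*} (s : Finset κ) (α : Model m →L[ℝ] ℝ) (a : κ → Alt m k) :
    wedgeOne α (∑ j ∈ s, a j) = ∑ j ∈ s, wedgeOne α (a j) := by
  simp [← wedgeOneL_apply]

lemma wedgeOne_anticomm (α β : Model m →L[ℝ] ℝ) (a : Alt m k) :
    wedgeOne α (wedgeOne β a) = - wedgeOne β (wedgeOne α a) := by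
  have h := wedgeOne_wedgeOne_self (α + β) a
  rw [wedgeOne_add_left, wedgeOne_add_left, wedgeOne_add, wedgeOne_add,
    wedgeOne_wedgeOne_self, wedgeOne_wedgeOne_self, zero_add, add_zero] at h
  exact eq_neg_of_add_eq_zero_left h

/-- This antisymmetry in the two covectors is what annihilates the second derivatives in
`extDeriv_lowerContract`. -/
lemma wedgeOne_wedgeContract_anticomm (α β : Model m →L[ℝ] ℝ) (X : Model m) (a : Alt m k) :
    wedgeOne α (wedgeContract β X a) = - wedgeOne β (wedgeContract α X a) := by
  cases k with
  | zero => simp [wedgeContract, ← wedgeOneL_apply]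
  | succ k => exact wedgeOne_anticomm α β _

/-- Interior products are antiderivations. -/
lemma curryLeft_wedgeOne (α : Model m →L[ℝ] ℝ) (X : Model m) (a : Alt m k) :
    (wedgeOne α a).curryLeft X + wedgeContract α X a = α X • a := by
  ext v
  cases k with
  | zero =>
    simp [wedgeContract, wedgeOne_apply]
  | succ k =>
    simp only [wedgeContract, ContinuousAlternatingMap.add_apply, curryLeft_apply_apply,
      wedgeOne_apply]
    -- The term in which `α` meets `X` is the right-hand side; each of the others cancels with the
    -- corresponding term of `α ∧ ι_X a`, whose index is shifted by one and whose sign is therefore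
    -- opposite.
    rw [Fin.sum_univ_succ, add_assoc, ← Finset.sum_add_distrib, Finset.sum_eq_zero]
    · simp
    · intro i _
      simp only [Fin.val_succ, pow_succ, Matrix.cons_val_succ]
      have : (i.succ.removeNth (Matrix.vecCons X v) : Fin (k+1) → Model m) =
          Matrix.vecCons X (i.removeNth v) := by
        ext j
        cases j using Fin.cases <;> simp [Fin.removeNth, Matrix.vecCons]
      simp [this]

/-- The antiderivation rule, in which `ι_X(α ∧ a)` disappears because `α ∧ a` has degree `m + 2`. -/
lemma wedgeOne_curryLeft_top (α : Model m →L[ℝ] ℝ) (X : Model m) (a : Alt m (m + 1)) :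
    wedgeOne α (a.curryLeft X) = α X • a := by
  have h := curryLeft_wedgeOne α X a
  rwa [Subsingleton.elim (wedgeOne α a) 0, curryLeft_zero, _root_.zero_apply,
    zero_add] at h

@[simp] lemma covec_apply (j : Fin (m + 1)) (v : Model m) : covec m j v = v j := rfl

lemma sum_covec_smul_vec (v : Model m) : ∑ j, covec m j v • vec m j = v := by
  ext i
  simp [vec, Pi.single_apply]

lemma sum_apply_vec_smul_covec (α : Model m →L[ℝ] ℝ) : ∑ j, α (vec m j) • covec m j = α := by
  ext v
  conv_rhs => rw [← sum_covec_smul_vec v, _root_.map_sum]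
  simp [mul_comm]

lemma sum_smulRight_covec {F : Type*} [NormedAddCommGroup F] [NormedSpace ℝ F]
    (f : Model m →L[ℝ] F) :
    ∑ j, (covec m j).smulRight (f (vec m j)) = f := by
  ext v
  conv_rhs => rw [← sum_covec_smul_vec v, _root_.map_sum]
  simp

lemma alternatizeUncurryFin_eq_sum (f : Model m →L[ℝ] Alt m k) :
    alternatizeUncurryFin f = ∑ j, wedgeOne (covec m j) (f (vec m j)) := by
  conv_lhs => rw [← sum_smulRight_covec f]
  rw [← alternatizeUncurryFinCLM_apply, _root_.map_sum]
  rfl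

/-- The sum over dual bases is the antisymmetrisation of the curried form, and antisymmetrising a
form that is already alternating multiplies it by its degree. -/
lemma sum_wedgeContract_covec_vec (a : Alt m k) :
    ∑ j, wedgeContract (covec m j) (vec m j) a = (k : ℝ) • a := by
  cases k with
  | zero => simp [wedgeContract]
  | succ k =>
    have := alternatizeUncurryFin_curryLeft a
    rw [alternatizeUncurryFin_eq_sum] at this
    simp only [wedgeContract, this]
    rw [Nat.cast_smul_eq_nsmul]

/-- An `m`-form is determined by its wedge products with covectors. -/
lemma eq_of_wedgeOne_eq {a b : Alt m m} (h : ∀ α, wedgeOne α a = wedgeOne α b) : a = b := by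
  -- An explicit inverse: by the antiderivation rule the sum is `(m + 1) • c - m • c`. The same
  -- formula defines `lower`.
  have key : ∀ c : Alt m m, ∑ j, (wedgeOne (covec m j) c).curryLeft (vec m j) = c := fun c => by
    have : ∀ j, (wedgeOne (covec m j) c).curryLeft (vec m j) =
        c - wedgeContract (covec m j) (vec m j) c := fun j => by
      rw [eq_sub_iff_add_eq, curryLeft_wedgeOne]
      simp [vec]
    simp only [this, Finset.sum_sub_distrib, sum_wedgeContract_covec_vec]
    simp [← Nat.cast_smul_eq_nsmul ℝ, add_smul]
  rw [← key a, ← key b]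
  simp only [h]

lemma wedgeOne_comp (α : Model m →L[ℝ] ℝ) (a : Alt m k) (A : Model m →L[ℝ] Model m) :
    (wedgeOne α a).compContinuousLinearMap A =
      wedgeOne (α.comp A) (a.compContinuousLinearMap A) := by
  ext v
  simp only [compContinuousLinearMap_apply, wedgeOne_apply]
  rfl

lemma wedgeContract_comp (α : Model m →L[ℝ] ℝ) (X : Model m) (a : Alt m k)
    (A : Model m →L[ℝ] Model m) :
    (wedgeContract α (A X) a).compContinuousLinearMap A =
      wedgeContract (α.comp A) X (a.compContinuousLinearMap A) := by
  cases k with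
  | zero => rfl
  | succ k =>
    simp only [wedgeContract]
    rw [wedgeOne_comp]
    congr 1
    exact (curryLeft_compContinuousLinearMap a A X).symm

/-- The derivative of `A ↦ A^* a` at the identity inserts the endomorphism into one slot at a time;
for `v ↦ α v • X` the result is `α ∧ ι_X a`. This is the link between frame changes and interior
products. -/
lemma fderivComp_id_smulRight (a : Alt m k) (α : Model m →L[ℝ] ℝ) (X : Model m) :
    a.fderivCompContinuousLinearMap (.id ℝ _) (α.smulRight X) = wedgeContract α X a := by
  cases k with
  | zero => simp [fderivCompContinuousLinearMap_of_isEmpty, wedgeContract]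
  | succ k =>
    rw [fderivCompContinuousLinearMap_eq_alternatizeUncurryFin]
    simp only [wedgeContract, wedgeOne, ContinuousLinearMap.comp_apply,
      alternatizeUncurryFinCLM_apply]
    congr 1
    ext x v
    simp

lemma fderivComp_id_eq_sum (a : Alt m k) (A : Model m →L[ℝ] Model m) :
    a.fderivCompContinuousLinearMap (.id ℝ _) A =
      ∑ j, wedgeContract (covec m j) (A (vec m j)) a := by
  conv_lhs => rw [← sum_smulRight_covec A, _root_.map_sum]
  simp only [fderivComp_id_smulRight]

variable {ι : Type*} {r : ι → ℕ}

/-- The characterisation through which `lower` is always handled. `T(e^j ∧ b)` is a top form, so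
wedging its contraction by `e_j` with `α` yields `α(e_j) • T(e^j ∧ b)`, and linearity in the
covector reassembles `T(α ∧ b)`. -/
lemma wedgeOne_lower (T : ((i : ι) → Alt m (r i + 1)) →L[ℝ] Alt m (m + 1))
    (α : Model m →L[ℝ] ℝ) (b : (i : ι) → Alt m (r i)) :
    wedgeOne α (lower (⇑T) b) = T fun i => wedgeOne α (b i) := by
  simp only [lower, wedgeOne_sum, wedgeOne_curryLeft_top]
  have : (fun i => wedgeOne α (b i)) =
      ∑ j, α (vec m j) • fun i => wedgeOne (covec m j) (b i) := by
    funext i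
    conv_lhs => rw [← sum_apply_vec_smul_covec α]
    simp [← wedgeOneL_apply]
  rw [this]
  simp

lemma wedgeContract_covec_sum (α : Model m →L[ℝ] ℝ) (X : Model m) (a : Alt m k) :
    wedgeContract α X a = ∑ j, α (vec m j) • wedgeContract (covec m j) X a := by
  cases k with
  | zero => simp [wedgeContract]
  | succ k =>
    conv_lhs => rw [← sum_apply_vec_smul_covec α]
    simp [wedgeContract, ← wedgeOneL_apply]

lemma wedgeOne_lowerContract (T : ((i : ι) → Alt m (r i)) →L[ℝ] Alt m (m + 1))
    (α : Model m →L[ℝ] ℝ) (X : Model m) (a : (i : ι) → Alt m (r i)) :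
    wedgeOne α (lowerContract (⇑T) X a) = T fun i => wedgeContract α X (a i) := by
  simp only [lowerContract, wedgeOne_sum, wedgeOne_curryLeft_top]
  have : (fun i => wedgeContract α X (a i)) =
      ∑ j, α (vec m j) • fun i => wedgeContract (covec m j) X (a i) := by
    funext i
    rw [wedgeContract_covec_sum]
    simp
  rw [this]
  simp

end FibreAlgebra

end FieldDiff

namespace FieldDiff

open ContinuousAlternatingMap (compContinuousLinearMapCLM alternatizeUncurryFin
  alternatizeUncurryFinCLM)

/-! ### Frame independence of the Lagrangian and of its derivatives -/

section NaturalLagrangian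

variable {m : ℕ} {ι : Type*} {r : ι → ℕ}

/-- The two `m`-forms are compared through their wedge products with covectors. As `A` is
invertible, every covector is `β ∘ A`, and for these the characterisation of `lower` reduces the
claim to the naturality of `T`. -/
lemma lower_comp {T T' : ((i : ι) → Alt m (r i + 1)) →L[ℝ] Alt m (m + 1)}
    (A : Model m ≃L[ℝ] Model m)
    (h : ∀ F : (i : ι) → Alt m (r i + 1),
      T' (fun i => (F i).compContinuousLinearMap (A : Model m →L[ℝ] Model m)) =
        (T F).compContinuousLinearMap (A : Model m →L[ℝ] Model m))
    (b : (i : ι) → Alt m (r i)) :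
    lower (⇑T') (fun i => (b i).compContinuousLinearMap (A : Model m →L[ℝ] Model m)) =
      (lower (⇑T) b).compContinuousLinearMap (A : Model m →L[ℝ] Model m) := by
  refine eq_of_wedgeOne_eq fun α => ?_
  obtain ⟨β, rfl⟩ : ∃ β : Model m →L[ℝ] ℝ, α = β.comp (A : Model m →L[ℝ] Model m) :=
    ⟨α.comp (A.symm : Model m →L[ℝ] Model m), by ext; simp⟩
  rw [wedgeOne_lower, ← wedgeOne_comp, wedgeOne_lower, ← h]
  simp only [wedgeOne_comp]

lemma lowerContract_comp {T T' : ((i : ι) → Alt m (r i)) →L[ℝ] Alt m (m + 1)}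
    (A : Model m ≃L[ℝ] Model m)
    (h : ∀ F : (i : ι) → Alt m (r i),
      T' (fun i => (F i).compContinuousLinearMap (A : Model m →L[ℝ] Model m)) =
        (T F).compContinuousLinearMap (A : Model m →L[ℝ] Model m))
    (X : Model m) (a : (i : ι) → Alt m (r i)) :
    lowerContract (⇑T') X (fun i => (a i).compContinuousLinearMap (A : Model m →L[ℝ] Model m)) =
      (lowerContract (⇑T) (A X) a).compContinuousLinearMap (A : Model m →L[ℝ] Model m) := by
  refine eq_of_wedgeOne_eq fun α => ?_
  obtain ⟨β, rfl⟩ : ∃ β : Model m →L[ℝ] ℝ, α = β.comp (A : Model m →L[ℝ] Model m) :=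
    ⟨α.comp (A.symm : Model m →L[ℝ] Model m), by ext; simp⟩
  rw [wedgeOne_lowerContract, ← wedgeOne_comp, wedgeOne_lowerContract, ← h]
  have := fun i => wedgeContract_comp β X (a i) (A : Model m →L[ℝ] Model m)
  simp only [← this]
  rfl

variable [Fintype ι]

/-- `Jet.pull` as a continuous linear map. -/
noncomputable def Jet.pullL (A : Model m →L[ℝ] Model m) : Jet m r →L[ℝ] Jet m r :=
  (ContinuousLinearMap.piMap fun _ => compContinuousLinearMapCLM A).prodMap
    (ContinuousLinearMap.piMap fun _ => compContinuousLinearMapCLM A)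

omit [Fintype ι] in
@[simp] lemma Jet.pullL_apply (A : Model m →L[ℝ] Model m) (ξ : Jet m r) :
    Jet.pullL A ξ = Jet.pull A ξ := rfl

/-- The infinitesimal change of frame. -/
noncomputable def Jet.deriv (A : Model m →L[ℝ] Model m) (ξ : Jet m r) : Jet m r :=
  (fun i => (ξ.1 i).fderivCompContinuousLinearMap (.id ℝ _) A,
    fun i => (ξ.2 i).fderivCompContinuousLinearMap (.id ℝ _) A)

lemma hasDerivAt_alt_comp_id_add {k : ℕ} (A : Model m →L[ℝ] Model m) (a : Alt m k) :
    HasDerivAt (fun t : ℝ => a.compContinuousLinearMap (.id ℝ _ + t • A))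
      (a.fderivCompContinuousLinearMap (.id ℝ _) A) 0 := by
  have h1 := (((hasDerivAt_id (0 : ℝ)).smul_const A).const_add
    (ContinuousLinearMap.id ℝ (Model m))).hasFDerivAt
  have h0 : ContinuousLinearMap.id ℝ (Model m) + (0 : ℝ) • A = .id ℝ _ := by
    rw [zero_smul ℝ A, add_zero]
  have := ((hasFDerivAt_const a (0 : ℝ)).continuousAlternatingMapCompContinuousLinearMap
    h1).hasDerivAt
  simpa [h0] using this

lemma Jet.hasDerivAt_pull (A : Model m →L[ℝ] Model m) (ξ : Jet m r) :
    HasDerivAt (fun t : ℝ => Jet.pull (.id ℝ _ + t • A) ξ) (Jet.deriv A ξ) 0 :=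
  (hasDerivAt_pi.2 fun i => hasDerivAt_alt_comp_id_add A (ξ.1 i)).prodMk
    (hasDerivAt_pi.2 fun i => hasDerivAt_alt_comp_id_add A (ξ.2 i))

omit [Fintype ι] in
@[simp] lemma Jet.pull_id (ξ : Jet m r) : Jet.pull (.id ℝ _) ξ = ξ := by
  ext <;> rfl

variable (Λ : NaturalLagrangian m r)

lemma NaturalLagrangian.contDiffAt {ξ : Jet m r} (hξ : ξ ∈ Λ.dom) :
    ContDiffAt ℝ ∞ Λ.toFun ξ :=
  Λ.contDiffOn.contDiffAt (Λ.isOpen_dom.mem_nhds hξ)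

lemma NaturalLagrangian.hasFDerivAt {ξ : Jet m r} (hξ : ξ ∈ Λ.dom) :
    HasFDerivAt Λ.toFun (fderiv ℝ Λ.toFun ξ) ξ :=
  ((Λ.contDiffAt hξ).differentiableAt (by simp)).hasFDerivAt

/-- Frame independence holds on the open set `Λ.dom`, so it may be differentiated in the jet with
the frame change held fixed. -/
lemma NaturalLagrangian.fderiv_pull (A : Model m ≃L[ℝ] Model m) {ξ : Jet m r} (hξ : ξ ∈ Λ.dom)
    (η : Jet m r) :
    fderiv ℝ Λ.toFun (Jet.pull (A : Model m →L[ℝ] Model m) ξ)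
        (Jet.pull (A : Model m →L[ℝ] Model m) η) =
      (fderiv ℝ Λ.toFun ξ η).compContinuousLinearMap (A : Model m →L[ℝ] Model m) := by
  have h1 := (Λ.hasFDerivAt (Λ.pull_mem A ξ hξ)).comp ξ
    (Jet.pullL (A : Model m →L[ℝ] Model m)).hasFDerivAt
  have h2 := (compContinuousLinearMapCLM (A : Model m →L[ℝ] Model m)).hasFDerivAt.comp ξ
    (Λ.hasFDerivAt hξ)
  have h3 : (Λ.toFun ∘ Jet.pullL (A : Model m →L[ℝ] Model m)) =ᶠ[𝓝 ξ]
      (compContinuousLinearMapCLM (A : Model m →L[ℝ] Model m)) ∘ Λ.toFun := by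
    filter_upwards [Λ.isOpen_dom.mem_nhds hξ] with ζ hζ
    exact Λ.map_pull A ζ hζ
  exact congrArg (fun f => f η) ((h1.congr_of_eventuallyEq h3.symm).unique h2)

/-- Infinitesimal frame independence. -/
lemma NaturalLagrangian.fderiv_deriv (A : Model m →L[ℝ] Model m) {ξ : Jet m r} (hξ : ξ ∈ Λ.dom) :
    fderiv ℝ Λ.toFun ξ (Jet.deriv A ξ) =
      (Λ.toFun ξ).fderivCompContinuousLinearMap (.id ℝ _) A := by
  have h1 : HasDerivAt (fun t : ℝ => Λ.toFun (Jet.pull (.id ℝ _ + t • A) ξ))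
      (fderiv ℝ Λ.toFun ξ (Jet.deriv A ξ)) 0 := by
    have h := Jet.hasDerivAt_pull A ξ
    refine HasFDerivAt.comp_hasDerivAt (0 : ℝ) ?_ h
    rw [zero_smul ℝ A, add_zero, Jet.pull_id]
    exact Λ.hasFDerivAt hξ
  have h2 := hasDerivAt_alt_comp_id_add A (Λ.toFun ξ)
  have h3 : (fun t : ℝ => Λ.toFun (Jet.pull (.id ℝ _ + t • A) ξ)) =ᶠ[𝓝 0]
      fun t : ℝ => (Λ.toFun ξ).compContinuousLinearMap (.id ℝ _ + t • A) := by
    -- Frame independence is assumed for invertible maps only; the invertible ones form a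
    -- neighbourhood of the identity, so `id + t A` qualifies for small `t`.
    have hc : Tendsto (fun t : ℝ => ContinuousLinearMap.id ℝ (Model m) + t • A) (𝓝 0)
        (𝓝 ((ContinuousLinearEquiv.refl ℝ (Model m) : Model m →L[ℝ] Model m))) := by
      have : Continuous fun t : ℝ => ContinuousLinearMap.id ℝ (Model m) + t • A := by fun_prop
      have h := this.tendsto 0
      rwa [zero_smul ℝ A, add_zero] at h
    filter_upwards [hc (ContinuousLinearEquiv.nhds _)] with t ht
    obtain ⟨B, hB⟩ := ht
    change (B : Model m →L[ℝ] Model m) = ContinuousLinearMap.id ℝ (Model m) + t • A at hB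
    rw [← hB]
    exact Λ.map_pull B ξ hξ
  exact (h1.congr_of_eventuallyEq h3.symm).unique h2

/-- The derivative of `L̃` in the direction of the fields. -/
noncomputable def NaturalLagrangian.d₀ (ξ : Jet m r) :
    ((i : ι) → Alt m (r i)) →L[ℝ] Alt m (m + 1) :=
  (fderiv ℝ Λ.toFun ξ).comp (.inl ℝ _ _)

/-- The derivative of `L̃` in the direction of the field strengths. -/
noncomputable def NaturalLagrangian.d₁ (ξ : Jet m r) :
    ((i : ι) → Alt m (r i + 1)) →L[ℝ] Alt m (m + 1) :=
  (fderiv ℝ Λ.toFun ξ).comp (.inr ℝ _ _)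

lemma NaturalLagrangian.fderiv_eq (ξ η : Jet m r) :
    fderiv ℝ Λ.toFun ξ η = Λ.d₀ ξ η.1 + Λ.d₁ ξ η.2 := by
  simp [NaturalLagrangian.d₀, NaturalLagrangian.d₁, ← map_add]

lemma NaturalLagrangian.d₁_pull (A : Model m ≃L[ℝ] Model m) {ξ : Jet m r} (hξ : ξ ∈ Λ.dom)
    (F : (i : ι) → Alt m (r i + 1)) :
    Λ.d₁ (Jet.pull (A : Model m →L[ℝ] Model m) ξ)
        (fun i => (F i).compContinuousLinearMap (A : Model m →L[ℝ] Model m)) =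
      (Λ.d₁ ξ F).compContinuousLinearMap (A : Model m →L[ℝ] Model m) := by
  have := Λ.fderiv_pull A hξ (0, F)
  rw [fderiv_eq, fderiv_eq] at this
  simp only [Jet.pull, Pi.zero_apply, map_zero, zero_add] at this
  have h0 : (fun i => ((0 : Alt m (r i)).compContinuousLinearMap
    (A : Model m →L[ℝ] Model m))) = 0 := by ext; simp
  rw [h0, map_zero, zero_add] at this
  exact this

/-- The interior product of the Lagrangian is determined by its derivatives. -/
lemma NaturalLagrangian.curryLeft_eq {ξ : Jet m r} (hξ : ξ ∈ Λ.dom) (X : Model m) :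
    (Λ.toFun ξ).curryLeft X = lowerContract (⇑(Λ.d₀ ξ)) X ξ.1 +
      lower (⇑(Λ.d₁ ξ)) (fun i => (ξ.2 i).curryLeft X) := by
  refine eq_of_wedgeOne_eq fun α => ?_
  rw [wedgeOne_add, wedgeOne_lowerContract, wedgeOne_lower]
  -- The frame is varied in the direction `α ⊗ X`, which turns each term into `α ∧ ι_X` of a form.
  have := Λ.fderiv_deriv (α.smulRight X) hξ
  rw [fderiv_eq, fderivComp_id_smulRight] at this
  simp only [Jet.deriv, fderivComp_id_smulRight] at this
  exact this.symm

end NaturalLagrangian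

end FieldDiff

namespace FieldDiff

/-! ### Tangent maps and charts -/

section Charts

variable {m k : ℕ} {M : Type*} [TopologicalSpace M] [ChartedSpace (Model m) M]
  {N : Type*} [TopologicalSpace N] [ChartedSpace (Model m) N]
  {P : Type*} [TopologicalSpace P] [ChartedSpace (Model m) P]

/-- The preferred chart at `x`. -/
noncomputable abbrev ch (m : ℕ) {M : Type*} [TopologicalSpace M] [ChartedSpace (Model m) M] (x : M) :
    PartialEquiv M (Model m) := extChartAt 𝓘(ℝ, Model m) x

lemma ch_target_mem {x₀ : M} {z : Model m} (hz : z ∈ (ch m x₀).target) :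
    (ch m x₀).target ∈ 𝓝 z :=
  (isOpen_extChartAt_target x₀).mem_nhds hz

lemma ch_source_mem {x₀ y : M} (hy : y ∈ (ch m x₀).source) : (ch m x₀).source ∈ 𝓝 y :=
  (isOpen_extChartAt_source x₀).mem_nhds hy

@[simp] lemma ch_model (x : Model m) : ch m x = PartialEquiv.refl (Model m) := by
  simp [ch, chartAt_self_eq]

lemma tmap_comp {g : M → P} {f : N → M} {x : N}
    (hg : MDifferentiableAt 𝓘(ℝ, Model m) 𝓘(ℝ, Model m) g (f x))
    (hf : MDifferentiableAt 𝓘(ℝ, Model m) 𝓘(ℝ, Model m) f x) :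
    tmap m (fun y => g (f y)) x = (tmap m g (f x)).comp (tmap m f x) :=
  mfderiv_comp x hg hf

lemma tmap_id (x : M) : tmap m (fun y : M => y) x = .id ℝ _ := mfderiv_id

lemma tmap_congr {f g : N → M} {x : N} (h : f =ᶠ[𝓝 x] g) : tmap m f x = tmap m g x :=
  h.mfderiv_eq

lemma tmap_model (f : Model m → Model m) (z : Model m) : tmap m f z = fderiv ℝ f z :=
  mfderiv_eq_fderiv

lemma pullback_comp {g : M → P} {f : N → M} {x : N} (η : MForm m P k)
    (hg : MDifferentiableAt 𝓘(ℝ, Model m) 𝓘(ℝ, Model m) g (f x))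
    (hf : MDifferentiableAt 𝓘(ℝ, Model m) 𝓘(ℝ, Model m) f x) :
    pullback (fun y => g (f y)) η x = pullback f (pullback g η) x := by
  simp only [pullback, tmap_comp hg hf]
  rfl

lemma pullback_id (η : MForm m M k) : pullback (fun y : M => y) η = η := by
  funext x
  simp only [pullback, tmap_id]
  rfl

lemma pullback_congr {f g : N → M} {x : N} (h : f =ᶠ[𝓝 x] g) (η : MForm m M k) :
    pullback f η x = pullback g η x := by
  simp only [pullback, tmap_congr h, h.self_of_nhds]

lemma inChart_model (x : Model m) (η : MForm m (Model m) k) : inChart x η = η := by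
  have : inChart x η = pullback (fun y => y) η := by
    unfold inChart
    rw [show extChartAt 𝓘(ℝ, Model m) x = _ from ch_model x]
    rfl
  rw [this, pullback_id]

lemma extD_model (η : MForm m (Model m) k) : extD η = extDeriv η := by
  funext x
  unfold extD
  rw [inChart_model, show extChartAt 𝓘(ℝ, Model m) x = _ from ch_model x]
  have : tmap m (PartialEquiv.refl (Model m)) x = .id ℝ _ := tmap_id x
  rw [this]
  rfl

variable [IsManifold 𝓘(ℝ, Model m) ∞ M] [IsManifold 𝓘(ℝ, Model m) ∞ N]

lemma contMDiffAt_ch {x₀ y : M} (hy : y ∈ (ch m x₀).source) :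
    ContMDiffAt 𝓘(ℝ, Model m) 𝓘(ℝ, Model m) ∞ (ch m x₀) y :=
  contMDiffAt_extChartAt' (by simpa [ch] using hy)

lemma contMDiffAt_ch_symm {x₀ : M} {z : Model m} (hz : z ∈ (ch m x₀).target) :
    ContMDiffAt 𝓘(ℝ, Model m) 𝓘(ℝ, Model m) ∞ (ch m x₀).symm z :=
  (contMDiffOn_extChartAt_symm x₀).contMDiffAt (ch_target_mem hz)

lemma mdiffAt_ch {x₀ y : M} (hy : y ∈ (ch m x₀).source) :
    MDifferentiableAt 𝓘(ℝ, Model m) 𝓘(ℝ, Model m) (ch m x₀) y :=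
  (contMDiffAt_ch hy).mdifferentiableAt (by simp)

lemma mdiffAt_ch_symm {x₀ : M} {z : Model m} (hz : z ∈ (ch m x₀).target) :
    MDifferentiableAt 𝓘(ℝ, Model m) 𝓘(ℝ, Model m) (ch m x₀).symm z :=
  (contMDiffAt_ch_symm hz).mdifferentiableAt (by simp)

lemma tmap_ch_comp_symm {x₀ : M} {z : Model m} (hz : z ∈ (ch m x₀).target) :
    (tmap m (ch m x₀) ((ch m x₀).symm z)).comp (tmap m (ch m x₀).symm z) = .id ℝ _ := by
  rw [← tmap_comp (mdiffAt_ch ((ch m x₀).map_target hz)) (mdiffAt_ch_symm hz), ← tmap_id z]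
  refine tmap_congr ?_
  filter_upwards [ch_target_mem hz] with w hw
  exact (ch m x₀).right_inv hw

lemma tmap_ch_symm_comp {x₀ y : M} (hy : y ∈ (ch m x₀).source) :
    (tmap m (ch m x₀).symm (ch m x₀ y)).comp (tmap m (ch m x₀) y) = .id ℝ _ := by
  rw [← tmap_comp (mdiffAt_ch_symm ((ch m x₀).map_source hy)) (mdiffAt_ch hy), ← tmap_id y]
  refine tmap_congr ?_
  filter_upwards [ch_source_mem hy] with w hw
  exact (ch m x₀).left_inv hw

/-- Tangent vectors at `x` are by convention their coordinates in the preferred chart at `x`. Hence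
the value of a form at `x` and its chart expression at the base point agree with no change of frame.
-/
lemma tmap_ch_self (x : M) : tmap m (ch m x) x = .id ℝ _ := by
  unfold tmap
  rw [(mdiffAt_ch (mem_extChartAt_source x)).mfderiv]
  have h : writtenInExtChartAt 𝓘(ℝ, Model m) 𝓘(ℝ, Model m) x (ch m x) =ᶠ[𝓝 (ch m x x)] id := by
    filter_upwards [ch_target_mem ((ch m x).map_source (mem_extChartAt_source x))] with z hz
    have := (ch m x).right_inv hz
    simpa [writtenInExtChartAt, chartAt_self_eq] using this
  simp only [modelWithCornersSelf_coe, range_id, fderivWithin_univ]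
  rw [h.fderiv_eq, fderiv_id]

lemma tmap_ch_symm_self (x : M) : tmap m (ch m x).symm (ch m x x) = .id ℝ _ := by
  have := tmap_ch_symm_comp (m := m) (x₀ := x) (y := x) (mem_extChartAt_source x)
  rwa [tmap_ch_self (m := m) x, ContinuousLinearMap.comp_id] at this

lemma inChart_self (x : M) (η : MForm m M k) : inChart x η (ch m x x) = η x := by
  have h : (ch m x).symm (ch m x x) = x := (ch m x).left_inv (mem_extChartAt_source x)
  have h2 := tmap_ch_symm_self (m := m) x
  simp only [inChart, pullback]
  rw [h2, h]
  rfl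

end Charts

/-! ### Smoothness of (families of) forms at a point -/

section SmoothAt

variable {m k : ℕ} {n : WithTop ℕ∞} {M : Type*} [TopologicalSpace M] [ChartedSpace (Model m) M]
  {N : Type*} [TopologicalSpace N] [ChartedSpace (Model m) N]

lemma one_add_one_le : (1 : WithTop ℕ∞) + 1 ≤ ∞ := by
  rw [one_add_one_eq_two]
  exact WithTop.coe_le_coe.2 (le_top : (2 : ℕ∞) ≤ ⊤)

/-- `η` is `C^n` at `y`. -/
def SmoothAt (n : WithTop ℕ∞) (η : MForm m M k) (y : M) : Prop :=
  ContDiffAt ℝ n (inChart y η) (ch m y y)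

/-- The family of forms `η` is jointly `C^n` at `(τ, y)`. -/
def SmoothFam (n : WithTop ℕ∞) (η : ℝ → MForm m M k) (τ : ℝ) (y : M) : Prop :=
  ContDiffAt ℝ n (fun p : ℝ × Model m => inChart y (η p.1) p.2) (τ, ch m y y)

lemma smoothAt_iff_smoothFam {η : MForm m M k} {y : M} (τ : ℝ) :
    SmoothAt n η y ↔ SmoothFam n (fun _ => η) τ y := by
  constructor
  · intro h
    exact ContDiffAt.comp (τ, ch m y y) (f := Prod.snd) h contDiffAt_snd
  · intro h
    exact ContDiffAt.comp (ch m y y) (f := fun z => (τ, z)) h (by fun_prop)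

lemma SmoothFam.smoothAt {η : ℝ → MForm m M k} {τ : ℝ} {y : M} (h : SmoothFam n η τ y) :
    SmoothAt n (η τ) y :=
  ContDiffAt.comp (ch m y y) (f := fun z => (τ, z)) h (by fun_prop)

lemma SmoothAt.of_le {η : MForm m M k} {y : M} {n' : WithTop ℕ∞} (h : SmoothAt n η y)
    (hn : n' ≤ n) : SmoothAt n' η y := ContDiffAt.of_le h hn

lemma SmoothFam.of_le {η : ℝ → MForm m M k} {τ : ℝ} {y : M} {n' : WithTop ℕ∞}
    (h : SmoothFam n η τ y) (hn : n' ≤ n) : SmoothFam n' η τ y := ContDiffAt.of_le h hn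

variable [IsManifold 𝓘(ℝ, Model m) ∞ M] [IsManifold 𝓘(ℝ, Model m) ∞ N]

omit [IsManifold 𝓘(ℝ, Model m) ∞ M] [IsManifold 𝓘(ℝ, Model m) ∞ N] in
lemma mdiffAt_slice {g : ℝ → N → M} {τ : ℝ} {x : N}
    (hg : ContMDiffAt (𝓘(ℝ, ℝ).prod 𝓘(ℝ, Model m)) 𝓘(ℝ, Model m) n
      (fun p : ℝ × N => g p.1 p.2) (τ, x)) :
    ContMDiffAt 𝓘(ℝ, Model m) 𝓘(ℝ, Model m) n (g τ) x :=
  ContMDiffAt.comp x (f := fun y => (τ, y)) hg (contMDiffAt_const.prodMk contMDiffAt_id)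

lemma contDiffAt_localRep {g : ℝ → N → M} {τ : ℝ} {x₀ : N} {y₀ : M} {z : Model m}
    (hn : n ≤ ∞) (hz : z ∈ (ch m x₀).target)
    (hg : ContMDiffAt (𝓘(ℝ, ℝ).prod 𝓘(ℝ, Model m)) 𝓘(ℝ, Model m) n
      (fun p : ℝ × N => g p.1 p.2) (τ, (ch m x₀).symm z))
    (hy : g τ ((ch m x₀).symm z) ∈ (ch m y₀).source) :
    ContDiffAt ℝ n (fun p : ℝ × Model m => ch m y₀ (g p.1 ((ch m x₀).symm p.2))) (τ, z) := by
  have h1 : ContMDiffAt (𝓘(ℝ, ℝ).prod 𝓘(ℝ, Model m)) (𝓘(ℝ, ℝ).prod 𝓘(ℝ, Model m)) n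
      (fun p : ℝ × Model m => (p.1, (ch m x₀).symm p.2)) (τ, z) :=
    contMDiffAt_fst.prodMk (ContMDiffAt.comp (τ, z) ((contMDiffAt_ch_symm hz).of_le hn)
      contMDiffAt_snd)
  have h2 := ContMDiffAt.comp (τ, z) hg h1
  have h3 := ContMDiffAt.comp (τ, z) ((contMDiffAt_ch hy).of_le hn) h2
  rw [← contMDiffAt_iff_contDiffAt, modelWithCornersSelf_prod, ← chartedSpaceSelf_prod]
  exact h3

/-- The expression in charts of a pullback. -/
lemma inChart_pullback_eventuallyEq {g : ℝ → N → M} {τ : ℝ} {x₀ : N} {y₀ : M} {z : Model m}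
    (η : ℝ → MForm m M k) (hz : z ∈ (ch m x₀).target)
    (hg : ContMDiffAt (𝓘(ℝ, ℝ).prod 𝓘(ℝ, Model m)) 𝓘(ℝ, Model m) 1
      (fun p : ℝ × N => g p.1 p.2) (τ, (ch m x₀).symm z))
    (hy : g τ ((ch m x₀).symm z) ∈ (ch m y₀).source) :
    (fun p : ℝ × Model m => inChart x₀ (pullback (g p.1) (η p.1)) p.2) =ᶠ[𝓝 (τ, z)]
      fun p => (inChart y₀ (η p.1) (ch m y₀ (g p.1 ((ch m x₀).symm p.2)))).compContinuousLinearMap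
        ((fderiv ℝ (fun p : ℝ × Model m => ch m y₀ (g p.1 ((ch m x₀).symm p.2))) p).comp
          (.inr ℝ ℝ (Model m))) := by
  have hc : Tendsto (fun p : ℝ × Model m => (p.1, (ch m x₀).symm p.2)) (𝓝 (τ, z))
      (𝓝 (τ, (ch m x₀).symm z)) :=
    continuousAt_fst.prodMk
      (ContinuousAt.comp (x := (τ, z)) (contMDiffAt_ch_symm hz).continuousAt continuousAt_snd)
  have e1 := hc.eventually (contMDiffAt_iff_contMDiffAt_nhds (by simp) |>.1 hg)
  have e2 := hc.eventually (hg.continuousAt.eventually (ch_source_mem hy))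
  have e3 : ∀ᶠ p : ℝ × Model m in 𝓝 (τ, z), p.2 ∈ (ch m x₀).target :=
    continuousAt_snd.eventually (ch_target_mem hz)
  have e4 := ((contDiffAt_localRep (by simp) hz hg hy).eventually (by simp))
  filter_upwards [e1, e2, e3, e4] with p h1 h2 h3 h4
  have d1 : MDifferentiableAt 𝓘(ℝ, Model m) 𝓘(ℝ, Model m) (g p.1) ((ch m x₀).symm p.2) :=
    (mdiffAt_slice h1).mdifferentiableAt (by simp)
  -- The spatial tangent map is the restriction of the joint derivative to `0 × Model m`; in this
  -- form it is visibly smooth in `(τ, z)`.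
  have hF : (fderiv ℝ (fun p : ℝ × Model m => ch m y₀ (g p.1 ((ch m x₀).symm p.2))) p).comp
      (.inr ℝ ℝ (Model m)) = tmap m (fun w => ch m y₀ (g p.1 ((ch m x₀).symm w))) p.2 := by
    rw [tmap_model]
    have hp := (h4.differentiableAt (by simp)).hasFDerivAt
    have := HasFDerivAt.comp p.2 (f := fun w => (p.1, w)) hp
      ((hasFDerivAt_const p.1 p.2).prodMk (hasFDerivAt_id p.2))
    exact this.fderiv.symm
  have d2 : MDifferentiableAt 𝓘(ℝ, Model m) 𝓘(ℝ, Model m)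
      (fun w => g p.1 ((ch m x₀).symm w)) p.2 :=
    MDifferentiableAt.comp p.2 d1 (mdiffAt_ch_symm h3)
  have d3 : MDifferentiableAt 𝓘(ℝ, Model m) 𝓘(ℝ, Model m)
      (fun w => ch m y₀ (g p.1 ((ch m x₀).symm w))) p.2 :=
    MDifferentiableAt.comp p.2 (mdiffAt_ch h2) d2
  have key := pullback_comp (g := (ch m y₀).symm)
    (f := fun w => ch m y₀ (g p.1 ((ch m x₀).symm w))) (η p.1)
    (mdiffAt_ch_symm ((ch m y₀).map_source h2)) d3
  rw [hF]
  change pullback (ch m x₀).symm (pullback (g p.1) (η p.1)) p.2 =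
    pullback (fun w => ch m y₀ (g p.1 ((ch m x₀).symm w))) (pullback (ch m y₀).symm (η p.1)) p.2
  rw [← key, ← pullback_comp (η p.1) d1 (mdiffAt_ch_symm h3)]
  refine pullback_congr ?_ _
  have : ∀ᶠ w in 𝓝 p.2, g p.1 ((ch m x₀).symm w) ∈ (ch m y₀).source :=
    d2.continuousAt.eventually (ch_source_mem h2)
  filter_upwards [this] with w hw
  exact ((ch m y₀).left_inv hw).symm

lemma _root_.ContDiffAt.alt_comp' {X V W : Type*} [NormedAddCommGroup X] [NormedSpace ℝ X]
    [NormedAddCommGroup V] [NormedSpace ℝ V] [FiniteDimensional ℝ V]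
    [NormedAddCommGroup W] [NormedSpace ℝ W] {f : X → W [⋀^Fin k]→L[ℝ] ℝ} {g : X → V →L[ℝ] W}
    {x : X} (hn : n ≤ ∞) (hf : ContDiffAt ℝ n f x) (hg : ContDiffAt ℝ n g x) :
    ContDiffAt ℝ n (fun y => (f y).compContinuousLinearMap (g y)) x :=
  (contDiff_compContinuousLinearMap.contDiffAt.of_le hn).comp x (hf.prodMk hg)

/-- A pullback contains the tangent map of `g`, so one derivative of `g` is lost, and none of `η`.
-/
lemma contDiffAt_inChart_pullback {g : ℝ → N → M} {τ : ℝ} {x₀ : N} {y₀ : M} {z : Model m}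
    {η : ℝ → MForm m M k} (hn : n + 1 ≤ ∞) (hz : z ∈ (ch m x₀).target)
    (hg : ContMDiffAt (𝓘(ℝ, ℝ).prod 𝓘(ℝ, Model m)) 𝓘(ℝ, Model m) (n + 1)
      (fun p : ℝ × N => g p.1 p.2) (τ, (ch m x₀).symm z))
    (hy : g τ ((ch m x₀).symm z) ∈ (ch m y₀).source)
    (hη : ContDiffAt ℝ n (fun p : ℝ × Model m => inChart y₀ (η p.1) p.2)
      (τ, ch m y₀ (g τ ((ch m x₀).symm z)))) :
    ContDiffAt ℝ n (fun p : ℝ × Model m => inChart x₀ (pullback (g p.1) (η p.1)) p.2) (τ, z) := by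
  have hn' : n ≤ n + 1 := le_self_add
  have h1 := contDiffAt_localRep hn hz hg hy
  refine ContDiffAt.congr_of_eventuallyEq ?_
    (inChart_pullback_eventuallyEq η hz (hg.of_le le_add_self) hy)
  refine ContDiffAt.alt_comp' (hn'.trans hn) ?_ ?_
  · exact ContDiffAt.comp (τ, z)
      (f := fun p : ℝ × Model m => (p.1, ch m y₀ (g p.1 ((ch m x₀).symm p.2))))
      hη (contDiffAt_fst.prodMk (h1.of_le hn'))
  · exact (h1.fderiv_right le_rfl).clm_comp contDiffAt_const

lemma SmoothFam.pullback {g : ℝ → N → M} {τ : ℝ} {x : N} {η : ℝ → MForm m M k} (hn : n + 1 ≤ ∞)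
    (hη : SmoothFam n η τ (g τ x))
    (hg : ContMDiffAt (𝓘(ℝ, ℝ).prod 𝓘(ℝ, Model m)) 𝓘(ℝ, Model m) (n + 1)
      (fun p : ℝ × N => g p.1 p.2) (τ, x)) :
    SmoothFam n (fun σ => FieldDiff.pullback (g σ) (η σ)) τ x := by
  have hx : (ch m x).symm (ch m x x) = x := (ch m x).left_inv (mem_extChartAt_source x)
  refine contDiffAt_inChart_pullback (y₀ := g τ x) hn
    ((ch m x).map_source (mem_extChartAt_source x)) ?_ ?_ ?_
  · rwa [hx]
  · rw [hx]; exact mem_extChartAt_source _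
  · rwa [hx]

/-- A change of chart is a pullback along the identity map, read in one chart on the source and
another on the target. -/
lemma smoothFam_iff_chart {η : ℝ → MForm m M k} {τ : ℝ} {x₀ y : M} (hn : n + 1 ≤ ∞)
    (hy : y ∈ (ch m x₀).source) :
    SmoothFam n η τ y ↔
      ContDiffAt ℝ n (fun p : ℝ × Model m => inChart x₀ (η p.1) p.2) (τ, ch m x₀ y) := by
  have key : ∀ a b : M, y ∈ (ch m a).source → y ∈ (ch m b).source →
      ContDiffAt ℝ n (fun p : ℝ × Model m => inChart b (η p.1) p.2) (τ, ch m b y) →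
      ContDiffAt ℝ n (fun p : ℝ × Model m => inChart a (η p.1) p.2) (τ, ch m a y) := by
    intro a b ha hb h
    have hx : (ch m a).symm (ch m a y) = y := (ch m a).left_inv ha
    have := contDiffAt_inChart_pullback (g := fun _ (w : M) => w) (x₀ := a) (y₀ := b) (τ := τ)
      (η := η) hn ((ch m a).map_source ha) contMDiffAt_snd (by rwa [hx]) (by rwa [hx])
    simpa only [pullback_id] using this
  exact ⟨key _ _ hy (mem_extChartAt_source y), key _ _ (mem_extChartAt_source y) hy⟩

lemma smoothAt_iff_chart {η : MForm m M k} {x₀ y : M} (hn : n + 1 ≤ ∞)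
    (hy : y ∈ (ch m x₀).source) :
    SmoothAt n η y ↔ ContDiffAt ℝ n (inChart x₀ η) (ch m x₀ y) := by
  rw [smoothAt_iff_smoothFam 0, smoothFam_iff_chart hn hy]
  constructor
  · intro h
    exact ContDiffAt.comp (ch m x₀ y) (f := fun z => ((0 : ℝ), z)) h (by fun_prop)
  · intro h
    exact ContDiffAt.comp ((0 : ℝ), ch m x₀ y) (f := Prod.snd) h contDiffAt_snd

lemma isSmoothFamily_iff {η : ℝ → MForm m M k} :
    IsSmoothFamily η ↔ ∀ τ y, SmoothFam ∞ η τ y := by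
  constructor
  · intro h τ y
    exact (h y).contDiffAt ((isOpen_univ.prod (isOpen_extChartAt_target y)).mem_nhds
      ⟨mem_univ _, mem_extChartAt_target y⟩)
  · intro h x₀ p hp
    have hz : p.2 ∈ (ch m x₀).target := hp.2
    have := (smoothFam_iff_chart (n := ∞) (by simp) ((ch m x₀).map_target hz)).1 (h p.1 _)
    rw [(ch m x₀).right_inv hz] at this
    exact this.contDiffWithinAt

lemma isSmoothForm_iff {η : MForm m M k} : IsSmoothForm η ↔ ∀ y, SmoothAt ∞ η y := by
  constructor
  · intro h y
    exact (h y).contDiffAt (extChartAt_target_mem_nhds y)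
  · intro h x₀ z hz
    have := (smoothAt_iff_chart (n := ∞) (by simp) ((ch m x₀).map_target hz)).1 (h _)
    rw [(ch m x₀).right_inv hz] at this
    exact this.contDiffWithinAt

lemma SmoothAt.pullback {f : N → M} {x : N} {η : MForm m M k} (hn : n + 1 ≤ ∞)
    (hη : SmoothAt n η (f x))
    (hf : ContMDiffAt 𝓘(ℝ, Model m) 𝓘(ℝ, Model m) (n + 1) f x) :
    SmoothAt n (FieldDiff.pullback f η) x := by
  rw [smoothAt_iff_smoothFam 0] at hη ⊢
  exact SmoothFam.pullback (g := fun _ => f) hn hη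
    (ContMDiffAt.comp ((0 : ℝ), x) (f := Prod.snd) hf contMDiffAt_snd)

end SmoothAt

end FieldDiff

namespace FieldDiff

open ContinuousAlternatingMap (compContinuousLinearMapCLM alternatizeUncurryFin
  alternatizeUncurryFinCLM)

/-- Antisymmetrization of an alternating-form-valued covector. -/
noncomputable def altL (m k : ℕ) : (Model m →L[ℝ] Alt m k) →L[ℝ] Alt m (k + 1) :=
  alternatizeUncurryFinCLM ℝ (Model m) ℝ

lemma contDiff_altL {m k : ℕ} {n : WithTop ℕ∞} :
    ContDiff ℝ n (altL m k : (Model m →L[ℝ] Alt m k) → Alt m (k + 1)) :=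
  ContinuousLinearMap.contDiff (𝕜 := ℝ) (E := Model m →L[ℝ] Alt m k) (F := Alt m (k + 1)) _

lemma hasFDerivAt_altL {m k : ℕ} (f : Model m →L[ℝ] Alt m k) :
    HasFDerivAt (altL m k : (Model m →L[ℝ] Alt m k) → Alt m (k + 1)) (altL m k) f :=
  ContinuousLinearMap.hasFDerivAt (𝕜 := ℝ) (E := Model m →L[ℝ] Alt m k) (F := Alt m (k + 1)) _

lemma altL_sub {m k : ℕ} (f g : Model m →L[ℝ] Alt m k) :
    altL m k (f - g) = altL m k f - altL m k g :=
  ContinuousLinearMap.map_sub (altL m k) f g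

lemma altL_eq_sum {m k : ℕ} (f : Model m →L[ℝ] Alt m k) :
    altL m k f = ∑ j, wedgeOne (covec m j) (f (vec m j)) :=
  alternatizeUncurryFin_eq_sum f

lemma extDeriv_eq_altL {m k : ℕ} (η : MForm m (Model m) k) (z : Model m) :
    extDeriv η z = altL m k (fderiv ℝ η z) := rfl

/-! ### Naturality and smoothness of the de Rham differential -/

section ExtD

variable {m k : ℕ} {n : WithTop ℕ∞} {M : Type*} [TopologicalSpace M] [ChartedSpace (Model m) M]
  {N : Type*} [TopologicalSpace N] [ChartedSpace (Model m) N]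

lemma pullback_eventuallyEq {η η' : MForm m M k} {f : N → M} {x : N} (hf : ContinuousAt f x)
    (h : η =ᶠ[𝓝 (f x)] η') : pullback f η =ᶠ[𝓝 x] pullback f η' := by
  filter_upwards [hf.eventually h] with y hy
  simp only [pullback, hy]

variable [IsManifold 𝓘(ℝ, Model m) ∞ M] [IsManifold 𝓘(ℝ, Model m) ∞ N]

lemma extD_congr {η η' : MForm m M k} {x : M} (h : η =ᶠ[𝓝 x] η') : extD η x = extD η' x := by
  have hx : (ch m x).symm (ch m x x) = x := (ch m x).left_inv (mem_extChartAt_source x)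
  have : inChart x η =ᶠ[𝓝 (ch m x x)] inChart x η' :=
    pullback_eventuallyEq (contMDiffAt_ch_symm (mem_extChartAt_target x)).continuousAt
      (by rwa [hx])
  simp only [extD]
  rw [this.extDeriv_eq]

/-- The de Rham differential commutes with pullbacks. -/
lemma extD_pullback {f : N → M} {x : N} {η : MForm m M k} (hη : SmoothAt 1 η (f x))
    (hf : ContMDiffAt 𝓘(ℝ, Model m) 𝓘(ℝ, Model m) 2 f x) :
    extD (pullback f η) x = pullback f (extD η) x := by
  have hx : (ch m x).symm (ch m x x) = x := (ch m x).left_inv (mem_extChartAt_source x)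
  set F : Model m → Model m := fun z => ch m (f x) (f ((ch m x).symm z)) with hF
  have hFx : F (ch m x x) = ch m (f x) (f x) := by simp only [hF, hx]
  have hfam : ContMDiffAt (𝓘(ℝ, ℝ).prod 𝓘(ℝ, Model m)) 𝓘(ℝ, Model m) 2
      (fun p : ℝ × N => f p.2) ((0 : ℝ), (ch m x).symm (ch m x x)) := by
    rw [hx]
    exact ContMDiffAt.comp ((0 : ℝ), x) (f := Prod.snd) hf contMDiffAt_snd
  have hys : f ((ch m x).symm (ch m x x)) ∈ (ch m (f x)).source := by
    rw [hx]; exact mem_extChartAt_source _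
  have h1 := inChart_pullback_eventuallyEq (g := fun _ => f) (fun _ => η) (y₀ := f x)
    (mem_extChartAt_target x) (hfam.of_le (by norm_num)) hys
  have h2 : ContDiffAt ℝ 2 F (ch m x x) :=
    ContDiffAt.comp (ch m x x) (f := fun z => ((0 : ℝ), z))
      (contDiffAt_localRep (g := fun _ => f) (by rw [← one_add_one_eq_two]; exact one_add_one_le)
        (mem_extChartAt_target x) hfam hys) (by fun_prop)
  have h3 : inChart x (pullback f η) =ᶠ[𝓝 (ch m x x)]
      fun z => (inChart (f x) η (F z)).compContinuousLinearMap (fderiv ℝ F z) := by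
    have hc : Tendsto (fun z : Model m => ((0 : ℝ), z)) (𝓝 (ch m x x)) (𝓝 (0, ch m x x)) :=
      Continuous.tendsto (by fun_prop) _
    filter_upwards [hc.eventually h1, h2.eventually (by simp)] with z hz hz2
    refine hz.trans ?_
    have := (hz2.differentiableAt (by simp)).hasFDerivAt.comp ((0 : ℝ), z)
      (f := Prod.snd) (hasFDerivAt_snd)
    have h4 : fderiv ℝ (fun p : ℝ × Model m => ch m (f x) (f ((ch m x).symm p.2))) (0, z) = _ :=
      this.fderiv
    rw [h4]
    congr 1
  -- The inverse chart at `x` drops out here because its tangent map at the base point is the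
  -- identity.
  have hFd : fderiv ℝ F (ch m x x) = (tmap m (ch m (f x)) (f x)).comp (tmap m f x) := by
    rw [← tmap_model, hF]
    have hfd : MDifferentiableAt 𝓘(ℝ, Model m) 𝓘(ℝ, Model m) f x :=
      hf.mdifferentiableAt (by simp)
    have e1 := tmap_comp (g := ch m (f x)) (f := f) (mdiffAt_ch (mem_extChartAt_source _)) hfd
    have e2 := tmap_comp (m := m) (g := fun y => ch m (f x) (f y)) (f := (ch m x).symm)
      (x := ch m x x) (by
        rw [hx]
        exact MDifferentiableAt.comp x (mdiffAt_ch (mem_extChartAt_source _)) hfd)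
      (mdiffAt_ch_symm (mem_extChartAt_target x))
    rw [e2, tmap_ch_symm_self (m := m) x, ContinuousLinearMap.comp_id, hx, e1]
  simp only [extD, pullback]
  rw [h3.extDeriv_eq, extDeriv_pullback (r := 2) ?_ h2 (by simp), hFx, hFd,
    show tmap m (extChartAt 𝓘(ℝ, Model m) x) x = _ from tmap_ch_self x]
  · rfl
  · rw [hFx]
    exact ContDiffAt.differentiableAt hη (by simp)

/-- `extD` uses a different chart at every point. Naturality applied to the inverse of the chart at
`x₀` shows that this single chart computes it at all points of its domain. -/
lemma inChart_extD {η : MForm m M k} {x₀ : M} {z : Model m} (hz : z ∈ (ch m x₀).target)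
    (hη : SmoothAt 1 η ((ch m x₀).symm z)) :
    inChart x₀ (extD η) z = extDeriv (inChart x₀ η) z := by
  rw [← extD_model]
  exact (extD_pullback hη ((contMDiffAt_ch_symm hz).of_le
    (by rw [← one_add_one_eq_two]; exact one_add_one_le))).symm

/-- With `d` written through the joint derivative in `(τ, z)`, joint smoothness of `d η_τ` and its
`τ`-derivative become accessible. -/
lemma eventually_inChart_extD {η : ℝ → MForm m M k} {τ : ℝ} {y : M} (h : SmoothFam 1 η τ y) :
    (fun p : ℝ × Model m => inChart y (extD (η p.1)) p.2) =ᶠ[𝓝 (τ, ch m y y)]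
      fun p => altL m k
        ((fderiv ℝ (fun p : ℝ × Model m => inChart y (η p.1) p.2) p).comp
          (.inr ℝ ℝ (Model m))) := by
  have h1 : ∀ᶠ p in 𝓝 (τ, ch m y y),
      ContDiffAt ℝ 1 (fun p : ℝ × Model m => inChart y (η p.1) p.2) p :=
    ContDiffAt.eventually h (by simp)
  have h3 : ∀ᶠ p : ℝ × Model m in 𝓝 (τ, ch m y y), p.2 ∈ (ch m y).target :=
    continuousAt_snd.eventually (ch_target_mem (mem_extChartAt_target y))
  filter_upwards [h1, h3] with p hp hp2
  have hs : ContDiffAt ℝ 1 (inChart y (η p.1)) p.2 :=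
    ContDiffAt.comp p.2 (f := fun z => (p.1, z)) hp (by fun_prop)
  have hsm : SmoothAt 1 (η p.1) ((ch m y).symm p.2) := by
    rw [smoothAt_iff_chart one_add_one_le ((ch m y).map_target hp2), (ch m y).right_inv hp2]
    exact hs
  rw [inChart_extD hp2 hsm, extDeriv]
  have := HasFDerivAt.comp p.2 (f := fun w => (p.1, w)) (hp.differentiableAt (by simp)).hasFDerivAt
    ((hasFDerivAt_const p.1 p.2).prodMk (hasFDerivAt_id p.2))
  have h4 : fderiv ℝ (inChart y (η p.1)) p.2 = _ := this.fderiv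
  rw [h4]
  rfl

lemma SmoothFam.extD {η : ℝ → MForm m M k} {τ : ℝ} {y : M} (h : SmoothFam (n + 1) η τ y) :
    SmoothFam n (fun σ => FieldDiff.extD (η σ)) τ y := by
  refine ContDiffAt.congr_of_eventuallyEq ?_ (eventually_inChart_extD (h.of_le le_add_self))
  refine contDiff_altL.contDiffAt.comp _ ?_
  exact (ContDiffAt.fderiv_right h le_rfl).clm_comp contDiffAt_const

lemma SmoothAt.extD {η : MForm m M k} {y : M} (h : SmoothAt (n + 1) η y) :
    SmoothAt n (FieldDiff.extD η) y := by
  rw [smoothAt_iff_smoothFam 0] at h ⊢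
  exact h.extD

/-! ### Velocities of families of forms -/

/-- The velocity of a family of forms at parameter `0`. -/
noncomputable def vel (η : ℝ → MForm m M k) : MForm m M k := fun x => deriv (fun τ => η τ x) 0

lemma SmoothFam.differentiableAt {η : ℝ → MForm m M k} {τ : ℝ} {x : M} (h : SmoothFam 1 η τ x) :
    DifferentiableAt ℝ (fun σ => η σ x) τ := by
  have h1 : DifferentiableAt ℝ (fun p : ℝ × Model m => inChart x (η p.1) p.2) (τ, ch m x x) :=
    ContDiffAt.differentiableAt h (by simp)
  have := DifferentiableAt.comp τ (f := fun σ => (σ, ch m x x)) h1 (by fun_prop)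
  refine this.congr_of_eventuallyEq (Eventually.of_forall fun σ => ?_)
  exact (inChart_self x (η σ)).symm

omit [IsManifold 𝓘(ℝ, Model m) ∞ M] [IsManifold 𝓘(ℝ, Model m) ∞ N] in
lemma hasDerivAt_pullback {η : ℝ → MForm m M k} {f : N → M} {x : N}
    (h : DifferentiableAt ℝ (fun σ => η σ (f x)) 0) :
    HasDerivAt (fun σ => pullback f (η σ) x) (pullback f (vel η) x) 0 :=
  (compContinuousLinearMapCLM (tmap m f x) : Alt m k →L[ℝ] Alt m k).hasFDerivAt.comp_hasDerivAt
    (0 : ℝ) h.hasDerivAt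

lemma inChart_vel {η : ℝ → MForm m M k} {x₀ : M} {z : Model m} (hz : z ∈ (ch m x₀).target)
    (h : SmoothFam 1 η 0 ((ch m x₀).symm z)) :
    inChart x₀ (vel η) z =
      fderiv ℝ (fun p : ℝ × Model m => inChart x₀ (η p.1) p.2) (0, z) (1, 0) := by
  have h0 := (smoothFam_iff_chart one_add_one_le ((ch m x₀).map_target hz)).1 h
  rw [(ch m x₀).right_inv hz] at h0
  have h1 := (h0.differentiableAt (by simp)).hasFDerivAt.comp_hasDerivAt (0 : ℝ)
    (f := fun σ : ℝ => (σ, z)) ((hasDerivAt_id (0 : ℝ)).prodMk (hasDerivAt_const _ _))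
  have h2 := hasDerivAt_pullback (f := (ch m x₀).symm) (x := z) h.differentiableAt
  exact h2.unique h1

lemma smoothAt_vel {η : ℝ → MForm m M k} (h : IsSmoothFamily η) (y : M) :
    SmoothAt ∞ (vel η) y := by
  rw [isSmoothFamily_iff] at h
  have h0 : ContDiffAt ℝ ∞ (fun z =>
      fderiv ℝ (fun p : ℝ × Model m => inChart y (η p.1) p.2) (0, z) (1, 0)) (ch m y y) := by
    refine ContDiffAt.clm_apply ?_ contDiffAt_const
    exact ContDiffAt.comp (ch m y y) (f := fun z => ((0 : ℝ), z))
      (ContDiffAt.fderiv_right (h 0 y) (by simp)) (by fun_prop)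
  refine h0.congr_of_eventuallyEq ?_
  filter_upwards [extChartAt_target_mem_nhds (I := 𝓘(ℝ, Model m)) y] with z hz
  exact inChart_vel hz ((h 0 _).of_le (by simp))

/-- The de Rham differential commutes with the variation. -/
lemma hasDerivAt_extD {η : ℝ → MForm m M k} (h : IsSmoothFamily η) (x : M) :
    HasDerivAt (fun τ => extD (η τ) x) (extD (vel η) x) 0 := by
  have hs := isSmoothFamily_iff.1 h
  set Ψ : ℝ × Model m → Alt m k := fun p => inChart x (η p.1) p.2 with hΨ
  have hΨs : ContDiffAt ℝ 2 Ψ (0, ch m x x) :=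
    ContDiffAt.of_le (hs 0 x) (by rw [← one_add_one_eq_two]; exact one_add_one_le)
  have hd : HasFDerivAt (fderiv ℝ Ψ) (fderiv ℝ (fderiv ℝ Ψ) (0, ch m x x)) (0, ch m x x) :=
    ((hΨs.fderiv_right (m := 1) one_add_one_eq_two.le).differentiableAt (by simp)).hasFDerivAt
  have e1 : (fun τ => extD (η τ) x) = fun τ => altL m k
      ((fderiv ℝ Ψ (τ, ch m x x)).comp (.inr ℝ ℝ (Model m))) := by
    funext τ
    rw [← inChart_self x (extD (η τ))]
    exact (eventually_inChart_extD ((hs τ x).of_le (by simp))).self_of_nhds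
  have e2 : extD (vel η) x = altL m k
      ((fderiv ℝ (fderiv ℝ Ψ) (0, ch m x x) (1, 0)).comp (.inr ℝ ℝ (Model m))) := by
    have h1 : inChart x (vel η) =ᶠ[𝓝 (ch m x x)] fun z => fderiv ℝ Ψ (0, z) (1, 0) := by
      filter_upwards [extChartAt_target_mem_nhds (I := 𝓘(ℝ, Model m)) x] with z hz
      exact inChart_vel hz ((hs 0 _).of_le (by simp))
    have h2' := HasFDerivAt.comp (ch m x x) (g := fderiv ℝ Ψ) (f := fun z => ((0 : ℝ), z)) hd
      ((hasFDerivAt_const (0 : ℝ) (ch m x x)).prodMk (hasFDerivAt_id (𝕜 := ℝ) (ch m x x)))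
    have h2 := h2'.clm_apply (hasFDerivAt_const ((1 : ℝ), (0 : Model m)) (ch m x x))
    have h3 : fderiv ℝ (inChart x (vel η)) (ch m x x) =
        (fderiv ℝ (fderiv ℝ Ψ) (0, ch m x x) (1, 0)).comp (.inr ℝ ℝ (Model m)) := by
      rw [h1.fderiv_eq]
      refine h2.fderiv.trans ?_
      -- Symmetry of the second derivative of `Ψ` in the directions `(0, v)` and `(1, 0)` is the
      -- interchange of `d` with `d/dτ`.
      have hsym := (hΨs.isSymmSndFDerivAt (by simp)).eq
      ext v w
      simp only [ContinuousLinearMap.comp_zero, zero_add, Function.comp_apply]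
      exact DFunLike.congr_fun (hsym (0, v) (1, 0)) w
    rw [← inChart_self x (extD (vel η)), inChart_extD (mem_extChartAt_target x)]
    · rw [extDeriv, h3]
      rfl
    · exact (smoothAt_vel h _).of_le (by simp)
  rw [e1, e2]
  refine HasFDerivAt.comp_hasDerivAt (l := altL m k) (0 : ℝ) (hasFDerivAt_altL _) ?_
  have h4 := HasFDerivAt.comp_hasDerivAt (l := fderiv ℝ Ψ) (0 : ℝ) hd (f := fun σ : ℝ => (σ, ch m x x))
    ((hasDerivAt_id (0 : ℝ)).prodMk (hasDerivAt_const _ _))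
  simpa using h4.clm_comp (hasDerivAt_const (0 : ℝ) (ContinuousLinearMap.inr ℝ ℝ (Model m)))

end ExtD

end FieldDiff

namespace FieldDiff

/-! ### Integration by parts on the model space -/

section Model

variable {m : ℕ} {ι : Type*} [Fintype ι] {r : ι → ℕ}

omit [Fintype ι] in
lemma two_le_infty : (2 : WithTop ℕ∞) ≤ ∞ := by
  rw [← one_add_one_eq_two]; exact one_add_one_le

/-- Wedge product of all components with `e^j`. -/
noncomputable def wedgeCovecL (r : ι → ℕ) (j : Fin (m + 1)) :
    ((i : ι) → Alt m (r i)) →L[ℝ] ((i : ι) → Alt m (r i + 1)) :=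
  ContinuousLinearMap.piMap fun _ => wedgeOneL (covec m j)

/-- Interior product with `e_j`. -/
noncomputable def contractVecL (k : ℕ) (j : Fin (m + 1)) : Alt m (k + 1) →L[ℝ] Alt m k :=
  (ContinuousAlternatingMap.curryLeftLI (𝕜 := ℝ) (E := Model m)
    (F := ℝ)).toContinuousLinearMap.flip (vec m j)

lemma smoothAt_model {n : WithTop ℕ∞} {k : ℕ} {η : MForm m (Model m) k} {z : Model m} :
    SmoothAt n η z ↔ ContDiffAt ℝ n η z := by
  simp only [SmoothAt, inChart_model, ch_model]
  rfl

lemma contDiffAt_extDeriv {n : WithTop ℕ∞} {k : ℕ} {η : MForm m (Model m) k} {z : Model m}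
    (h : ContDiffAt ℝ (n + 1) η z) : ContDiffAt ℝ n (extDeriv η) z :=
  contDiff_altL.contDiffAt.comp z (h.fderiv_right le_rfl)

lemma contDiffAt_jet {n : WithTop ℕ∞} {φ : Field m (Model m) r} {z : Model m}
    (h : ∀ i, ContDiffAt ℝ (n + 1) (φ i) z) : ContDiffAt ℝ n (jet φ) z := by
  refine ContDiffAt.prodMk (contDiffAt_pi.2 fun i => (h i).of_le le_self_add)
    (contDiffAt_pi.2 fun i => ?_)
  simp only [extD_model]
  exact contDiffAt_extDeriv (h i)

/-- The covectors `e^l` are constant and may be moved inside the derivative. This makes `d` of an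
`m`-form `T♭(b)` computable, since `e^l ∧ T♭(b) = T(e^l ∧ b)`. -/
lemma extDeriv_eq_sum_fderiv {k : ℕ} {η : MForm m (Model m) k} {p : Model m}
    (h : DifferentiableAt ℝ η p) :
    extDeriv η p = ∑ l, fderiv ℝ (fun z => wedgeOne (covec m l) (η z)) p (vec m l) := by
  rw [extDeriv_eq_altL, altL_eq_sum]
  refine Finset.sum_congr rfl fun l _ => ?_
  have : fderiv ℝ (fun z => wedgeOne (covec m l) (η z)) p =
      (wedgeOneL (covec m l)).comp (fderiv ℝ η p) :=
    (HasFDerivAt.comp (g := wedgeOneL (k := k) (covec m l)) p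
      (wedgeOneL (k := k) (covec m l)).hasFDerivAt h.hasFDerivAt).fderiv
  rw [this]
  rfl

omit [Fintype ι] in
lemma map_sum_fin {n : ℕ} {s : ι → ℕ} {F : Type*} [NormedAddCommGroup F] [NormedSpace ℝ F]
    (T : ((i : ι) → Alt m (s i)) →L[ℝ] F) (g : Fin n → (i : ι) → Alt m (s i)) :
    T (∑ l, g l) = ∑ l, T (g l) := by
  simp

variable (Λ : NaturalLagrangian m r)

lemma NaturalLagrangian.contDiffAt_d₁ {ξ : Jet m r} (hξ : ξ ∈ Λ.dom) :
    ContDiffAt ℝ ∞ Λ.d₁ ξ :=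
  ((Λ.contDiffAt hξ).fderiv_right (by simp)).clm_comp contDiffAt_const

lemma NaturalLagrangian.contDiffAt_d₀ {ξ : Jet m r} (hξ : ξ ∈ Λ.dom) :
    ContDiffAt ℝ ∞ Λ.d₀ ξ :=
  ((Λ.contDiffAt hξ).fderiv_right (by simp)).clm_comp contDiffAt_const

/-- The terms of the Euler-Lagrange expression in which `∂L̃/∂(dφ)` is differentiated. -/
noncomputable def divL (S : Model m →L[ℝ] ((i : ι) → Alt m (r i + 1)) →L[ℝ] Alt m (m + 1)) :
    ((i : ι) → Alt m (r i)) →L[ℝ] Alt m (m + 1) :=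
  ∑ l, (S (vec m l)).comp (wedgeCovecL r l)

omit [Fintype ι] in
lemma divL_apply (S : Model m →L[ℝ] ((i : ι) → Alt m (r i + 1)) →L[ℝ] Alt m (m + 1))
    (a : (i : ι) → Alt m (r i)) :
    divL S a = ∑ l, S (vec m l) (fun i => wedgeOne (covec m l) (a i)) := by
  simp only [divL, _root_.sum_apply]
  rfl

/-- The Euler-Lagrange expression on the model space. -/
noncomputable def eulerModel (φ : Field m (Model m) r) (p : Model m) :
    ((i : ι) → Alt m (r i)) →L[ℝ] Alt m (m + 1) :=
  Λ.d₀ (jet φ p) - divL (fderiv ℝ (fun z => Λ.d₁ (jet φ z)) p)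

lemma theta_eq {M : Type*} [TopologicalSpace M] [ChartedSpace (Model m) M] (φ δ : Field m M r)
    (x : M) : theta Λ φ δ x = lower (⇑(Λ.d₁ (jet φ x))) (fun i => δ i x) := rfl

lemma contDiffAt_theta {n : WithTop ℕ∞} (hn : n ≤ ∞) {φ δ : Field m (Model m) r} {p : Model m}
    (hφ : ∀ i, ContDiffAt ℝ ∞ (φ i) p) (hp : jet φ p ∈ Λ.dom)
    (hδ : ∀ i, ContDiffAt ℝ n (δ i) p) : ContDiffAt ℝ n (theta Λ φ δ) p := by
  have h1 : ContDiffAt ℝ n (fun z => Λ.d₁ (jet φ z)) p :=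
    ((Λ.contDiffAt_d₁ hp).comp p (contDiffAt_jet (n := ∞) (by simpa using hφ))).of_le hn
  have h2 : ContDiffAt ℝ n (fun z i => δ i z) p := contDiffAt_pi.2 hδ
  have : theta Λ φ δ = fun z => ∑ j, contractVecL m j
      ((Λ.d₁ (jet φ z)) (wedgeCovecL r j fun i => δ i z)) := rfl
  rw [this]
  refine ContDiffAt.sum fun j _ => ?_
  refine (contractVecL m j).contDiff.contDiffAt.comp p ?_
  exact h1.clm_apply ((wedgeCovecL r j).contDiff.contDiffAt.comp p h2)

lemma hasFDerivAt_d₁_jet {φ : Field m (Model m) r} {p : Model m}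
    (hφ : ∀ i, ContDiffAt ℝ ∞ (φ i) p) (hp : jet φ p ∈ Λ.dom) :
    HasFDerivAt (fun z => Λ.d₁ (jet φ z)) (fderiv ℝ (fun z => Λ.d₁ (jet φ z)) p) p :=
  (((Λ.contDiffAt_d₁ hp).comp p
    (contDiffAt_jet (n := ∞) (by simpa using hφ))).differentiableAt (by simp)).hasFDerivAt

/-- The Leibniz rule for `∂_l (L̃₁(e^l ∧ δ))`: differentiating `L̃₁` along the jet gives `divL`,
differentiating `δ` gives `L̃₁(dδ)`. -/
lemma extDeriv_theta {φ δ : Field m (Model m) r} {p : Model m}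
    (hφ : ∀ i, ContDiffAt ℝ ∞ (φ i) p) (hp : jet φ p ∈ Λ.dom)
    (hδ : ∀ i, ContDiffAt ℝ 1 (δ i) p) :
    extDeriv (theta Λ φ δ) p =
      divL (fderiv ℝ (fun z => Λ.d₁ (jet φ z)) p) (fun i => δ i p) +
        Λ.d₁ (jet φ p) (fun i => extDeriv (δ i) p) := by
  have hθ : DifferentiableAt ℝ (theta Λ φ δ) p :=
    (contDiffAt_theta Λ (by simp) hφ hp hδ).differentiableAt (by simp)
  have h1 := hasFDerivAt_d₁_jet Λ hφ hp
  have h2 : HasFDerivAt (fun z i => δ i z)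
      (ContinuousLinearMap.pi fun i => fderiv ℝ (δ i) p) p :=
    hasFDerivAt_pi.2 fun i => ((hδ i).differentiableAt (by simp)).hasFDerivAt
  rw [extDeriv_eq_sum_fderiv hθ, divL_apply]
  have h3 : (fun i => extDeriv (δ i) p) =
      ∑ l, wedgeCovecL r l (fun i => fderiv ℝ (δ i) p (vec m l)) := by
    funext i
    rw [Finset.sum_apply, extDeriv_eq_altL, altL_eq_sum]
    rfl
  have h3' : Λ.d₁ (jet φ p) (fun i => extDeriv (δ i) p) =
      ∑ l, Λ.d₁ (jet φ p) (wedgeCovecL r l (fun i => fderiv ℝ (δ i) p (vec m l))) := by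
    rw [h3]
    exact map_sum_fin (s := fun i => r i + 1) (Λ.d₁ (jet φ p))
      (fun l => wedgeCovecL r l (fun i => fderiv ℝ (δ i) p (vec m l)))
  rw [h3', ← Finset.sum_add_distrib]
  refine Finset.sum_congr rfl fun l _ => ?_
  have h4 : (fun z => wedgeOne (covec m l) (theta Λ φ δ z)) =
      fun z => (Λ.d₁ (jet φ z)) (wedgeCovecL r l fun i => δ i z) := by
    funext z
    exact wedgeOne_lower (Λ.d₁ (jet φ z)) (covec m l) (fun i => δ i z)
  have h5 : HasFDerivAt (fun z => wedgeCovecL r l fun i => δ i z)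
      ((wedgeCovecL r l).comp (ContinuousLinearMap.pi fun i => fderiv ℝ (δ i) p)) p :=
    HasFDerivAt.comp (g := wedgeCovecL r l) p (wedgeCovecL r l).hasFDerivAt h2
  rw [h4, (h1.clm_apply h5).fderiv]
  exact add_comm (Λ.d₁ (jet φ p) (wedgeCovecL r l fun i => fderiv ℝ (δ i) p (vec m l))) _

/-- Integration by parts: the term `L̃₁(dδ)` occurs in both `dL` and `dθ`, and no derivative of `δ`
survives their difference. -/
lemma varLagr_sub_extD_theta_model {φ δ : Field m (Model m) r} {p : Model m}
    (hφ : ∀ i, ContDiffAt ℝ ∞ (φ i) p) (hp : jet φ p ∈ Λ.dom)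
    (hδ : ∀ i, ContDiffAt ℝ 1 (δ i) p) :
    varLagr Λ φ δ p - extD (theta Λ φ δ) p = eulerModel Λ φ p (fun i => δ i p) := by
  rw [extD_model, extDeriv_theta Λ hφ hp hδ, varLagr, Λ.fderiv_eq]
  simp only [jet, extD_model, eulerModel, _root_.sub_apply]
  abel

end Model

/-! ### Naturality under local diffeomorphisms -/

section Naturality

variable {m : ℕ} {ι : Type*} [Fintype ι] {r : ι → ℕ}
  {M : Type*} [TopologicalSpace M] [ChartedSpace (Model m) M]
  {N : Type*} [TopologicalSpace N] [ChartedSpace (Model m) N]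
  (Λ : NaturalLagrangian m r)

/-- `f` is a local diffeomorphism near `x`. -/
def LDiff (m : ℕ) {M N : Type*} [TopologicalSpace M] [ChartedSpace (Model m) M]
    [TopologicalSpace N] [ChartedSpace (Model m) N] (f : N → M) (x : N) : Prop :=
  ∀ᶠ y in 𝓝 x, ContMDiffAt 𝓘(ℝ, Model m) 𝓘(ℝ, Model m) ∞ f y ∧
    ∃ A : Model m ≃L[ℝ] Model m, (A : Model m →L[ℝ] Model m) = tmap m f y

/-- `φ` is smooth and in the domain of the Lagrangian near `x`. -/
def AdmAt (φ : Field m M r) (x : M) : Prop :=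
  ∀ᶠ y in 𝓝 x, (∀ i, SmoothAt ∞ (φ i) y) ∧ jet φ y ∈ Λ.dom

lemma LDiff.contMDiffAt {f : N → M} {x : N} (h : LDiff m f x) :
    ContMDiffAt 𝓘(ℝ, Model m) 𝓘(ℝ, Model m) ∞ f x := h.self_of_nhds.1

lemma LDiff.exists_equiv {f : N → M} {x : N} (h : LDiff m f x) :
    ∃ A : Model m ≃L[ℝ] Model m, (A : Model m →L[ℝ] Model m) = tmap m f x := h.self_of_nhds.2

lemma LDiff.eventually {f : N → M} {x : N} (h : LDiff m f x) : ∀ᶠ y in 𝓝 x, LDiff m f y :=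
  eventually_eventually_nhds.2 h

variable {Λ} in
lemma AdmAt.smoothAt {φ : Field m M r} {x : M} (h : AdmAt Λ φ x) (i : ι) : SmoothAt ∞ (φ i) x :=
  h.self_of_nhds.1 i

variable {Λ} in
lemma AdmAt.mem_dom {φ : Field m M r} {x : M} (h : AdmAt Λ φ x) : jet φ x ∈ Λ.dom :=
  h.self_of_nhds.2

variable {Λ} in
lemma AdmAt.eventually {φ : Field m M r} {x : M} (h : AdmAt Λ φ x) : ∀ᶠ y in 𝓝 x, AdmAt Λ φ y :=
  eventually_eventually_nhds.2 h

variable [IsManifold 𝓘(ℝ, Model m) ∞ M] [IsManifold 𝓘(ℝ, Model m) ∞ N]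

omit [IsManifold 𝓘(ℝ, Model m) ∞ N] in
lemma lDiff_ch_symm {x₀ : M} {z : Model m} (hz : z ∈ (ch m x₀).target) :
    LDiff m (ch m x₀).symm z := by
  filter_upwards [ch_target_mem hz] with w hw
  refine ⟨contMDiffAt_ch_symm hw, ?_⟩
  refine ⟨ContinuousLinearEquiv.equivOfInverse (tmap m (ch m x₀).symm w)
    (tmap m (ch m x₀) ((ch m x₀).symm w)) (fun v => ?_) (fun v => ?_), rfl⟩
  · exact DFunLike.congr_fun (tmap_ch_comp_symm hw) v
  · have := tmap_ch_symm_comp (m := m) (x₀ := x₀) (y := (ch m x₀).symm w) ((ch m x₀).map_target hw)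
    rw [(ch m x₀).right_inv hw] at this
    exact DFunLike.congr_fun this v

omit [IsManifold 𝓘(ℝ, Model m) ∞ M] [IsManifold 𝓘(ℝ, Model m) ∞ N] in
lemma lDiff_diffeo (f : Diffeo m N M) (x : N) : LDiff m f x := by
  refine Eventually.of_forall fun y => ⟨f.contMDiff y, ?_⟩
  have hf : ∀ y, MDifferentiableAt 𝓘(ℝ, Model m) 𝓘(ℝ, Model m) f y :=
    fun y => (f.contMDiff y).mdifferentiableAt (by simp)
  have hf' : ∀ y, MDifferentiableAt 𝓘(ℝ, Model m) 𝓘(ℝ, Model m) f.symm y :=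
    fun y => (f.symm.contMDiff y).mdifferentiableAt (by simp)
  refine ⟨ContinuousLinearEquiv.equivOfInverse (tmap m f y) (tmap m f.symm (f y))
    (fun v => ?_) (fun v => ?_), rfl⟩
  · have := tmap_comp (m := m) (hf' (f y)) (hf y)
    simp only [Diffeomorph.symm_apply_apply, tmap_id] at this
    exact (DFunLike.congr_fun this v).symm
  · have := tmap_comp (m := m) (g := f) (f := f.symm) (x := f y) (hf _) (hf' _)
    simp only [Diffeomorph.symm_apply_apply, Diffeomorph.apply_symm_apply, tmap_id] at this
    exact (DFunLike.congr_fun this v).symm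

omit [Fintype ι] in
-- Because `d` is natural, second derivatives of `f` do not enter: `φ` and `dφ` both transform by
-- the tangent map alone. Naturality of the whole theory thereby reduces to linear frame changes in
-- the fibre.
lemma jet_pullField {f : N → M} {x : N} {φ : Field m M r} (hφ : ∀ i, SmoothAt 1 (φ i) (f x))
    (hf : ContMDiffAt 𝓘(ℝ, Model m) 𝓘(ℝ, Model m) 2 f x) :
    jet (pullField f φ) x = Jet.pull (tmap m f x) (jet φ (f x)) := by
  simp only [jet, Jet.pull, pullField, extD_pullback (hφ _) hf]
  rfl

variable {Λ}

lemma AdmAt.pullField {f : N → M} {x : N} {φ : Field m M r} (hφ : AdmAt Λ φ (f x))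
    (hf : LDiff m f x) : AdmAt Λ (pullField f φ) x := by
  filter_upwards [hf, hf.contMDiffAt.continuousAt.eventually hφ] with y hy hy'
  refine ⟨fun i => SmoothAt.pullback (by simp) (hy'.1 i) (by simpa using hy.1), ?_⟩
  rw [jet_pullField (fun i => (hy'.1 i).of_le (by simp)) (hy.1.of_le two_le_infty)]
  obtain ⟨A, hA⟩ := hy.2
  rw [← hA]
  exact Λ.pull_mem A _ hy'.2

lemma lagr_pullField {f : N → M} {x : N} {φ : Field m M r} (hφ : AdmAt Λ φ (f x))
    (hf : LDiff m f x) : lagr Λ (pullField f φ) x = pullback f (lagr Λ φ) x := by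
  obtain ⟨A, hA⟩ := hf.exists_equiv
  simp only [lagr, pullback]
  rw [jet_pullField (fun i => (hφ.smoothAt i).of_le (by simp))
    (hf.contMDiffAt.of_le two_le_infty), ← hA]
  exact Λ.map_pull A _ hφ.mem_dom

lemma varLagr_pullField {f : N → M} {x : N} {φ δ : Field m M r} (hφ : AdmAt Λ φ (f x))
    (hδ : ∀ i, SmoothAt 1 (δ i) (f x)) (hf : LDiff m f x) :
    varLagr Λ (pullField f φ) (pullField f δ) x = pullback f (varLagr Λ φ δ) x := by
  obtain ⟨A, hA⟩ := hf.exists_equiv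
  simp only [varLagr, pullback]
  rw [jet_pullField (fun i => (hφ.smoothAt i).of_le (by simp))
    (hf.contMDiffAt.of_le two_le_infty), jet_pullField hδ
    (hf.contMDiffAt.of_le two_le_infty), ← hA]
  exact Λ.fderiv_pull A hφ.mem_dom _

lemma theta_pullField {f : N → M} {x : N} {φ : Field m M r} (δ : Field m M r)
    (hφ : AdmAt Λ φ (f x)) (hf : LDiff m f x) :
    theta Λ (pullField f φ) (pullField f δ) x = pullback f (theta Λ φ δ) x := by
  obtain ⟨A, hA⟩ := hf.exists_equiv
  simp only [theta_eq, pullback]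
  rw [jet_pullField (fun i => (hφ.smoothAt i).of_le (by simp))
    (hf.contMDiffAt.of_le two_le_infty)]
  simp only [pullField, pullback, ← hA]
  exact lower_comp A (fun F => Λ.d₁_pull A hφ.mem_dom F) _

/-- The expression of a field in the preferred chart at `x`. -/
noncomputable def chartField (x : M) (φ : Field m M r) : Field m (Model m) r :=
  pullField (ch m x).symm φ

omit [IsManifold 𝓘(ℝ, Model m) ∞ N] in
lemma AdmAt.chartField {x : M} {φ : Field m M r} (hφ : AdmAt Λ φ x) :
    AdmAt Λ (chartField x φ) (ch m x x) :=
  AdmAt.pullField (by rwa [(ch m x).left_inv (mem_extChartAt_source x)])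
    (lDiff_ch_symm (mem_extChartAt_target x))

omit [Fintype ι] [IsManifold 𝓘(ℝ, Model m) ∞ M] in
lemma SmoothAt.chartField {n : WithTop ℕ∞} {x : M} {δ : Field m M r} (i : ι)
    (h : SmoothAt n (δ i) x) : ContDiffAt ℝ n (chartField x δ i) (ch m x x) := h

omit [IsManifold 𝓘(ℝ, Model m) ∞ N] in
lemma smoothAt_theta {n : WithTop ℕ∞} (hn : n ≤ ∞) {x : M} {φ δ : Field m M r}
    (hφ : AdmAt Λ φ x) (hδ : ∀ i, SmoothAt n (δ i) x) : SmoothAt n (theta Λ φ δ) x := by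
  have hx : (ch m x).symm (ch m x x) = x := (ch m x).left_inv (mem_extChartAt_source x)
  have h1 := contDiffAt_theta Λ hn (fun i => smoothAt_model.1 (hφ.chartField.smoothAt i))
    hφ.chartField.mem_dom (fun i => (hδ i).chartField)
  refine h1.congr_of_eventuallyEq ?_
  have hc : ContinuousAt (ch m x).symm (ch m x x) :=
    (contMDiffAt_ch_symm (mem_extChartAt_target x)).continuousAt
  have h2 : ∀ᶠ z in 𝓝 (ch m x x), AdmAt Λ φ ((ch m x).symm z) :=
    hc.eventually (by rw [hx]; exact hφ.eventually)
  filter_upwards [h2, (lDiff_ch_symm (m := m) (x₀ := x) (mem_extChartAt_target x)).eventually] with z hz hz'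
  exact (theta_pullField δ hz hz').symm

lemma extD_theta_pullField {f : N → M} {x : N} {φ δ : Field m M r}
    (hφ : AdmAt Λ φ (f x)) (hδ : ∀ i, SmoothAt 1 (δ i) (f x)) (hf : LDiff m f x) :
    extD (theta Λ (pullField f φ) (pullField f δ)) x = pullback f (extD (theta Λ φ δ)) x := by
  rw [← extD_pullback (smoothAt_theta (by simp) hφ hδ) (hf.contMDiffAt.of_le two_le_infty)]
  refine extD_congr ?_
  filter_upwards [hf.contMDiffAt.continuousAt.eventually hφ.eventually, hf.eventually]
    with y hy hy'
  exact theta_pullField δ hy hy'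

omit [IsManifold 𝓘(ℝ, Model m) ∞ N] in
lemma comp_tmap_ch_symm_self {k : ℕ} (x : M) (a : Alt m k) :
    a.compContinuousLinearMap (tmap m (ch m x).symm (ch m x x)) = a := by
  rw [tmap_ch_symm_self]; rfl

omit [IsManifold 𝓘(ℝ, Model m) ∞ N] in
/-- What remains of `dL - dθ` depends algebraically on the variation. -/
lemma varLagr_sub_extD_theta {x : M} {φ δ : Field m M r} (hφ : AdmAt Λ φ x)
    (hδ : ∀ i, SmoothAt 1 (δ i) x) :
    varLagr Λ φ δ x - extD (theta Λ φ δ) x =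
      eulerModel Λ (chartField x φ) (ch m x x) (fun i => δ i x) := by
  have hx : (ch m x).symm (ch m x x) = x := (ch m x).left_inv (mem_extChartAt_source x)
  have hφ' : AdmAt Λ φ ((ch m x).symm (ch m x x)) := by rwa [hx]
  have hδ' : ∀ i, SmoothAt 1 (δ i) ((ch m x).symm (ch m x x)) := by rwa [hx]
  have hL := lDiff_ch_symm (m := m) (mem_extChartAt_target (I := 𝓘(ℝ, Model m)) x)
  have h1 := varLagr_sub_extD_theta_model Λ
    (fun i => smoothAt_model.1 (hφ.chartField.smoothAt i))
    hφ.chartField.mem_dom (fun i => (hδ i).chartField)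
  simp only [chartField] at h1 ⊢
  rw [varLagr_pullField hφ' hδ' hL, extD_theta_pullField hφ' hδ' hL] at h1
  simp only [pullback, comp_tmap_ch_symm_self, hx, pullField] at h1
  exact h1

omit [Fintype ι] [IsManifold 𝓘(ℝ, Model m) ∞ N] in
lemma inChart_chartConst_eventuallyEq (x : M) (a : (i : ι) → Alt m (r i)) (i : ι) :
    inChart x (chartConst x a i) =ᶠ[𝓝 (ch m x x)] fun _ => a i := by
  filter_upwards [ch_target_mem (mem_extChartAt_target x)] with z hz
  have := tmap_ch_comp_symm (m := m) (x₀ := x) hz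
  change ((a i).compContinuousLinearMap (tmap m (ch m x) ((ch m x).symm z))).compContinuousLinearMap
    (tmap m (ch m x).symm z) = a i
  change (a i).compContinuousLinearMap
    ((tmap m (ch m x) ((ch m x).symm z)).comp (tmap m (ch m x).symm z)) = a i
  rw [this]
  rfl

omit [Fintype ι] [IsManifold 𝓘(ℝ, Model m) ∞ N] in
lemma smoothAt_chartConst {n : WithTop ℕ∞} (x : M) (a : (i : ι) → Alt m (r i)) (i : ι) :
    SmoothAt n (chartConst x a i) x :=
  contDiffAt_const.congr_of_eventuallyEq (inChart_chartConst_eventuallyEq x a i)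

omit [Fintype ι] [IsManifold 𝓘(ℝ, Model m) ∞ N] in
lemma chartConst_self (x : M) (a : (i : ι) → Alt m (r i)) (i : ι) : chartConst x a i x = a i := by
  simp only [chartConst]
  rw [show tmap m (extChartAt 𝓘(ℝ, Model m) x) x = _ from tmap_ch_self x]
  rfl

omit [IsManifold 𝓘(ℝ, Model m) ∞ N] in
lemma eulerLagrange_eq {x : M} {φ : Field m M r} (hφ : AdmAt Λ φ x) :
    eulerLagrange Λ φ x = ⇑(eulerModel Λ (chartField x φ) (ch m x x)) := by
  funext a
  simp only [eulerLagrange]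
  rw [varLagr_sub_extD_theta hφ (smoothAt_chartConst x a)]
  simp only [chartConst_self]

omit [IsManifold 𝓘(ℝ, Model m) ∞ N] in
-- `eulerLagrange` is defined with the constant extension of a value. As `dL - dθ` depends only on
-- the value of the variation at `x`, any other extension gives the same result.
lemma fieldEq_eq {x : M} {φ δ : Field m M r} (hφ : AdmAt Λ φ x)
    (hδ : ∀ i, SmoothAt 1 (δ i) x) :
    fieldEq Λ φ δ x = varLagr Λ φ δ x - extD (theta Λ φ δ) x := by
  rw [varLagr_sub_extD_theta hφ hδ, fieldEq, eulerLagrange_eq hφ]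

/-- `dL` and `dθ` are natural, but a constant extension pulled back by `f` need not be constant in
the chart on `N`. `fieldEq_eq` makes it admissible there nevertheless. -/
lemma eulerLagrange_pullField {f : N → M} {x : N} {φ : Field m M r} (hφ : AdmAt Λ φ (f x))
    (hf : LDiff m f x) (a : (i : ι) → Alt m (r i)) :
    eulerLagrange Λ (pullField f φ) x (fun i => (a i).compContinuousLinearMap (tmap m f x)) =
      (eulerLagrange Λ φ (f x) a).compContinuousLinearMap (tmap m f x) := by
  have h1 := fieldEq_eq hφ (smoothAt_chartConst (f x) a)
  have h2 := fieldEq_eq (hφ.pullField hf) (δ := pullField f (chartConst (f x) a)) (fun i =>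
    SmoothAt.pullback one_add_one_le (smoothAt_chartConst (f x) a i)
      (hf.contMDiffAt.of_le one_add_one_le))
  rw [varLagr_pullField hφ (smoothAt_chartConst (f x) a) hf,
    extD_theta_pullField hφ (smoothAt_chartConst (f x) a) hf] at h2
  simp only [fieldEq, pullField, pullback, chartConst_self] at h1 h2
  rw [h1]
  exact h2

lemma fieldEq_pullField {f : N → M} {x : N} {φ : Field m M r} (δ : Field m M r)
    (hφ : AdmAt Λ φ (f x)) (hf : LDiff m f x) :
    fieldEq Λ (pullField f φ) (pullField f δ) x = pullback f (fieldEq Λ φ δ) x :=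
  eulerLagrange_pullField hφ hf _

lemma fieldEqContract_pullField {f : N → M} {x : N} {φ : Field m M r} {X : M → Model m}
    {X' : N → Model m} (hφ : AdmAt Λ φ (f x)) (hf : LDiff m f x)
    (hX : tmap m f x (X' x) = X (f x)) :
    fieldEqContract Λ (pullField f φ) X' x = pullback f (fieldEqContract Λ φ X) x := by
  have h := eulerLagrange_pullField hφ hf
  obtain ⟨A, hA⟩ := hf.exists_equiv
  simp only [fieldEqContract, pullback, pullField]
  rw [← hX]
  rw [← hA] at h ⊢
  rw [eulerLagrange_eq hφ, eulerLagrange_eq (hφ.pullField hf)] at *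
  exact lowerContract_comp A h (X' x) _

end Naturality

end FieldDiff

namespace FieldDiff

/-! ### Lie derivatives on the model space -/

section LieModel

variable {m k : ℕ}

/-- The Lie derivative of a form on the model space. -/
noncomputable def lieModel (X : Model m → Model m) (η : MForm m (Model m) k) :
    MForm m (Model m) k := fun p =>
  fderiv ℝ η p (X p) + (η p).fderivCompContinuousLinearMap (.id ℝ _) (fderiv ℝ X p)

/-- The sum `∑ l, ∂_l (e^l ∧ ι_X η)`. -/
noncomputable def divContract (X : Model m → Model m) (η : MForm m (Model m) k) :
    MForm m (Model m) k := fun p =>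
  ∑ l, fderiv ℝ (fun z => wedgeContract (covec m l) (X z) (η z)) p (vec m l)

lemma contDiff_wedgeContractL (α : Model m →L[ℝ] ℝ) {n : WithTop ℕ∞} :
    ContDiff ℝ n (fun X => wedgeContractL (k := k) α X) :=
  ContinuousLinearMap.contDiff (𝕜 := ℝ) (E := Model m) (F := Alt m k →L[ℝ] Alt m k) _

lemma hasFDerivAt_wedgeContractL (α : Model m →L[ℝ] ℝ) (X : Model m) :
    HasFDerivAt (fun X => wedgeContractL (k := k) α X) (wedgeContractL (k := k) α) X :=
  ContinuousLinearMap.hasFDerivAt (𝕜 := ℝ) (E := Model m) (F := Alt m k →L[ℝ] Alt m k) _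

lemma hasFDerivAt_wedgeContract (α : Model m →L[ℝ] ℝ) {X : Model m → Model m}
    {η : MForm m (Model m) k} {p : Model m} (hη : DifferentiableAt ℝ η p)
    (hX : DifferentiableAt ℝ X p) :
    HasFDerivAt (fun z => wedgeContract α (X z) (η z))
      ((wedgeContractL (k := k) α (X p)).comp (fderiv ℝ η p) +
        ((wedgeContractL (k := k) α).comp (fderiv ℝ X p)).flip (η p)) p := by
  have h1 : HasFDerivAt (fun z => wedgeContractL (k := k) α (X z))
      ((wedgeContractL (k := k) α).comp (fderiv ℝ X p)) p :=
    HasFDerivAt.comp (g := fun X => wedgeContractL (k := k) α X) (f := X) p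
      (hasFDerivAt_wedgeContractL α (X p)) hX.hasFDerivAt
  have h2 := h1.clm_apply hη.hasFDerivAt
  simpa only [wedgeContractL_apply] using h2

lemma curryLeftL_sum {n : ℕ} (g : Fin n → Alt m (k + 1)) (X : Model m) :
    (∑ l, g l).curryLeft X = ∑ l, (g l).curryLeft X := by
  induction n with
  | zero => simp
  | succ n ih =>
    simp only [Fin.sum_univ_succ, ContinuousAlternatingMap.curryLeft_add,
      _root_.add_apply, ih]

lemma apply_eq_sum_vec {F : Type*} [NormedAddCommGroup F] [NormedSpace ℝ F]
    (f : Model m →L[ℝ] F) (v : Model m) : f v = ∑ l, v l • f (vec m l) := by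
  conv_lhs => rw [← sum_covec_smul_vec v, map_sum]
  simp

/-- Cartan's formula on the model space. -/
lemma lieModel_eq {X : Model m → Model m} {η : MForm m (Model m) k} {p : Model m}
    (hη : DifferentiableAt ℝ η p) (hX : DifferentiableAt ℝ X p) :
    lieModel X η p = (extDeriv η p).curryLeft (X p) + divContract X η p := by
  have h1 : ∀ l, fderiv ℝ (fun z => wedgeContract (covec m l) (X z) (η z)) p (vec m l) =
      wedgeContract (covec m l) (X p) (fderiv ℝ η p (vec m l)) +
        wedgeContract (covec m l) (fderiv ℝ X p (vec m l)) (η p) := fun l => by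
    rw [(hasFDerivAt_wedgeContract _ hη hX).fderiv, ← wedgeContractL_apply,
      ← wedgeContractL_apply]
    rfl
  simp only [divContract, h1]
  rw [Finset.sum_add_distrib, extDeriv_eq_altL, altL_eq_sum, curryLeftL_sum, ← add_assoc,
    ← Finset.sum_add_distrib]
  -- The antiderivation rule pairs `ι_X(e^l ∧ ∂_l η)` with `e^l ∧ ι_X ∂_l η`, giving `X^l • ∂_l η`.
  -- What remains, `∑ e^l ∧ ι_{∂_l X} η`, is the frame derivative along `DX`.
  simp only [curryLeft_wedgeOne, lieModel, fderivComp_id_eq_sum, covec_apply]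
  rw [← apply_eq_sum_vec]

lemma contDiffAt_interior {X : Model m → Model m} {η : MForm m (Model m) (k + 1)}
    {n : WithTop ℕ∞} {p : Model m} (hη : ContDiffAt ℝ n η p) (hX : ContDiffAt ℝ n X p) :
    ContDiffAt ℝ n (interior X η) p := by
  have : interior X η = fun z =>
      (ContinuousAlternatingMap.curryLeftLI (𝕜 := ℝ) (E := Model m) (F := ℝ)
        (n := k)).toContinuousLinearMap (η z) (X z) := rfl
  rw [this]
  refine ContDiffAt.clm_apply ?_ hX
  exact (ContinuousLinearMap.contDiff _).contDiffAt.comp p hη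

/-- In positive degree `divContract` is `d ι_X η`, and in degree zero it is `0`; it serves to state
Cartan's formula in all degrees at once, fields of degree zero included. -/
lemma extDeriv_interior {X : Model m → Model m} {η : MForm m (Model m) (k + 1)}
    {p : Model m} (hη : ContDiffAt ℝ 1 η p) (hX : ContDiffAt ℝ 1 X p) :
    extDeriv (interior X η) p = divContract X η p :=
  extDeriv_eq_sum_fderiv ((contDiffAt_interior hη hX).differentiableAt (by simp))

end LieModel

/-! ### The Noether identity on the model space -/

section NoetherModel

variable {m : ℕ} {ι : Type*} [Fintype ι] {r : ι → ℕ} {Λ : NaturalLagrangian m r}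

omit [Fintype ι] in
lemma pullField_fun_id {M : Type*} [TopologicalSpace M] [ChartedSpace (Model m) M]
    (φ : Field m M r) : pullField (fun y : M => y) φ = φ := by
  funext i
  exact pullback_id _

omit [Fintype ι] in
lemma chartField_model (x : Model m) (φ : Field m (Model m) r) : chartField x φ = φ := by
  unfold chartField
  rw [ch_model]
  exact pullField_fun_id φ

lemma eulerLagrange_model {φ : Field m (Model m) r} {z : Model m} (hφ : AdmAt Λ φ z) :
    eulerLagrange Λ φ z = ⇑(eulerModel Λ φ z) := by
  rw [eulerLagrange_eq hφ, chartField_model, ch_model]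
  rfl

/-- The field `ι_X dφ`. -/
noncomputable def contractD (X : Model m → Model m) (φ : Field m (Model m) r) :
    Field m (Model m) r := fun i => interior X (extDeriv (φ i))

omit [Fintype ι] in
lemma lowerContract_sub (T T' : ((i : ι) → Alt m (r i)) →L[ℝ] Alt m (m + 1)) (X : Model m)
    (a : (i : ι) → Alt m (r i)) :
    lowerContract (⇑(T - T')) X a = lowerContract (⇑T) X a - lowerContract (⇑T') X a := by
  refine eq_of_wedgeOne_eq fun α => ?_
  rw [wedgeOne_sub, wedgeOne_lowerContract, wedgeOne_lowerContract, wedgeOne_lowerContract]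
  rfl

noncomputable instance :
    NormedAddCommGroup (((i : ι) → Alt m (r i + 1)) →L[ℝ] Alt m (m + 1)) :=
  ContinuousLinearMap.toNormedAddCommGroup

noncomputable instance : NormedSpace ℝ (((i : ι) → Alt m (r i + 1)) →L[ℝ] Alt m (m + 1)) :=
  ContinuousLinearMap.toNormedSpace

noncomputable instance : NormedAddCommGroup
    (Model m →L[ℝ] ((i : ι) → Alt m (r i + 1)) →L[ℝ] Alt m (m + 1)) :=
  ContinuousLinearMap.toNormedAddCommGroup (E := Model m)
    (F := ((i : ι) → Alt m (r i + 1)) →L[ℝ] Alt m (m + 1))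

noncomputable instance : NormedSpace ℝ
    (Model m →L[ℝ] ((i : ι) → Alt m (r i + 1)) →L[ℝ] Alt m (m + 1)) :=
  ContinuousLinearMap.toNormedSpace (E := Model m)
    (F := ((i : ι) → Alt m (r i + 1)) →L[ℝ] Alt m (m + 1))

/-- The derivative of `∂L̃/∂(dφ)` along the jet of a field. -/
noncomputable def dMomentum (Λ : NaturalLagrangian m r) (φ : Field m (Model m) r) :=
  fderiv ℝ (fun z => Λ.d₁ (jet φ z))

/-- `curryLeft_eq` trades the part of `E(ι_X φ; φ)` that comes from `∂L̃/∂φ` for `ι_X L - θ(ι_X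
dφ)`, two forms whose differentials are already under control. -/
lemma fieldEqContract_model {φ : Field m (Model m) r} {X : Model m → Model m} {z : Model m}
    (hφ : AdmAt Λ φ z) :
    fieldEqContract Λ φ X z = interior X (lagr Λ φ) z - theta Λ φ (contractD X φ) z -
      lowerContract (⇑(divL (dMomentum Λ φ z))) (X z) (fun i => φ i z) := by
  rw [fieldEqContract, eulerLagrange_model hφ, eulerModel, lowerContract_sub]
  have h := Λ.curryLeft_eq hφ.mem_dom (X z)
  simp only [jet, extD_model] at h
  congr 1
  rw [eq_sub_iff_add_eq]
  simp only [interior, lagr, jet, extD_model, theta_eq, contractD]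
  exact h.symm

variable {φ : Field m (Model m) r} {X : Model m → Model m} {p : Model m}

lemma AdmAt.contDiffAt (hφ : AdmAt Λ φ p) (i : ι) : ContDiffAt ℝ ∞ (φ i) p :=
  smoothAt_model.1 (hφ.smoothAt i)

lemma AdmAt.contDiffAt_jet (hφ : AdmAt Λ φ p) : ContDiffAt ℝ ∞ (jet φ) p :=
  FieldDiff.contDiffAt_jet (n := ∞) (by simpa using hφ.contDiffAt)

lemma AdmAt.contDiffAt_lagr (hφ : AdmAt Λ φ p) : ContDiffAt ℝ ∞ (lagr Λ φ) p :=
  (Λ.contDiffAt hφ.mem_dom).comp p hφ.contDiffAt_jet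

lemma AdmAt.contDiffAt_dMomentum (hφ : AdmAt Λ φ p) : ContDiffAt ℝ ∞ (dMomentum Λ φ) p :=
  ((Λ.contDiffAt_d₁ hφ.mem_dom).comp p hφ.contDiffAt_jet).fderiv_right (by simp)

lemma AdmAt.contDiffAt_contractD {n : WithTop ℕ∞} (hn : n ≤ ∞) (hφ : AdmAt Λ φ p)
    (hX : ContDiffAt ℝ n X p) (i : ι) : ContDiffAt ℝ n (contractD X φ i) p :=
  contDiffAt_interior
    ((contDiffAt_extDeriv (n := ∞) (by simpa using hφ.contDiffAt i)).of_le hn) hX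

/-- The Lagrangian is invariant under infinitesimal diffeomorphisms. -/
lemma lieModel_lagr (hφ : AdmAt Λ φ p) :
    lieModel X (lagr Λ φ) p = Λ.d₀ (jet φ p) (fun i => lieModel X (φ i) p) +
      Λ.d₁ (jet φ p) (fun i => lieModel X (extDeriv (φ i)) p) := by
  have hj : HasFDerivAt (jet φ) (fderiv ℝ (jet φ) p) p :=
    (hφ.contDiffAt_jet.differentiableAt (by simp)).hasFDerivAt
  have h1 : fderiv ℝ (lagr Λ φ) p = (fderiv ℝ Λ.toFun (jet φ p)).comp (fderiv ℝ (jet φ) p) :=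
    ((Λ.hasFDerivAt hφ.mem_dom).comp p hj).fderiv
  have h2 : fderiv ℝ (jet φ) p = (ContinuousLinearMap.pi fun i => fderiv ℝ (φ i) p).prod
      (ContinuousLinearMap.pi fun i => fderiv ℝ (extDeriv (φ i)) p) := by
    refine HasFDerivAt.fderiv (HasFDerivAt.prodMk (hasFDerivAt_pi.2 fun i =>
      ((hφ.contDiffAt i).differentiableAt (by simp)).hasFDerivAt) (hasFDerivAt_pi.2 fun i => ?_))
    simp only [extD_model]
    exact ((contDiffAt_extDeriv (n := ∞) (by simpa using hφ.contDiffAt i)).differentiableAt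
      (by simp)).hasFDerivAt
  -- The transport part of the Lie derivative is the chain rule; the part along `DX` is an
  -- infinitesimal frame change, which passes through `L̃`.
  have h3 := Λ.fderiv_deriv (fderiv ℝ X p) hφ.mem_dom
  have h4 : lieModel X (lagr Λ φ) p = fderiv ℝ Λ.toFun (jet φ p) (fderiv ℝ (jet φ) p (X p)) +
      fderiv ℝ Λ.toFun (jet φ p) (Jet.deriv (fderiv ℝ X p) (jet φ p)) := by
    rw [h3, lieModel, h1]
    rfl
  rw [h4, ← map_add, h2, Λ.fderiv_eq]
  simp only [Jet.deriv, jet, extD_model]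
  rfl

/-- Cartan's formula with `d d η = 0`. -/
lemma lieModel_extDeriv {k : ℕ} {η : MForm m (Model m) k} (hη : ContDiffAt ℝ ∞ η p)
    (hX : ContDiffAt ℝ 1 X p) :
    lieModel X (extDeriv η) p = extDeriv (interior X (extDeriv η)) p := by
  have h := contDiffAt_extDeriv (n := ∞) (by simpa using hη)
  rw [lieModel_eq (h.differentiableAt (by simp)) (hX.differentiableAt (by simp)),
    extDeriv_interior (h.of_le (by simp)) hX,
    extDeriv_extDeriv_apply hη (by simpa using two_le_infty)]
  simp

lemma extDeriv_interior_lagr (hφ : AdmAt Λ φ p) (hX : ContDiffAt ℝ 1 X p) :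
    extDeriv (interior X (lagr Λ φ)) p = lieModel X (lagr Λ φ) p := by
  rw [lieModel_eq (hφ.contDiffAt_lagr.differentiableAt (by simp))
    (hX.differentiableAt (by simp)), extDeriv_interior (hφ.contDiffAt_lagr.of_le (by simp)) hX,
    Subsingleton.elim (extDeriv (lagr Λ φ) p) 0]
  simp

omit [Fintype ι] in
lemma lowerContract_eq_sum (T : ((i : ι) → Alt m (r i)) →L[ℝ] Alt m (m + 1)) (X : Model m)
    (a : (i : ι) → Alt m (r i)) :
    lowerContract (⇑T) X a = ∑ j, contractVecL m j
      (T fun i => wedgeContractL (covec m j) X (a i)) := by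
  simp only [lowerContract, wedgeContractL_apply]
  rfl

lemma AdmAt.contDiffAt_divL {n : WithTop ℕ∞} (hn : n ≤ ∞) (hφ : AdmAt Λ φ p) :
    ContDiffAt ℝ n (fun z => divL (dMomentum Λ φ z)) p := by
  refine ContDiffAt.sum fun l _ => ?_
  exact ((hφ.contDiffAt_dMomentum.of_le hn).clm_apply contDiffAt_const).clm_comp contDiffAt_const

lemma contDiffAt_wedgeContract {n : WithTop ℕ∞} {k : ℕ} (α : Model m →L[ℝ] ℝ)
    {η : MForm m (Model m) k} (hη : ContDiffAt ℝ n η p) (hX : ContDiffAt ℝ n X p) :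
    ContDiffAt ℝ n (fun z => wedgeContractL α (X z) (η z)) p :=
  (ContDiffAt.comp (g := fun X => wedgeContractL (k := k) α X) (f := X) p
    (contDiff_wedgeContractL α).contDiffAt hX).clm_apply hη

lemma AdmAt.contDiffAt_lowerContract {n : WithTop ℕ∞} (hn : n ≤ ∞) (hφ : AdmAt Λ φ p)
    (hX : ContDiffAt ℝ n X p) :
    ContDiffAt ℝ n (fun z => lowerContract (⇑(divL (dMomentum Λ φ z))) (X z) (fun i => φ i z))
      p := by
  simp only [lowerContract_eq_sum]
  refine ContDiffAt.sum fun l _ => ?_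
  refine (contractVecL m l).contDiff.contDiffAt.comp p ?_
  refine (hφ.contDiffAt_divL hn).clm_apply (contDiffAt_pi.2 fun i => ?_)
  exact contDiffAt_wedgeContract _ ((hφ.contDiffAt i).of_le hn) hX

/-- A double sum of a symmetric against an antisymmetric expression vanishes. -/
lemma sum_sum_eq_zero_of_antisymm {n : ℕ} {F : Type*} [AddCommGroup F] [Module ℝ F]
    (f : Fin n → Fin n → F) (h : ∀ i j, f i j = - f j i) : ∑ i, ∑ j, f i j = 0 := by
  have h1 : ∑ i, ∑ j, f i j = - ∑ i, ∑ j, f i j := by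
    conv_lhs => rw [Finset.sum_comm]
    simp only [← Finset.sum_neg_distrib]
    exact Finset.sum_congr rfl fun i _ => Finset.sum_congr rfl fun j _ => h j i
  rw [eq_neg_iff_add_eq_zero, ← two_smul ℝ] at h1
  exact (smul_eq_zero.1 h1).resolve_left two_ne_zero

/-- The differential is `∑ ∂_l (∂_j L̃₁ (e^j ∧ e^l ∧ ι_X φ))`. Terms with `∂_l ∂_j L̃₁` cancel in
pairs, symmetric against antisymmetric; the others collect `∑ ∂_l (e^l ∧ ι_X φ)`. -/
lemma extDeriv_lowerContract (hφ : AdmAt Λ φ p) (hX : ContDiffAt ℝ 1 X p) :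
    extDeriv (fun z => lowerContract (⇑(divL (dMomentum Λ φ z))) (X z) (fun i => φ i z)) p =
      divL (dMomentum Λ φ p) (fun i => divContract X (φ i) p) := by
  have hXd := hX.differentiableAt (by simp)
  have hφd : ∀ i, DifferentiableAt ℝ (φ i) p := fun i =>
    (hφ.contDiffAt i).differentiableAt (by simp)
  rw [extDeriv_eq_sum_fderiv
    ((hφ.contDiffAt_lowerContract (by simp) hX).differentiableAt (by simp))]
  set W : Fin (m + 1) → Model m → (i : ι) → Alt m (r i) :=
    fun l z i => wedgeContract (covec m l) (X z) (φ i z) with hW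
  have hWd : ∀ l, HasFDerivAt (W l) (ContinuousLinearMap.pi fun i =>
      fderiv ℝ (fun z => wedgeContract (covec m l) (X z) (φ i z)) p) p := fun l =>
    hasFDerivAt_pi.2 fun i =>
      (hasFDerivAt_wedgeContract (covec m l) (hφd i) hXd).differentiableAt.hasFDerivAt
  have hS : HasFDerivAt (dMomentum Λ φ) (fderiv ℝ (dMomentum Λ φ) p) p :=
    (hφ.contDiffAt_dMomentum.differentiableAt (by simp)).hasFDerivAt
  have hsym : ∀ v w, fderiv ℝ (dMomentum Λ φ) p v w = fderiv ℝ (dMomentum Λ φ) p w v := by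
    have := ((Λ.contDiffAt_d₁ hφ.mem_dom).comp p hφ.contDiffAt_jet).isSymmSndFDerivAt
      (by simpa using two_le_infty)
    exact fun v w => this.eq v w
  have h1 : ∀ l, fderiv ℝ (fun z => wedgeOne (covec m l)
      (lowerContract (⇑(divL (dMomentum Λ φ z))) (X z) (fun i => φ i z))) p (vec m l) =
      ∑ j, (fderiv ℝ (dMomentum Λ φ) p (vec m l) (vec m j) (wedgeCovecL r j (W l p)) +
        dMomentum Λ φ p (vec m j) (wedgeCovecL r j (fun i =>
          fderiv ℝ (fun z => wedgeContract (covec m l) (X z) (φ i z)) p (vec m l)))) := by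
    intro l
    have e1 : (fun z => wedgeOne (covec m l)
        (lowerContract (⇑(divL (dMomentum Λ φ z))) (X z) (fun i => φ i z))) =
        fun z => ∑ j, dMomentum Λ φ z (vec m j) (wedgeCovecL r j (W l z)) := by
      funext z
      rw [wedgeOne_lowerContract (divL (dMomentum Λ φ z)), divL_apply]
      rfl
    rw [e1]
    have e2 : ∀ j, HasFDerivAt (fun z => dMomentum Λ φ z (vec m j) (wedgeCovecL r j (W l z)))
        _ p := fun j =>
      (hS.clm_apply (hasFDerivAt_const (vec m j) p)).clm_apply
        (HasFDerivAt.comp (g := wedgeCovecL r j) p (wedgeCovecL r j).hasFDerivAt (hWd l))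
    rw [(HasFDerivAt.fun_sum fun j _ => e2 j).fderiv, _root_.sum_apply]
    refine Finset.sum_congr rfl fun j _ => ?_
    simp only [ContinuousLinearMap.comp_zero, zero_add]
    exact add_comm (dMomentum Λ φ p (vec m j) (wedgeCovecL r j (fun i =>
          fderiv ℝ (fun z => wedgeContract (covec m l) (X z) (φ i z)) p (vec m l)))) _
  simp only [h1, Finset.sum_add_distrib]
  rw [sum_sum_eq_zero_of_antisymm, zero_add, Finset.sum_comm]
  · rw [divL_apply]
    refine Finset.sum_congr rfl fun j _ => ?_
    rw [← map_sum_fin (s := fun i => r i + 1) (dMomentum Λ φ p (vec m j))]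
    congr 1
    funext i
    simp only [Finset.sum_apply, divContract, wedgeOne_sum]
    rfl
  · intro l j
    rw [hsym (vec m l) (vec m j), ← ContinuousLinearMap.map_neg]
    congr 1
    funext i
    exact wedgeOne_wedgeContract_anticomm _ _ _ _

/-- `E(𝔏_X φ; φ) = dE(ι_X φ; φ)` on the model space. -/
lemma noether_model (hφ : AdmAt Λ φ p) (hX : ContDiffAt ℝ 1 X p) :
    extDeriv (fieldEqContract Λ φ X) p =
      eulerModel Λ φ p (fun i => lieModel X (φ i) p) := by
  have hXd := hX.differentiableAt (by simp)
  have e1 : fieldEqContract Λ φ X =ᶠ[𝓝 p] fun z => interior X (lagr Λ φ) z -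
      theta Λ φ (contractD X φ) z -
      lowerContract (⇑(divL (dMomentum Λ φ z))) (X z) (fun i => φ i z) := by
    filter_upwards [hφ.eventually] with z hz
    exact fieldEqContract_model hz
  have d1 : DifferentiableAt ℝ (interior X (lagr Λ φ)) p :=
    (contDiffAt_interior (hφ.contDiffAt_lagr.of_le (by simp)) hX).differentiableAt (by simp)
  have d2 : DifferentiableAt ℝ (theta Λ φ (contractD X φ)) p :=
    (contDiffAt_theta Λ (by simp) hφ.contDiffAt hφ.mem_dom
      (hφ.contDiffAt_contractD (by simp) hX)).differentiableAt (by simp)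
  have d3 := (hφ.contDiffAt_lowerContract (by simp) hX).differentiableAt (by simp)
  have e2 : extDeriv (fieldEqContract Λ φ X) p = extDeriv (interior X (lagr Λ φ)) p -
      extDeriv (theta Λ φ (contractD X φ)) p - extDeriv (fun z =>
        lowerContract (⇑(divL (dMomentum Λ φ z))) (X z) (fun i => φ i z)) p := by
    rw [e1.extDeriv_eq]
    simp only [extDeriv_eq_altL]
    rw [← altL_sub, ← altL_sub]
    congr 1
    exact ((d1.hasFDerivAt.sub d2.hasFDerivAt).sub d3.hasFDerivAt).fderiv
  rw [e2, extDeriv_interior_lagr hφ hX, lieModel_lagr hφ, extDeriv_lowerContract hφ hX,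
    extDeriv_theta Λ hφ.contDiffAt hφ.mem_dom (hφ.contDiffAt_contractD (by simp) hX)]
  -- The `L̃₁` terms cancel because `𝔏_X dφ = d ι_X dφ`, and by Cartan's formula the two `divL`
  -- terms add up to `divL` of `𝔏_X φ`.
  have h1 : (fun i => lieModel X (φ i) p) =
      (fun i => contractD X φ i p) + fun i => divContract X (φ i) p := by
    funext i
    exact lieModel_eq ((hφ.contDiffAt i).differentiableAt (by simp)) hXd
  have h2 : (fun i => lieModel X (extDeriv (φ i)) p) =
      fun i => extDeriv (contractD X φ i) p := by
    funext i
    exact lieModel_extDeriv (hφ.contDiffAt i) hX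
  have h3 : divL (dMomentum Λ φ p) (fun i => lieModel X (φ i) p) =
      divL (dMomentum Λ φ p) (fun i => contractD X φ i p) +
        divL (dMomentum Λ φ p) (fun i => divContract X (φ i) p) := by
    rw [h1, ContinuousLinearMap.map_add]
  have h4 : eulerModel Λ φ p (fun i => lieModel X (φ i) p) =
      Λ.d₀ (jet φ p) (fun i => lieModel X (φ i) p) -
        divL (dMomentum Λ φ p) (fun i => lieModel X (φ i) p) := rfl
  rw [h4, h3, h2]
  change _ - (divL (dMomentum Λ φ p) _ + _) - _ = _
  abel

end NoetherModel

end FieldDiff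

namespace FieldDiff

/-! ### Lie derivatives on a manifold, and the Noether identity -/

section LieManifold

variable {m k : ℕ} {M : Type*} [TopologicalSpace M] [ChartedSpace (Model m) M]

/-- The expression of a vector field in the preferred chart at `x`. -/
noncomputable def vecChart (x : M) (X : M → Model m) : Model m → Model m := fun z =>
  tmap m (ch m x) ((ch m x).symm z) (X ((ch m x).symm z))

/-- The Lie derivative of a form of any degree, computed at `x` in the preferred chart at `x`. -/
noncomputable def lieM (X : M → Model m) (η : MForm m M k) : MForm m M k := fun x =>
  lieModel (vecChart x X) (inChart x η) (ch m x x)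

/-- The vector field `X` is `C^n` at `x`. -/
def VecSmoothAt (n : WithTop ℕ∞) (X : M → Model m) (x : M) : Prop :=
  ContDiffAt ℝ n (vecChart x X) (ch m x x)

lemma extD_eq_extDeriv (η : MForm m M k) (x : M) [IsManifold 𝓘(ℝ, Model m) ∞ M] :
    extD η x = extDeriv (inChart x η) (ch m x x) := by
  simp only [extD]
  rw [show tmap m (extChartAt 𝓘(ℝ, Model m) x) x = _ from tmap_ch_self x]
  rfl

variable [IsManifold 𝓘(ℝ, Model m) ∞ M]

lemma tmap_ch_symm_vecChart {x : M} {z : Model m} (hz : z ∈ (ch m x).target) (X : M → Model m) :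
    tmap m (ch m x).symm z (vecChart x X z) = X ((ch m x).symm z) := by
  have h := tmap_ch_symm_comp (m := m) (x₀ := x) (y := (ch m x).symm z) ((ch m x).map_target hz)
  rw [(ch m x).right_inv hz] at h
  exact DFunLike.congr_fun h _

lemma inChart_interior {x : M} {z : Model m} (hz : z ∈ (ch m x).target) (X : M → Model m)
    (η : MForm m M (k + 1)) :
    inChart x (interior X η) z = interior (vecChart x X) (inChart x η) z := by
  simp only [inChart, pullback, interior]
  rw [← tmap_ch_symm_vecChart hz X]
  ext v
  simp only [ContinuousAlternatingMap.compContinuousLinearMap_apply,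
    ContinuousAlternatingMap.curryLeft_apply_apply]
  congr 1
  funext j
  refine Fin.cases ?_ (fun j => ?_) j <;> rfl

lemma inChart_interior_eventuallyEq (x : M) (X : M → Model m) (η : MForm m M (k + 1)) :
    inChart x (interior X η) =ᶠ[𝓝 (ch m x x)] interior (vecChart x X) (inChart x η) := by
  filter_upwards [ch_target_mem (mem_extChartAt_target x)] with z hz
  exact inChart_interior hz X η

lemma SmoothAt.interior {n : WithTop ℕ∞} {x : M} {X : M → Model m} {η : MForm m M (k + 1)}
    (hη : SmoothAt n η x) (hX : VecSmoothAt n X x) : SmoothAt n (interior X η) x :=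
  (contDiffAt_interior hη hX).congr_of_eventuallyEq (inChart_interior_eventuallyEq x X η)

omit [IsManifold 𝓘(ℝ, Model m) ∞ M] in
lemma extD_top (η : MForm m M (m + 1)) : extD η = 0 :=
  funext fun _ => Subsingleton.elim _ _

omit [IsManifold 𝓘(ℝ, Model m) ∞ M] in
lemma lieD_top (X : M → Model m) (L : MForm m M (m + 1)) :
    lieD X L = extD (interior X L) := by
  rw [lieD, extD_top]
  funext x
  simp [interior]

/-- `lieD` is Cartan's formula, available in positive degree; `lieM` is the chart formula, available
in every degree, as the variation of the fields requires. On top forms both are `d ι_X L`. -/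
lemma lieD_top_eq_lieM {x : M} {X : M → Model m} {L : MForm m M (m + 1)} (hL : SmoothAt 1 L x)
    (hX : VecSmoothAt 1 X x) : lieD X L x = lieM X L x := by
  rw [lieD_top, extD_eq_extDeriv, (inChart_interior_eventuallyEq x X L).extDeriv_eq,
    extDeriv_interior hL hX, lieM, lieModel_eq (ContDiffAt.differentiableAt hL (by simp))
      (ContDiffAt.differentiableAt hX (by simp)),
    Subsingleton.elim (extDeriv (inChart x L) (ch m x x)) 0]
  simp

variable {ι : Type*} [Fintype ι] {r : ι → ℕ} {Λ : NaturalLagrangian m r}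

/-- The Noether identity `E(𝔏_X φ; φ) = dE(ι_X φ; φ)`. -/
lemma extD_fieldEqContract {φ : Field m M r} {X : M → Model m} {x : M} (hφ : AdmAt Λ φ x)
    (hX : VecSmoothAt 1 X x) :
    extD (fieldEqContract Λ φ X) x = eulerLagrange Λ φ x (fun i => lieM X (φ i) x) := by
  have hx : (ch m x).symm (ch m x x) = x := (ch m x).left_inv (mem_extChartAt_source x)
  have hc : ContinuousAt (ch m x).symm (ch m x x) :=
    (contMDiffAt_ch_symm (mem_extChartAt_target x)).continuousAt
  have h2 : ∀ᶠ z in 𝓝 (ch m x x), AdmAt Λ φ ((ch m x).symm z) :=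
    hc.eventually (by rw [hx]; exact hφ.eventually)
  have e1 : inChart x (fieldEqContract Λ φ X) =ᶠ[𝓝 (ch m x x)]
      fieldEqContract Λ (chartField x φ) (vecChart x X) := by
    filter_upwards [h2, ch_target_mem (mem_extChartAt_target x)] with z hz hz'
    exact (fieldEqContract_pullField hz (lDiff_ch_symm hz') (tmap_ch_symm_vecChart hz' X)).symm
  rw [extD_eq_extDeriv, e1.extDeriv_eq, noether_model hφ.chartField hX, eulerLagrange_eq hφ]
  rfl

end LieManifold

/-! ### Variation of pullbacks along families of diffeomorphisms -/

section Flow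

variable {m k : ℕ} {M : Type*} [TopologicalSpace M] [ChartedSpace (Model m) M]
  {N : Type*} [TopologicalSpace N] [ChartedSpace (Model m) N]

/-- The velocity at parameter `0` of a curve in `M`. -/
noncomputable def curveVel (m : ℕ) {M : Type*} [TopologicalSpace M] [ChartedSpace (Model m) M]
    (γ : ℝ → M) : Model m :=
  (mfderiv 𝓘(ℝ, ℝ) 𝓘(ℝ, Model m) γ 0 : ℝ →L[ℝ] Model m) 1

lemma curveVel_comp {γ : ℝ → N} {f : N → M}
    (hf : MDifferentiableAt 𝓘(ℝ, Model m) 𝓘(ℝ, Model m) f (γ 0))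
    (hγ : MDifferentiableAt 𝓘(ℝ, ℝ) 𝓘(ℝ, Model m) γ 0) :
    curveVel m (fun τ => f (γ τ)) = tmap m f (γ 0) (curveVel m γ) := by
  have := mfderiv_comp (0 : ℝ) hf hγ
  exact DFunLike.congr_fun this 1

lemma curveVel_model (γ : ℝ → Model m) : curveVel m γ = deriv γ 0 := by
  simp only [curveVel, mfderiv_eq_fderiv]
  rfl

variable [IsManifold 𝓘(ℝ, Model m) ∞ M] [IsManifold 𝓘(ℝ, Model m) ∞ N]

lemma vecChart_velocity {H : ℝ → M → M}
    (hH : ContMDiff (𝓘(ℝ, ℝ).prod 𝓘(ℝ, Model m)) 𝓘(ℝ, Model m) ∞ (fun p : ℝ × M => H p.1 p.2))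
    (h0 : ∀ y, H 0 y = y) {x : M} {z : Model m} (hz : z ∈ (ch m x).target) :
    vecChart x (fun y => curveVel m fun τ => H τ y) z =
      fderiv ℝ (fun p : ℝ × Model m => ch m x (H p.1 ((ch m x).symm p.2))) (0, z) (1, 0) := by
  have hs : H 0 ((ch m x).symm z) ∈ (ch m x).source := by
    rw [h0]; exact (ch m x).map_target hz
  have hd := (contDiffAt_localRep le_rfl hz (hH _) hs).differentiableAt (by simp)
  have h1 := hd.hasFDerivAt.comp_hasDerivAt (0 : ℝ)
    (f := fun σ : ℝ => (σ, z)) ((hasDerivAt_id (0 : ℝ)).prodMk (hasDerivAt_const _ _))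
  have hγ : MDifferentiableAt 𝓘(ℝ, ℝ) 𝓘(ℝ, Model m) (fun τ => H τ ((ch m x).symm z)) 0 :=
    ((hH.comp (contMDiff_id.prodMk contMDiff_const)).contMDiffAt).mdifferentiableAt (by simp)
  have h2 := curveVel_comp (f := ch m x) (γ := fun τ => H τ ((ch m x).symm z))
    (mdiffAt_ch hs) hγ
  have h3 : deriv (fun τ => ch m x (H τ ((ch m x).symm z))) 0 = _ := h1.deriv
  rw [curveVel_model, h3, h0] at h2
  exact h2.symm

lemma vecSmoothAt_velocity {H : ℝ → M → M}
    (hH : ContMDiff (𝓘(ℝ, ℝ).prod 𝓘(ℝ, Model m)) 𝓘(ℝ, Model m) ∞ (fun p : ℝ × M => H p.1 p.2))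
    (h0 : ∀ y, H 0 y = y) (x : M) :
    VecSmoothAt ∞ (fun y => curveVel m fun τ => H τ y) x := by
  have hs : H 0 ((ch m x).symm (ch m x x)) ∈ (ch m x).source := by
    rw [h0]; exact (ch m x).map_target (mem_extChartAt_target x)
  have h1 := contDiffAt_localRep le_rfl (mem_extChartAt_target x) (hH _) hs
  have h2 : ContDiffAt ℝ ∞ (fun z => fderiv ℝ
      (fun p : ℝ × Model m => ch m x (H p.1 ((ch m x).symm p.2))) (0, z) (1, 0)) (ch m x x) := by
    refine ContDiffAt.clm_apply ?_ contDiffAt_const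
    exact ContDiffAt.comp (ch m x x) (f := fun z => ((0 : ℝ), z))
      (h1.fderiv_right (by simp)) (by fun_prop)
  refine h2.congr_of_eventuallyEq ?_
  filter_upwards [ch_target_mem (mem_extChartAt_target x)] with z hz
  exact vecChart_velocity hH h0 hz

/-- Variation of a pullback along a family of maps starting at the identity. -/
lemma hasDerivAt_pullback_flow {H : ℝ → M → M} {η : ℝ → MForm m M k}
    (hH : ContMDiff (𝓘(ℝ, ℝ).prod 𝓘(ℝ, Model m)) 𝓘(ℝ, Model m) ∞ (fun p : ℝ × M => H p.1 p.2))
    (h0 : ∀ y, H 0 y = y) (hη : IsSmoothFamily η) (x : M) :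
    HasDerivAt (fun τ => pullback (H τ) (η τ) x)
      (vel η x + lieM (fun y => curveVel m fun τ => H τ y) (η 0) x) 0 := by
  have hs := isSmoothFamily_iff.1 hη
  have hx : (ch m x).symm (ch m x x) = x := (ch m x).left_inv (mem_extChartAt_source x)
  have hsrc : H 0 ((ch m x).symm (ch m x x)) ∈ (ch m x).source := by
    rw [h0]; exact (ch m x).map_target (mem_extChartAt_target x)
  set z₀ := ch m x x with hz₀
  set W : ℝ × Model m → Alt m k := fun p => inChart x (η p.1) p.2 with hW
  set h : ℝ × Model m → Model m := fun p => ch m x (H p.1 ((ch m x).symm p.2)) with hh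
  have hh0 : ∀ᶠ z in 𝓝 z₀, h (0, z) = z := by
    filter_upwards [ch_target_mem (mem_extChartAt_target x)] with z hz
    simp only [hh, h0]
    exact (ch m x).right_inv hz
  have hhs : ContDiffAt ℝ ∞ h (0, z₀) :=
    contDiffAt_localRep le_rfl (mem_extChartAt_target x) (hH _) hsrc
  have hWd : HasFDerivAt W (fderiv ℝ W (0, z₀)) (0, z₀) :=
    (ContDiffAt.differentiableAt (hs 0 x) (by simp)).hasFDerivAt
  have hhd : HasFDerivAt h (fderiv ℝ h (0, z₀)) (0, z₀) :=
    (hhs.differentiableAt (by simp)).hasFDerivAt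
  have hhdd : HasFDerivAt (fderiv ℝ h) (fderiv ℝ (fderiv ℝ h) (0, z₀)) (0, z₀) :=
    ((hhs.fderiv_right (m := 1) one_add_one_le).differentiableAt (by simp)).hasFDerivAt
  have hτ : HasDerivAt (fun σ : ℝ => (σ, z₀)) ((1 : ℝ), (0 : Model m)) 0 :=
    (hasDerivAt_id (0 : ℝ)).prodMk (hasDerivAt_const _ _)
  set V := vecChart x (fun y => curveVel m fun τ => H τ y) with hV
  have hVz : ∀ᶠ z in 𝓝 z₀, V z = fderiv ℝ h (0, z) (1, 0) := by
    filter_upwards [ch_target_mem (mem_extChartAt_target x)] with z hz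
    exact vecChart_velocity hH h0 hz
  have hinr : HasFDerivAt (fun z : Model m => ((0 : ℝ), z)) (.inr ℝ ℝ (Model m)) z₀ :=
    (hasFDerivAt_const (0 : ℝ) z₀).prodMk (hasFDerivAt_id (𝕜 := ℝ) z₀)
  -- The family starts at the identity, so the frame derivative of the pullback is taken at the
  -- identity.
  have hid : (fderiv ℝ h (0, z₀)).comp (.inr ℝ ℝ (Model m)) = .id ℝ (Model m) := by
    have h1 := HasFDerivAt.comp z₀ (g := h) (f := fun z => ((0 : ℝ), z)) hhd hinr
    exact HasFDerivAt.unique (f := fun z => h (0, z)) h1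
      ((hasFDerivAt_id z₀).congr_of_eventuallyEq hh0)
  -- `V` is `∂h/∂τ` at `τ = 0`, so by symmetry of second derivatives the rate of change of the
  -- tangent map of `h` is `DV`.
  have hfV : fderiv ℝ V z₀ = (fderiv ℝ (fderiv ℝ h) (0, z₀) (1, 0)).comp (.inr ℝ ℝ (Model m)) := by
    have h2' := HasFDerivAt.comp z₀ (g := fderiv ℝ h) (f := fun z => ((0 : ℝ), z)) hhdd hinr
    have h2 := h2'.clm_apply (hasFDerivAt_const ((1 : ℝ), (0 : Model m)) z₀)
    rw [Filter.EventuallyEq.fderiv_eq (f₁ := V) hVz]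
    refine h2.fderiv.trans ?_
    have hsym := (hhs.isSymmSndFDerivAt (by simpa using two_le_infty)).eq
    ext1 v
    simp only [ContinuousLinearMap.comp_zero, zero_add, Function.comp_apply]
    exact hsym (0, v) (1, 0)
  have hfη : fderiv ℝ (inChart x (η 0)) z₀ = (fderiv ℝ W (0, z₀)).comp (.inr ℝ ℝ (Model m)) :=
    (HasFDerivAt.comp z₀ (g := W) (f := fun z => ((0 : ℝ), z)) hWd hinr).fderiv
  have hvel : vel η x = fderiv ℝ W (0, z₀) (1, 0) := by
    rw [← inChart_self x (vel η)]
    exact inChart_vel (mem_extChartAt_target x) ((hs 0 _).of_le (by simp))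
  have e1 : (fun τ => pullback (H τ) (η τ) x) =ᶠ[𝓝 0] fun τ =>
      (W (τ, h (τ, z₀))).compContinuousLinearMap
        ((fderiv ℝ h (τ, z₀)).comp (.inr ℝ ℝ (Model m))) := by
    have h1 := inChart_pullback_eventuallyEq (g := H) η (x₀ := x) (y₀ := x)
      (mem_extChartAt_target x) ((hH _).of_le (by simp)) hsrc
    have h2 : Tendsto (fun σ : ℝ => (σ, z₀)) (𝓝 0) (𝓝 (0, z₀)) := hτ.continuousAt
    filter_upwards [h2.eventually h1] with τ hτ
    rw [← inChart_self x (FieldDiff.pullback (H τ) (η τ))]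
    exact hτ
  refine HasDerivAt.congr_of_eventuallyEq ?_ e1
  have d1 : HasDerivAt (fun τ => h (τ, z₀)) (fderiv ℝ h (0, z₀) (1, 0)) 0 :=
    HasFDerivAt.comp_hasDerivAt (l := h) (0 : ℝ) (f := fun σ : ℝ => (σ, z₀)) hhd hτ
  have hh00 : h (0, z₀) = z₀ := hh0.self_of_nhds
  have d2 : HasDerivAt (fun τ => W (τ, h (τ, z₀)))
      (fderiv ℝ W (0, z₀) (1, fderiv ℝ h (0, z₀) (1, 0))) 0 :=
    HasFDerivAt.comp_hasDerivAt (l := W) (0 : ℝ) (f := fun σ : ℝ => (σ, h (σ, z₀)))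
      (by rw [hh00]; exact hWd) ((hasDerivAt_id (0 : ℝ)).prodMk d1)
  have d3 : HasDerivAt (fun τ => (fderiv ℝ h (τ, z₀)).comp (.inr ℝ ℝ (Model m)))
      ((fderiv ℝ (fderiv ℝ h) (0, z₀) (1, 0)).comp (.inr ℝ ℝ (Model m))) 0 := by
    have h4 := HasFDerivAt.comp_hasDerivAt (l := fderiv ℝ h) (0 : ℝ) hhdd
      (f := fun σ : ℝ => (σ, z₀)) hτ
    simpa using h4.clm_comp (hasDerivAt_const (0 : ℝ) (ContinuousLinearMap.inr ℝ ℝ (Model m)))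
  have d4 := (d2.hasFDerivAt.continuousAlternatingMapCompContinuousLinearMap
    d3.hasFDerivAt).hasDerivAt
  refine d4.congr_deriv ?_
  rw [hid, hh00, lieM, ← hV, ← hz₀, lieModel, hfV, hfη, hvel, hVz.self_of_nhds]
  -- The explicit dependence on `τ` gives the velocity of `η`; the motion of the base point gives
  -- the transport term of the Lie derivative.
  have hsplit : ((1 : ℝ), fderiv ℝ h (0, z₀) (1, 0)) =
      (1, 0) + ContinuousLinearMap.inr ℝ ℝ (Model m) (fderiv ℝ h (0, z₀) (1, 0)) := by simp
  rw [hsplit, map_add, ← add_assoc]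
  simp only [_root_.add_apply, ContinuousLinearMap.comp_apply,
    ContinuousLinearMap.toSpanSingleton_apply, one_smul]
  rfl

/-! Families of diffeomorphisms. -/

variable {g : ℝ → Diffeo m N M}

omit [IsManifold 𝓘(ℝ, Model m) ∞ M] [IsManifold 𝓘(ℝ, Model m) ∞ N] in
lemma IsDiffFamily.contMDiff_flow (hg : IsDiffFamily g) :
    ContMDiff (𝓘(ℝ, ℝ).prod 𝓘(ℝ, Model m)) 𝓘(ℝ, Model m) ∞
      (fun p : ℝ × M => g p.1 ((g 0).symm p.2)) :=
  hg.comp (contMDiff_fst.prodMk ((g 0).symm.contMDiff.comp contMDiff_snd))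

omit [IsManifold 𝓘(ℝ, Model m) ∞ N] in
lemma vecSmoothAt_generator (hg : IsDiffFamily g) (y : M) : VecSmoothAt ∞ (generator g) y :=
  vecSmoothAt_velocity (H := fun τ y => g τ ((g 0).symm y)) hg.contMDiff_flow (by simp) y

omit [IsManifold 𝓘(ℝ, Model m) ∞ N] in
/-- The variation of a form at the point `x` when transported by a family of diffeomorphisms. -/
lemma hasDerivAt_pullback_family (hg : IsDiffFamily g) {η : ℝ → MForm m M k}
    (hη : IsSmoothFamily η) (x : N) :
    HasDerivAt (fun τ => pullback (g τ) (η τ) x)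
      (pullback (g 0) (vel η + lieM (generator g) (η 0)) x) 0 := by
  -- Writing `g_τ = (g_τ ∘ g_0⁻¹) ∘ g_0` reduces to a family on `M` that starts at the identity,
  -- pulled back by the fixed map `g_0`.
  have h1 := hasDerivAt_pullback_flow (H := fun τ y => g τ ((g 0).symm y)) hg.contMDiff_flow
    (by simp) hη (g 0 x)
  have h2 := hasDerivAt_pullback (f := g 0) (x := x)
    (η := fun τ => pullback (fun y => g τ ((g 0).symm y)) (η τ)) h1.differentiableAt
  have e1 : vel (fun τ => pullback (fun y => g τ ((g 0).symm y)) (η τ)) (g 0 x) =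
      (vel η + lieM (generator g) (η 0)) (g 0 x) := h1.deriv
  have e2 : ∀ τ, pullback (g 0) (pullback (fun y => g τ ((g 0).symm y)) (η τ)) x =
      pullback (g τ) (η τ) x := fun τ => by
    have hd : ∀ τ y, MDifferentiableAt 𝓘(ℝ, Model m) 𝓘(ℝ, Model m) (g τ) y :=
      fun τ y => ((g τ).contMDiff y).mdifferentiableAt (by simp)
    have hd' : MDifferentiableAt 𝓘(ℝ, Model m) 𝓘(ℝ, Model m)
        (fun y => g τ ((g 0).symm y)) (g 0 x) :=
      (((g τ).contMDiff.comp (g 0).symm.contMDiff) _).mdifferentiableAt (by simp)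
    rw [← pullback_comp (η τ) hd' (hd 0 x)]
    simp
  simp only [e2] at h2
  refine h2.congr_deriv ?_
  simp only [pullback]
  rw [e1]

lemma isSmoothFamily_pullback (hg : IsDiffFamily g) {η : ℝ → MForm m M k}
    (hη : IsSmoothFamily η) : IsSmoothFamily (fun τ => pullback (g τ) (η τ)) := by
  rw [isSmoothFamily_iff] at hη ⊢
  exact fun τ x => SmoothFam.pullback (g := fun τ => g τ) (by simp) (hη τ _) (hg _)

omit [IsManifold 𝓘(ℝ, Model m) ∞ N] in
lemma vel_pullback (hg : IsDiffFamily g) {η : ℝ → MForm m M k} (hη : IsSmoothFamily η) :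
    vel (fun τ => pullback (g τ) (η τ)) =
      pullback (g 0) (vel η + lieM (generator g) (η 0)) :=
  funext fun x => (hasDerivAt_pullback_family hg hη x).deriv

end Flow

/-! ### Variation of the Lagrangian along curves of fields -/

section LagrFamily

variable {m : ℕ} {ι : Type*} [Fintype ι] {r : ι → ℕ} {Λ : NaturalLagrangian m r}
  {M : Type*} [TopologicalSpace M] [ChartedSpace (Model m) M]
  [IsManifold 𝓘(ℝ, Model m) ∞ M]

omit [Fintype ι] in
lemma jet_chartField {φ : Field m M r} {x₀ : M} {z : Model m} (hz : z ∈ (ch m x₀).target)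
    (hφ : ∀ i, SmoothAt 1 (φ i) ((ch m x₀).symm z)) :
    jet (chartField x₀ φ) z = (fun i => inChart x₀ (φ i) z, fun i => inChart x₀ (extD (φ i)) z) := by
  rw [chartField, jet_pullField hφ ((contMDiffAt_ch_symm hz).of_le two_le_infty)]
  rfl

lemma isSmoothFamily_lagr {c : ℝ → Field m M r} (hc : ∀ i, IsSmoothFamily fun τ => c τ i)
    (hd : ∀ τ x, jet (c τ) x ∈ Λ.dom) : IsSmoothFamily fun τ => lagr Λ (c τ) := by
  have hs : ∀ i τ x, SmoothFam ∞ (fun τ => c τ i) τ x := fun i => isSmoothFamily_iff.1 (hc i)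
  have hadm : ∀ τ x, AdmAt Λ (c τ) x := fun τ x =>
    Eventually.of_forall fun y => ⟨fun i => (hs i τ y).smoothAt, hd τ y⟩
  rw [isSmoothFamily_iff]
  intro τ x
  have hsd : ∀ i, ContDiffAt ℝ ∞ (fun p : ℝ × Model m => inChart x (extD (c p.1 i)) p.2)
      (τ, ch m x x) := fun i =>
    SmoothFam.extD (n := ∞) (η := fun τ => c τ i) ((hs i τ x).of_le (by simp))
  have h1 : ContDiffAt ℝ ∞ (fun p : ℝ × Model m => Λ.toFun
      ((fun i => inChart x (c p.1 i) p.2, fun i => inChart x (extD (c p.1 i)) p.2) : Jet m r))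
      (τ, ch m x x) := by
    refine ContDiffAt.comp (τ, ch m x x) (g := Λ.toFun)
      (f := fun p : ℝ × Model m =>
        ((fun i => inChart x (c p.1 i) p.2, fun i => inChart x (extD (c p.1 i)) p.2) : Jet m r))
      ?_ (ContDiffAt.prodMk (contDiffAt_pi.2 fun i => hs i τ x) (contDiffAt_pi.2 fun i => ?_))
    · refine Λ.contDiffAt ?_
      have := (hadm τ x).chartField.mem_dom
      rwa [jet_chartField (mem_extChartAt_target x) fun i => (hs i τ _).smoothAt.of_le (by simp)]
        at this
    · exact hsd i
  refine h1.congr_of_eventuallyEq ?_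
  have h3 : ∀ᶠ p : ℝ × Model m in 𝓝 (τ, ch m x x), p.2 ∈ (ch m x).target :=
    continuousAt_snd.eventually (ch_target_mem (mem_extChartAt_target x))
  filter_upwards [h3] with p hp
  have := lagr_pullField (hadm p.1 ((ch m x).symm p.2)) (lDiff_ch_symm hp)
  rw [← jet_chartField hp fun i => (hs i p.1 _).smoothAt.of_le (by simp)]
  exact this.symm

lemma hasDerivAt_lagr {c : ℝ → Field m M r} (hc : ∀ i, IsSmoothFamily fun τ => c τ i)
    (hd : ∀ x, jet (c 0) x ∈ Λ.dom) (x : M) :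
    HasDerivAt (fun τ => lagr Λ (c τ) x) (varLagr Λ (c 0) (velocity c) x) 0 := by
  refine HasFDerivAt.comp_hasDerivAt (l := Λ.toFun) (f := fun τ => jet (c τ) x) (0 : ℝ)
    (Λ.hasFDerivAt (hd x)) ?_
  refine HasDerivAt.prodMk (hasDerivAt_pi.2 fun i => ?_) (hasDerivAt_pi.2 fun i =>
    hasDerivAt_extD (hc i) x)
  exact ((isSmoothFamily_iff.1 (hc i) 0 x).of_le (by simp)).differentiableAt.hasDerivAt

lemma vel_lagr {c : ℝ → Field m M r} (hc : ∀ i, IsSmoothFamily fun τ => c τ i)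
    (hd : ∀ x, jet (c 0) x ∈ Λ.dom) :
    vel (fun τ => lagr Λ (c τ)) = varLagr Λ (c 0) (velocity c) :=
  funext fun x => (hasDerivAt_lagr hc hd x).deriv

end LagrFamily

end FieldDiff

namespace FieldDiff

/-! ### Integration over chains -/

section Cubes

variable {m k l : ℕ} {n : WithTop ℕ∞} {M : Type*} [TopologicalSpace M] [ChartedSpace (Model m) M]
  {N : Type*} [TopologicalSpace N] [ChartedSpace (Model m) N]

/-- The tangent map of a cube. -/
noncomputable def cubeDeriv (σ : Cube m M k) (t : Fin k → ℝ) : (Fin k → ℝ) →L[ℝ] Model m :=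
  mfderiv 𝓘(ℝ, Fin k → ℝ) 𝓘(ℝ, Model m) σ.toFun t

/-- The pullback `σ^* η`. -/
noncomputable def cubePull (σ : Cube m M k) (η : MForm m M l) (t : Fin k → ℝ) :
    (Fin k → ℝ) [⋀^Fin l]→L[ℝ] ℝ :=
  (η (σ.toFun t)).compContinuousLinearMap (cubeDeriv σ t)

lemma cube_integral_eq (σ : Cube m M k) (η : MForm m M k) :
    σ.integral η = ∫ t in Icc (0 : Fin k → ℝ) 1, cubePull σ η t fun i => Pi.single i 1 := rfl

lemma Cube.mdiffAt (σ : Cube m M k) (t : Fin k → ℝ) :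
    MDifferentiableAt 𝓘(ℝ, Fin k → ℝ) 𝓘(ℝ, Model m) σ.toFun t :=
  (σ.smooth t).mdifferentiableAt (by simp)

/-! Change of variables. -/

lemma cubeDeriv_map (f : Diffeo m M N) (σ : Cube m M k) (t : Fin k → ℝ) :
    cubeDeriv (σ.map f) t = (tmap m f (σ.toFun t)).comp (cubeDeriv σ t) :=
  mfderiv_comp t ((f.contMDiff _).mdifferentiableAt (by simp)) (σ.mdiffAt t)

lemma tmap_comp_tmap_symm (f : Diffeo m N M) (y : M) :
    (tmap m f (f.symm y)).comp (tmap m f.symm y) = .id ℝ _ := by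
  have h := tmap_comp (m := m) (g := f) (f := f.symm) (x := y)
    ((f.contMDiff _).mdifferentiableAt (by simp)) ((f.symm.contMDiff _).mdifferentiableAt (by simp))
  rw [← h]
  simp only [Diffeomorph.apply_symm_apply]
  exact tmap_id y

lemma cubePull_map_symm (f : Diffeo m N M) (σ : Cube m M k) (η : MForm m M l) (t : Fin k → ℝ) :
    cubePull (σ.map f.symm) (pullback f η) t = cubePull σ η t := by
  have h : (σ.map f.symm).toFun t = f.symm (σ.toFun t) := rfl
  simp only [cubePull, pullback]
  rw [cubeDeriv_map, h]
  change (η (f (f.symm (σ.toFun t)))).compContinuousLinearMap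
    (((tmap m f (f.symm (σ.toFun t))).comp (tmap m f.symm (σ.toFun t))).comp (cubeDeriv σ t)) = _
  rw [tmap_comp_tmap_symm, f.apply_symm_apply]
  rfl

lemma cube_integral_map_symm (f : Diffeo m N M) (σ : Cube m M k) (η : MForm m M k) :
    (σ.map f.symm).integral (pullback f η) = σ.integral η := by
  simp only [cube_integral_eq, cubePull_map_symm]

/-- No change of variables in the integral and no orientation sign are involved: `f⁻¹(U)` has the
same parameter cubes, on which the two integrands coincide pointwise. -/
lemma pair_preim (f : Diffeo m N M) (η : MForm m M k) (U : Chain m M k) :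
    pair (pullback f η) (preim f U) = pair η U := by
  unfold pair preim
  rw [Finsupp.sum_mapDomain_index (by simp) (by intros; push_cast; ring)]
  simp only [cube_integral_map_symm]

/-! Smoothness of pullbacks to cubes. -/

variable [IsManifold 𝓘(ℝ, Model m) ∞ M]

/-- The neighbourhood depends on the cube and not on the form, so that the identity can be used
along a family of forms. -/
lemma eventually_cubePull_eq (σ : Cube m M k) (t₀ : Fin k → ℝ) :
    ∀ᶠ t in 𝓝 t₀, ∀ {l : ℕ} (η : MForm m M l), cubePull σ η t =
      (inChart (σ.toFun t₀) η (ch m (σ.toFun t₀) (σ.toFun t))).compContinuousLinearMap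
        (fderiv ℝ (fun t => ch m (σ.toFun t₀) (σ.toFun t)) t) := by
  have h1 : ∀ᶠ t in 𝓝 t₀, σ.toFun t ∈ (ch m (σ.toFun t₀)).source :=
    (σ.smooth.continuous.tendsto t₀).eventually (ch_source_mem (mem_extChartAt_source _))
  filter_upwards [h1] with t ht l η
  have e1 : fderiv ℝ (fun t => ch m (σ.toFun t₀) (σ.toFun t)) t =
      (tmap m (ch m (σ.toFun t₀)) (σ.toFun t)).comp (cubeDeriv σ t) := by
    rw [← mfderiv_eq_fderiv]
    exact mfderiv_comp t (mdiffAt_ch ht) (σ.mdiffAt t)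
  rw [e1]
  simp only [inChart, pullback, cubePull]
  rw [(ch m (σ.toFun t₀)).left_inv ht]
  change _ = (η (σ.toFun t)).compContinuousLinearMap
    (((tmap m (ch m (σ.toFun t₀)).symm (ch m (σ.toFun t₀) (σ.toFun t))).comp
      (tmap m (ch m (σ.toFun t₀)) (σ.toFun t))).comp (cubeDeriv σ t))
  rw [tmap_ch_symm_comp ht]
  rfl

lemma contDiffAt_cubeRep (σ : Cube m M k) (t₀ : Fin k → ℝ) :
    ContDiffAt ℝ ∞ (fun t => ch m (σ.toFun t₀) (σ.toFun t)) t₀ := by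
  rw [← contMDiffAt_iff_contDiffAt]
  exact ContMDiffAt.comp t₀ (contMDiffAt_ch (mem_extChartAt_source _)) (σ.smooth t₀)

lemma contDiffAt_cubePull_family {η : ℝ → MForm m M l} {τ : ℝ} (σ : Cube m M k) {t₀ : Fin k → ℝ}
    (h : SmoothFam ∞ η τ (σ.toFun t₀)) :
    ContDiffAt ℝ ∞ (fun p : ℝ × (Fin k → ℝ) => cubePull σ (η p.1) p.2) (τ, t₀) := by
  have h1 : ∀ᶠ p : ℝ × (Fin k → ℝ) in 𝓝 (τ, t₀), cubePull σ (η p.1) p.2 =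
      (inChart (σ.toFun t₀) (η p.1) (ch m (σ.toFun t₀) (σ.toFun p.2))).compContinuousLinearMap
        (fderiv ℝ (fun t => ch m (σ.toFun t₀) (σ.toFun t)) p.2) :=
    (continuousAt_snd.eventually (eventually_cubePull_eq σ t₀)).mono fun p hp => hp _
  refine ContDiffAt.congr_of_eventuallyEq ?_ h1
  have h2 := contDiffAt_cubeRep σ t₀
  have h3 : ContDiffAt ℝ ∞
      (fun p : ℝ × (Fin k → ℝ) => ch m (σ.toFun t₀) (σ.toFun p.2)) (τ, t₀) :=
    ContDiffAt.comp (τ, t₀) (f := Prod.snd) h2 contDiffAt_snd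
  have h4 : ContDiffAt ℝ ∞ (fun p : ℝ × (Fin k → ℝ) =>
      fderiv ℝ (fun t => ch m (σ.toFun t₀) (σ.toFun t)) p.2) (τ, t₀) :=
    ContDiffAt.comp (τ, t₀) (f := Prod.snd) (h2.fderiv_right (m := ∞) (by simp)) contDiffAt_snd
  refine ContDiffAt.alt_comp' le_rfl ?_ h4
  exact ContDiffAt.comp (τ, t₀) (g := fun p : ℝ × Model m => inChart (σ.toFun t₀) (η p.1) p.2)
    (f := fun p : ℝ × (Fin k → ℝ) => (p.1, ch m (σ.toFun t₀) (σ.toFun p.2)))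
    h (contDiffAt_fst.prodMk h3)

lemma contDiff_cubePull {η : MForm m M l} (σ : Cube m M k)
    (h : ∀ y, SmoothAt ∞ η y) : ContDiff ℝ ∞ (cubePull σ η) := by
  rw [contDiff_iff_contDiffAt]
  intro t
  exact ContDiffAt.comp t (f := fun t => ((0 : ℝ), t))
    (contDiffAt_cubePull_family σ ((smoothAt_iff_smoothFam 0).1 (h (σ.toFun t)))) (by fun_prop)

lemma extDeriv_cubePull {η : MForm m M l} (σ : Cube m M k) (t : Fin k → ℝ)
    (h : SmoothAt 1 η (σ.toFun t)) : extDeriv (cubePull σ η) t = cubePull σ (extD η) t := by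
  have h1 : cubePull σ η =ᶠ[𝓝 t] fun s =>
      (inChart (σ.toFun t) η (ch m (σ.toFun t) (σ.toFun s))).compContinuousLinearMap
        (fderiv ℝ (fun s => ch m (σ.toFun t) (σ.toFun s)) s) :=
    (eventually_cubePull_eq σ t).mono fun s hs => hs η
  rw [h1.extDeriv_eq, extDeriv_pullback (r := 2)
      (f := fun s => ch m (σ.toFun t) (σ.toFun s)) (ContDiffAt.differentiableAt h (by simp))
    ((contDiffAt_cubeRep σ t).of_le two_le_infty) (by simp),
    (eventually_cubePull_eq σ t).self_of_nhds, inChart_self, extD_eq_extDeriv]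

lemma integrableOn_cubePull {η : MForm m M l} (σ : Cube m M k) (h : ∀ y, SmoothAt ∞ η y)
    (v : Fin l → Fin k → ℝ) :
    IntegrableOn (fun t => cubePull σ η t v) (Icc (0 : Fin k → ℝ) 1) :=
  Continuous.integrableOn_Icc (by
    have := (contDiff_cubePull σ h).continuous
    fun_prop)

lemma cube_integral_add {η η' : MForm m M k} (σ : Cube m M k) (h : ∀ y, SmoothAt ∞ η y)
    (h' : ∀ y, SmoothAt ∞ η' y) : σ.integral (η + η') = σ.integral η + σ.integral η' := by
  simp only [cube_integral_eq]
  rw [← integral_add (integrableOn_cubePull σ h _) (integrableOn_cubePull σ h' _)]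
  rfl

lemma pair_add {η η' : MForm m M k} (U : Chain m M k) (h : ∀ y, SmoothAt ∞ η y)
    (h' : ∀ y, SmoothAt ∞ η' y) : pair (η + η') U = pair η U + pair η' U := by
  unfold pair
  rw [← Finsupp.sum_add]
  refine Finsupp.sum_congr fun σ _ => ?_
  rw [cube_integral_add σ h h', mul_add]

/-! Differentiation under the integral sign. -/

lemma hasDerivAt_cube_integral {η : ℝ → MForm m M k} (h : IsSmoothFamily η) (σ : Cube m M k) :
    HasDerivAt (fun τ => σ.integral (η τ)) (σ.integral (vel η)) 0 := by
  have hs := isSmoothFamily_iff.1 h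
  set b : Fin k → Fin k → ℝ := fun i => Pi.single i 1 with hb
  set F : ℝ × (Fin k → ℝ) → ℝ := fun p => cubePull σ (η p.1) p.2 b with hF
  have hFs : ContDiff ℝ ∞ F := by
    rw [contDiff_iff_contDiffAt]
    rintro ⟨τ, t⟩
    exact (ContinuousLinearMap.contDiff (𝕜 := ℝ)
      (ContinuousAlternatingMap.apply ℝ (Fin k → ℝ) ℝ b)).contDiffAt.comp _
      (contDiffAt_cubePull_family σ (hs τ _))
  set F' : ℝ → (Fin k → ℝ) → ℝ := fun τ t => fderiv ℝ F (τ, t) (1, 0) with hF'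
  have hd : ∀ τ t, HasDerivAt (fun τ => F (τ, t)) (F' τ t) τ := fun τ t =>
    HasFDerivAt.comp_hasDerivAt (l := F) (f := fun τ => (τ, t)) τ
      ((hFs.differentiable (by simp)) (τ, t)).hasFDerivAt
      ((hasDerivAt_id τ).prodMk (hasDerivAt_const _ _))
  have hF'c : Continuous fun p : ℝ × (Fin k → ℝ) => F' p.1 p.2 :=
    (hFs.continuous_fderiv (by simp)).clm_apply continuous_const
  -- The dominating function is constant: the `τ`-derivative is continuous, hence bounded on the
  -- compact set `[-1, 1] × [0, 1]^k`.
  obtain ⟨C, hC⟩ := ((isCompact_Icc (a := (-1 : ℝ)) (b := 1)).prod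
    (isCompact_Icc (a := (0 : Fin k → ℝ)) (b := 1))).exists_bound_of_continuousOn
    hF'c.continuousOn
  have hv : ∀ t, F' 0 t = cubePull σ (vel η) t b := fun t => by
    have h1 := ((hs 0 (σ.toFun t)).of_le (by simp)).differentiableAt.hasDerivAt
    have h2 : HasDerivAt (fun τ => F (τ, t)) (cubePull σ (vel η) t b) 0 :=
      HasFDerivAt.comp_hasDerivAt (l := fun a : Alt m k => a fun i => cubeDeriv σ t (b i)) (0 : ℝ)
        (ContinuousAlternatingMap.apply ℝ (Model m) ℝ fun i => cubeDeriv σ t (b i)).hasFDerivAt h1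
    exact (hd 0 t).unique h2
  have key := (hasDerivAt_integral_of_dominated_loc_of_deriv_le
    (μ := volume.restrict (Icc (0 : Fin k → ℝ) 1)) (F := fun τ t => F (τ, t)) (F' := F')
    (x₀ := (0 : ℝ)) (s := Icc (-1) 1) (bound := fun _ => C) (Icc_mem_nhds (by simp) (by simp))
    (Eventually.of_forall fun τ => ?_) ?_ ?_ ?_ ?_ ?_).2
  · simp only [hv] at key
    exact key
  · exact (hFs.continuous.comp (by fun_prop : Continuous fun t => (τ, t))).aestronglyMeasurable
  · exact (hFs.continuous.comp
      (by fun_prop : Continuous fun t => ((0 : ℝ), t))).integrableOn_Icc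
  · exact (hF'c.comp (by fun_prop : Continuous fun t => ((0 : ℝ), t))).aestronglyMeasurable
  · exact (ae_restrict_iff' measurableSet_Icc).2 (Eventually.of_forall fun t ht τ hτ =>
      hC (τ, t) ⟨hτ, ht⟩)
  · exact integrableOn_const isCompact_Icc.measure_lt_top.ne (by simp)
  · exact Eventually.of_forall fun t τ _ => hd τ t

lemma hasDerivAt_pair {η : ℝ → MForm m M k} (h : IsSmoothFamily η) (U : Chain m M k) :
    HasDerivAt (fun τ => pair (η τ) U) (pair (vel η) U) 0 := by
  unfold pair Finsupp.sum
  exact HasDerivAt.fun_sum fun σ _ => (hasDerivAt_cube_integral h σ).const_mul _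

/-! Stokes' theorem. -/

lemma fderiv_insertNth (i : Fin (k + 1)) (a : ℝ) (t v : Fin k → ℝ) :
    fderiv ℝ (fun t : Fin k → ℝ => (i.insertNth a t : Fin (k + 1) → ℝ)) t v =
      i.insertNth 0 v := by
  have hd := (contDiff_insertNth i a).differentiable (by simp) t
  funext j
  have h1 : fderiv ℝ (fun t : Fin k → ℝ => (i.insertNth a t : Fin (k + 1) → ℝ)) t v j =
      fderiv ℝ (fun t : Fin k → ℝ => (i.insertNth a t : Fin (k + 1) → ℝ) j) t v := by
    rw [((hasFDerivAt_pi'.1 hd.hasFDerivAt) j).fderiv]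
    rfl
  rw [h1]
  refine Fin.succAboveCases i ?_ (fun j' => ?_) j
  · simp
  · simp only [Fin.insertNth_apply_succAbove]
    rw [(hasFDerivAt_apply (𝕜 := ℝ) j' t).fderiv]
    rfl

omit [IsManifold 𝓘(ℝ, Model m) ∞ M] in
lemma cube_integral_face (σ : Cube m M (k + 1)) (i : Fin (k + 1)) (a : ℝ) (η : MForm m M k) :
    (σ.face i a).integral η = ∫ t in Icc (0 : Fin k → ℝ) 1,
      cubePull σ η (i.insertNth a t) (fun j => Pi.single (i.succAbove j) 1) := by
  rw [cube_integral_eq]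
  congr 1
  funext t
  have h1 : cubeDeriv (σ.face i a) t = (cubeDeriv σ (i.insertNth a t)).comp
      (fderiv ℝ (fun t : Fin k → ℝ => (i.insertNth a t : Fin (k + 1) → ℝ)) t) := by
    rw [← mfderiv_eq_fderiv]
    exact mfderiv_comp t (σ.mdiffAt _)
      ((contDiff_insertNth i a).contMDiff.contMDiffAt.mdifferentiableAt (by simp))
  have h2 : ∀ j : Fin k, (i.insertNth (0 : ℝ) (Pi.single j (1 : ℝ)) : Fin (k + 1) → ℝ) =
      Pi.single (i.succAbove j) 1 := fun j => by
    funext j'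
    refine Fin.succAboveCases i ?_ (fun j'' => ?_) j'
    · simp
    · simp [Pi.single_apply]
  simp only [cubePull, h1]
  change (η (σ.toFun (i.insertNth a t))) (fun j => cubeDeriv σ (i.insertNth a t)
    (fderiv ℝ (fun t : Fin k → ℝ => (i.insertNth a t : Fin (k + 1) → ℝ)) t (Pi.single j 1))) = _
  simp only [fderiv_insertNth, h2]
  rfl

/-- The divergence theorem for the vector field whose `i`-th component is `(-1)^i` times the
coefficient of `σ^* η` with `e_i` omitted: its divergence is the coefficient of `d σ^* η`, and its
fluxes are the face integrals. -/
lemma cube_stokes {η : MForm m M k} (σ : Cube m M (k + 1)) (h : ∀ y, SmoothAt ∞ η y) :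
    σ.integral (extD η) = ∑ i : Fin (k + 1), (-1 : ℝ) ^ (i : ℕ) *
      ((σ.face i 1).integral η - (σ.face i 0).integral η) := by
  have hs := contDiff_cubePull σ h
  set b : Fin (k + 1) → Fin (k + 1) → ℝ := fun i => Pi.single i 1 with hb
  set f : Fin (k + 1) → (Fin (k + 1) → ℝ) → ℝ := fun i t =>
    (-1 : ℝ) ^ (i : ℕ) * cubePull σ η t (i.removeNth b) with hf
  have hfs : ∀ i, ContDiff ℝ ∞ (f i) := fun i => contDiff_const.mul
    ((ContinuousLinearMap.contDiff (𝕜 := ℝ)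
      (ContinuousAlternatingMap.apply ℝ (Fin (k + 1) → ℝ) ℝ (i.removeNth b))).comp hs)
  have hext : ∀ t, cubePull σ (extD η) t b = ∑ i, fderiv ℝ (f i) t (b i) := fun t => by
    rw [← extDeriv_cubePull σ t ((h _).of_le (by simp)),
      extDeriv_apply (hs.differentiable (by simp) t)]
    refine Finset.sum_congr rfl fun i _ => ?_
    rw [hf]
    simp only
    have hdi : DifferentiableAt ℝ (fun t => cubePull σ η t (i.removeNth b)) t :=
      (((ContinuousLinearMap.contDiff (𝕜 := ℝ) (n := ∞)
        (ContinuousAlternatingMap.apply ℝ (Fin (k + 1) → ℝ) ℝ (i.removeNth b))).comp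
        hs).differentiable (by simp)) t
    rw [(hdi.hasFDerivAt.const_mul ((-1) ^ (i : ℕ))).fderiv, _root_.smul_apply, zsmul_eq_mul, smul_eq_mul]
    push_cast
    rfl
  have hint : IntegrableOn (fun t => ∑ i, fderiv ℝ (f i) t (b i))
      (Icc (0 : Fin (k + 1) → ℝ) 1) := by
    refine Continuous.integrableOn_Icc (continuous_finsetSum _ fun i _ => ?_)
    exact ((hfs i).continuous_fderiv (by simp)).clm_apply continuous_const
  rw [cube_integral_eq]
  simp only [← hb, hext]
  rw [integral_divergence_of_hasFDerivAt_off_countable' (0 : Fin (k + 1) → ℝ) 1 (by simp) f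
    (fun i t => fderiv ℝ (f i) t) ∅ countable_empty
    (fun i => (hfs i).continuous.continuousOn)
    (fun t _ i => ((hfs i).differentiable (by simp) t).hasFDerivAt) hint]
  refine Finset.sum_congr rfl fun i _ => ?_
  simp only [cube_integral_face, hf, integral_const_mul, ← mul_sub]
  rfl

/-- The integration pairing as an additive map on chains. -/
noncomputable def pairHom (η : MForm m M k) : Chain m M k →+ ℝ :=
  Finsupp.liftAddHom fun σ => (AddMonoidHom.mulRight (σ.integral η)).comp (Int.castAddHom ℝ)

omit [IsManifold 𝓘(ℝ, Model m) ∞ M] in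
lemma pairHom_apply (η : MForm m M k) (U : Chain m M k) : pairHom η U = pair η U := rfl

omit [IsManifold 𝓘(ℝ, Model m) ∞ M] in
lemma pairHom_single (η : MForm m M k) (σ : Cube m M k) :
    pairHom η (Finsupp.single σ 1) = σ.integral η := by
  simp [pairHom]

/-- Stokes' theorem. -/
lemma pair_extD {η : MForm m M k} (h : ∀ y, SmoothAt ∞ η y) (U : Chain m M (k + 1)) :
    pair (extD η) U = pair η (boundary U) := by
  rw [← pairHom_apply η, boundary, map_finsuppSum, pair]
  refine Finsupp.sum_congr fun σ _ => ?_
  rw [cube_stokes σ h, map_zsmul, map_sum, zsmul_eq_mul]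
  congr 1
  refine Finset.sum_congr rfl fun i _ => ?_
  rw [map_zsmul, map_sub, pairHom_single, pairHom_single, zsmul_eq_mul]
  push_cast
  rfl

end Cubes

end FieldDiff

namespace FieldDiff

/-! ### Field spaces, curves of fields and solutions -/

section FieldSpace

variable {m : ℕ} {ι : Type*} [Fintype ι] {r : ι → ℕ} {Λ : NaturalLagrangian m r}
  {M : Type*} [TopologicalSpace M] [ChartedSpace (Model m) M]
  [IsManifold 𝓘(ℝ, Model m) ∞ M] {Φ : Set (Field m M r)}

lemma IsFieldSpace.smoothAt (hΦ : IsFieldSpace Λ Φ) {φ : Field m M r} (hφ : φ ∈ Φ) (i : ι)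
    (x : M) : SmoothAt ∞ (φ i) x := isSmoothForm_iff.1 (hΦ.smooth φ hφ i) x

lemma IsFieldSpace.admAt (hΦ : IsFieldSpace Λ Φ) {φ : Field m M r} (hφ : φ ∈ Φ) (x : M) :
    AdmAt Λ φ x :=
  Eventually.of_forall fun y => ⟨fun i => hΦ.smoothAt hφ i y, hΦ.jet_mem φ hφ y⟩

lemma isSmoothFamily_add_smul {k : ℕ} {η ζ : MForm m M k} {s : ℝ → ℝ} (hη : ∀ y, SmoothAt ∞ η y)
    (hζ : ∀ y, SmoothAt ∞ ζ y) (hs : ContDiff ℝ ∞ s) :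
    IsSmoothFamily fun τ => η + s τ • ζ := by
  rw [isSmoothFamily_iff]
  intro τ y
  have h1 := (smoothAt_iff_smoothFam τ).1 (hη y)
  have h2 := (smoothAt_iff_smoothFam τ).1 (hζ y)
  exact ContDiffAt.add h1 (ContDiffAt.smul (hs.contDiffAt.comp (τ, ch m y y) contDiffAt_fst) h2)

/-- Every compactly supported perturbation is the velocity of a curve in the field space. -/
lemma IsFieldSpace.exists_curve (hΦ : IsFieldSpace Λ Φ) {φ δ : Field m M r} (hφ : φ ∈ Φ)
    (hδ : ∀ i, IsSmoothForm (δ i)) (hK : ∃ K : Set M, IsCompact K ∧ ∀ x ∉ K, ∀ i, δ i x = 0) :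
    ∃ s : ℝ → ℝ, IsCurveIn Φ (fun τ => φ + s τ • δ) ∧ s 0 = 0 ∧
      velocity (fun τ => φ + s τ • δ) = δ := by
  obtain ⟨ε, hε, h⟩ := Metric.eventually_nhds_iff.1 (hΦ.perturb φ hφ δ hδ hK)
  set e := ε / 2 with he
  have he0 : 0 < e := by positivity
  -- The line `φ + τ • δ` is only known to stay in `Φ` for `|τ| < ε`, while a curve is defined for
  -- all `τ`. The parameter `e sin(τ / e)` stays within `e = ε / 2` and has derivative `1` at `0`.
  refine ⟨fun τ => e * Real.sin (τ / e), ⟨fun τ => h ?_, fun i => ?_⟩, by simp, ?_⟩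
  · rw [Real.dist_eq, sub_zero, abs_mul, abs_of_pos he0]
    have := Real.abs_sin_le_one (τ / e)
    nlinarith
  · refine isSmoothFamily_add_smul (hΦ.smoothAt hφ i) (isSmoothForm_iff.1 (hδ i)) ?_
    exact contDiff_const.mul (Real.contDiff_sin.comp (contDiff_id.div_const e))
  · funext i x
    have h1 : HasDerivAt (fun τ : ℝ => e * Real.sin (τ / e)) 1 0 := by
      have h2 := (((hasDerivAt_id (0 : ℝ)).div_const e).sin).const_mul e
      refine h2.congr_deriv ?_
      simp [he0.ne']
    have h3 := (h1.smul_const (δ i x)).const_add (φ i x)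
    rw [one_smul] at h3
    exact h3.deriv

/-- The field on `M` whose components in the preferred chart at `x₀` are `g • a`. -/
noncomputable def bumpField (x₀ : M) (g : Model m → ℝ) (a : (i : ι) → Alt m (r i)) :
    Field m M r := fun i y =>
  open Classical in if y ∈ (ch m x₀).source then g (ch m x₀ y) • chartConst x₀ a i y else 0

omit [Fintype ι] [IsManifold 𝓘(ℝ, Model m) ∞ M] in
lemma bumpField_eq_zero {x₀ : M} {g : Model m → ℝ} {a : (i : ι) → Alt m (r i)} {y : M}
    (hy : y ∉ (ch m x₀).symm '' tsupport g) (i : ι) : bumpField x₀ g a i y = 0 := by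
  rw [bumpField]
  split_ifs with h
  · have : ch m x₀ y ∉ tsupport g := fun h' => hy ⟨_, h', (ch m x₀).left_inv h⟩
    rw [image_eq_zero_of_notMem_tsupport this, zero_smul]
  · rfl

omit [Fintype ι] in
lemma inChart_bumpField {x₀ : M} {g : Model m → ℝ} {a : (i : ι) → Alt m (r i)} {z : Model m}
    (hz : z ∈ (ch m x₀).target) (i : ι) : inChart x₀ (bumpField x₀ g a i) z = g z • a i := by
  have h1 := tmap_ch_comp_symm (m := m) (x₀ := x₀) hz
  simp only [inChart, pullback, bumpField]
  rw [if_pos ((ch m x₀).map_target hz), (ch m x₀).right_inv hz]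
  change g z • (a i).compContinuousLinearMap
    ((tmap m (ch m x₀) ((ch m x₀).symm z)).comp (tmap m (ch m x₀).symm z)) = g z • a i
  rw [h1]
  rfl

omit [IsManifold 𝓘(ℝ, Model m) ∞ M] in
lemma isCompact_symm_image {x₀ : M} {g : Model m → ℝ} (hg : HasCompactSupport g)
    (hgt : tsupport g ⊆ (ch m x₀).target) : IsCompact ((ch m x₀).symm '' tsupport g) :=
  IsCompact.image_of_continuousOn hg ((continuousOn_extChartAt_symm x₀).mono hgt)

omit [Fintype ι] in
-- The Hausdorff property makes the compact support closed in `M`, so that extension by zero is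
-- smooth at the points outside it.
lemma isSmoothForm_bumpField [T2Space M] {x₀ : M} {g : Model m → ℝ} (hg : ContDiff ℝ ∞ g)
    (hgc : HasCompactSupport g) (hgt : tsupport g ⊆ (ch m x₀).target)
    (a : (i : ι) → Alt m (r i)) (i : ι) : IsSmoothForm (bumpField x₀ g a i) := by
  rw [isSmoothForm_iff]
  intro y
  by_cases hy : y ∈ (ch m x₀).symm '' tsupport g
  · obtain ⟨z, hz, rfl⟩ := hy
    have hz' := hgt hz
    rw [smoothAt_iff_chart (by simp) ((ch m x₀).map_target hz'), (ch m x₀).right_inv hz']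
    have h1 : ContDiffAt ℝ ∞ (fun z => g z • a i) z := hg.contDiffAt.smul contDiffAt_const
    refine h1.congr_of_eventuallyEq ?_
    filter_upwards [ch_target_mem hz'] with w hw
    exact inChart_bumpField hw i
  · have h1 : bumpField x₀ g a i =ᶠ[𝓝 y] fun _ => 0 := by
      filter_upwards [(isCompact_symm_image hgc hgt).isClosed.isOpen_compl.mem_nhds hy] with w hw
      exact bumpField_eq_zero hw i
    have hyy : (ch m y).symm (ch m y y) = y := (ch m y).left_inv (mem_extChartAt_source y)
    have h2 : inChart y (bumpField x₀ g a i) =ᶠ[𝓝 (ch m y y)] inChart y (fun _ => 0) :=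
      pullback_eventuallyEq (contMDiffAt_ch_symm (mem_extChartAt_target y)).continuousAt
        (by rwa [hyy])
    have h3 : inChart y (fun _ : M => (0 : Alt m (r i))) = fun _ => 0 := rfl
    rw [h3] at h2
    exact contDiffAt_const.congr_of_eventuallyEq h2

omit [Fintype ι] in
/-- Every value at a point is the value of a compactly supported variation. -/
lemma exists_bump [T2Space M] (x : M) (a : (i : ι) → Alt m (r i)) :
    ∃ δ : Field m M r, (∀ i, IsSmoothForm (δ i)) ∧
      (∃ K : Set M, IsCompact K ∧ ∀ x ∉ K, ∀ i, δ i x = 0) ∧ ∀ i, δ i x = a i := by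
  obtain ⟨g, hgt, hgc, hg, -, hg1⟩ := exists_contDiff_tsupport_subset (n := ⊤)
    (extChartAt_target_mem_nhds (I := 𝓘(ℝ, Model m)) x)
  refine ⟨bumpField x g a, isSmoothForm_bumpField hg hgc hgt a,
    ⟨_, isCompact_symm_image hgc hgt, fun y hy => bumpField_eq_zero hy⟩, fun i => ?_⟩
  have h := inChart_bumpField (g := g) (a := a) (mem_extChartAt_target (I := 𝓘(ℝ, Model m)) x) i
  rw [hg1, one_smul] at h
  rw [← inChart_self x (bumpField x g a i)]
  exact h

/-- Solutions are the fields whose Euler-Lagrange expression vanishes at every point. -/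
lemma IsFieldSpace.mem_solutions_iff [T2Space M] (hΦ : IsFieldSpace Λ Φ) {φ : Field m M r}
    (hφ : φ ∈ Φ) : φ ∈ solutions Λ Φ ↔ ∀ x a, eulerLagrange Λ φ x a = 0 := by
  constructor
  · rintro ⟨-, h⟩ x a
    obtain ⟨δ, hδ, hK, ha⟩ := exists_bump x a
    obtain ⟨s, hc, hs, hv⟩ := hΦ.exists_curve hφ hδ hK
    have h1 := congrFun (h _ hc (by simp [hs])) x
    rw [hv, fieldEq, show (fun i => δ i x) = a from funext ha] at h1
    exact h1
  · intro h
    exact ⟨hφ, fun c _ _ => funext fun x => h x _⟩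

variable {N : Type*} [TopologicalSpace N] [ChartedSpace (Model m) N]
  [IsManifold 𝓘(ℝ, Model m) ∞ N]

lemma eulerLagrange_eq_zero_iff (hΦ : IsFieldSpace Λ Φ) {φ : Field m M r} (hφ : φ ∈ Φ)
    (f : Diffeo m N M) :
    (∀ x a, eulerLagrange Λ (pullField f φ) x a = 0) ↔ ∀ x a, eulerLagrange Λ φ x a = 0 := by
  have key : ∀ x a, eulerLagrange Λ (pullField f φ) x
      (fun i => (a i).compContinuousLinearMap (tmap m f x)) =
        (eulerLagrange Λ φ (f x) a).compContinuousLinearMap (tmap m f x) := fun x a =>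
    eulerLagrange_pullField (hΦ.admAt hφ _) (lDiff_diffeo f x) a
  have hinv : ∀ {k : ℕ} (x : N) (b : Alt m k), (b.compContinuousLinearMap
      (tmap m f.symm (f x))).compContinuousLinearMap (tmap m f x) = b := fun x b => by
    have := tmap_comp_tmap_symm f.symm x
    change b.compContinuousLinearMap ((tmap m f.symm (f x)).comp (tmap m f x)) = b
    rw [show (tmap m f.symm (f x)).comp (tmap m f x) = .id ℝ _ from this]
    rfl
  have hinv' : ∀ {k : ℕ} (x : N) (b : Alt m k), (b.compContinuousLinearMap
      (tmap m f x)).compContinuousLinearMap (tmap m f.symm (f x)) = b := fun x b => by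
    have := tmap_comp_tmap_symm f (f x)
    rw [f.symm_apply_apply] at this
    change b.compContinuousLinearMap ((tmap m f x).comp (tmap m f.symm (f x))) = b
    rw [this]
    rfl
  constructor
  · intro h y a
    obtain ⟨x, rfl⟩ : ∃ x, f x = y := f.surjective y
    rw [← hinv' x (eulerLagrange Λ φ (f x) a), ← key, h]
    rfl
  · intro h x a
    have h1 := key x fun i => (a i).compContinuousLinearMap (tmap m f.symm (f x))
    simp only [hinv, h] at h1
    rw [h1]
    rfl

omit [Fintype ι] [IsManifold 𝓘(ℝ, Model m) ∞ M] [IsManifold 𝓘(ℝ, Model m) ∞ N] in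
lemma pullField_pullField {P : Type*} [TopologicalSpace P] [ChartedSpace (Model m) P]
    (f : Diffeo m N M) (g : Diffeo m P N) (φ : Field m M r) :
    pullField g (pullField f φ) = pullField (g.trans f) φ := by
  funext i x
  exact (pullback_comp (m := m) (g := f) (f := g) (φ i)
    ((f.contMDiff _).mdifferentiableAt (by simp))
    ((g.contMDiff _).mdifferentiableAt (by simp))).symm

omit [Fintype ι] [IsManifold 𝓘(ℝ, Model m) ∞ M] in
lemma pullField_refl (φ : Field m M r) :
    pullField (Diffeomorph.refl 𝓘(ℝ, Model m) M ∞) φ = φ :=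
  funext fun i => pullback_id (φ i)

omit [Fintype ι] [IsManifold 𝓘(ℝ, Model m) ∞ M] [IsManifold 𝓘(ℝ, Model m) ∞ N] in
lemma pullField_symm_pullField (f : Diffeo m N M) (φ : Field m M r) :
    pullField f.symm (pullField f φ) = φ := by
  rw [pullField_pullField, Diffeomorph.symm_trans_self, pullField_refl]

omit [Fintype ι] [IsManifold 𝓘(ℝ, Model m) ∞ M] [IsManifold 𝓘(ℝ, Model m) ∞ N] in
lemma pullField_pullField_symm (f : Diffeo m N M) (φ : Field m N r) :
    pullField f (pullField f.symm φ) = φ := by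
  rw [pullField_pullField, Diffeomorph.self_trans_symm, pullField_refl]

/-- The transported field space is a field space. -/
lemma IsFieldSpace.transport (hΦ : IsFieldSpace Λ Φ) : IsFieldSpace Λ (transport N Φ) where
  smooth := by
    rintro _ ⟨v, φ, hφ, rfl⟩ i
    rw [isSmoothForm_iff]
    exact fun y => SmoothAt.pullback (by simp) (hΦ.smoothAt hφ i _) (v.contMDiff _)
  jet_mem := by
    rintro _ ⟨v, φ, hφ, rfl⟩ x
    exact ((hΦ.admAt hφ (v x)).pullField (lDiff_diffeo v x)).mem_dom
  stable := by
    rintro ψ _ ⟨v, φ, hφ, rfl⟩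
    exact ⟨ψ.trans v, φ, hφ, pullField_pullField v ψ φ⟩
  perturb := by
    rintro _ ⟨v, φ, hφ, rfl⟩ δ hδ ⟨K, hK, hδK⟩
    have h1 := hΦ.perturb φ hφ (pullField v.symm δ) (fun i => isSmoothForm_iff.2 fun y =>
      SmoothAt.pullback (by simp) (isSmoothForm_iff.1 (hδ i) _) (v.symm.contMDiff _))
      ⟨v '' K, hK.image v.continuous, fun y hy i => by
        have : v.symm y ∉ K := fun h => hy ⟨_, h, v.apply_symm_apply y⟩
        simp only [pullField, pullback, hδK _ this]
        rfl⟩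
    filter_upwards [h1] with τ hτ
    refine ⟨v, _, hτ, ?_⟩
    have h2 : pullField v (φ + τ • pullField v.symm δ) =
        pullField v φ + τ • pullField v (pullField v.symm δ) := rfl
    rw [h2, pullField_pullField_symm]

lemma IsFieldSpace.mem_solutions_transport_iff [T2Space M] [T2Space N] (hΦ : IsFieldSpace Λ Φ)
    {φ : Field m M r} (hφ : φ ∈ Φ) (f : Diffeo m N M) :
    pullField f φ ∈ solutions Λ (FieldDiff.transport N Φ) ↔ φ ∈ solutions Λ Φ := by
  rw [hΦ.transport.mem_solutions_iff ⟨f, φ, hφ, rfl⟩, hΦ.mem_solutions_iff hφ,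
    eulerLagrange_eq_zero_iff hΦ hφ]

lemma IsFieldSpace.mem_solutions_pullField_iff [T2Space M] (hΦ : IsFieldSpace Λ Φ)
    {φ : Field m M r} (hφ : φ ∈ Φ) (f : Diffeo m M M) :
    pullField f φ ∈ solutions Λ Φ ↔ φ ∈ solutions Λ Φ := by
  rw [hΦ.mem_solutions_iff (hΦ.stable f φ hφ), hΦ.mem_solutions_iff hφ,
    eulerLagrange_eq_zero_iff hΦ hφ]

/-- At a solution `E` annihilates every value at every point, so the pulled-back equations hold on
any `δ` and in particular on velocities of transformed curves. -/
lemma IsFieldSpace.fieldEq_eq_zero [T2Space M] (hΦ : IsFieldSpace Λ Φ) {φ : Field m M r}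
    (hφ : φ ∈ solutions Λ Φ) (f : Diffeo m N M) (δ : Field m N r) :
    fieldEq Λ (pullField f φ) δ = 0 :=
  funext fun x => (eulerLagrange_eq_zero_iff hΦ hφ.1 f).2
    ((hΦ.mem_solutions_iff hφ.1).1 hφ) x _

end FieldSpace

end FieldDiff

namespace FieldDiff

/-! ### Variation of families transported by field-dependent diffeomorphisms -/

section Variation

variable {m : ℕ} {M : Type*} [TopologicalSpace M] [ChartedSpace (Model m) M]
  [IsManifold 𝓘(ℝ, Model m) ∞ M]
  {N : Type*} [TopologicalSpace N] [ChartedSpace (Model m) N]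
  [IsManifold 𝓘(ℝ, Model m) ∞ N]
  {g : ℝ → Diffeo m N M} {L : ℝ → MForm m M (m + 1)}

omit [IsManifold 𝓘(ℝ, Model m) ∞ N] in
lemma lieM_generator_top (hg : IsDiffFamily g) (hL : IsSmoothFamily L) :
    lieM (generator g) (L 0) = lieD (generator g) (L 0) :=
  funext fun y => (lieD_top_eq_lieM (((isSmoothFamily_iff.1 hL 0 y).smoothAt).of_le (by simp))
    (ContDiffAt.of_le (vecSmoothAt_generator hg y) (by simp))).symm

omit [IsManifold 𝓘(ℝ, Model m) ∞ N] in
lemma smoothAt_interior_generator (hg : IsDiffFamily g) (hL : IsSmoothFamily L) (y : M) :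
    SmoothAt ∞ (interior (generator g) (L 0)) y :=
  ((isSmoothFamily_iff.1 hL 0 y).smoothAt).interior (vecSmoothAt_generator hg y)

omit [IsManifold 𝓘(ℝ, Model m) ∞ N] in
lemma smoothAt_lieD_generator (hg : IsDiffFamily g) (hL : IsSmoothFamily L) (y : M) :
    SmoothAt ∞ (lieD (generator g) (L 0)) y := by
  rw [lieD_top]
  exact SmoothAt.extD (n := ∞) ((smoothAt_interior_generator hg hL y).of_le (by simp))

omit [IsManifold 𝓘(ℝ, Model m) ∞ N] in
lemma pair_lieD_generator (hg : IsDiffFamily g) (hL : IsSmoothFamily L) (U : Chain m M (m + 1)) :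
    pair (lieD (generator g) (L 0)) U = pair (interior (generator g) (L 0)) (boundary U) := by
  rw [lieD_top, pair_extD (smoothAt_interior_generator hg hL)]

omit [IsManifold 𝓘(ℝ, Model m) ∞ N] in
lemma pair_vel_add_lieD (hg : IsDiffFamily g) (hL : IsSmoothFamily L) (U : Chain m M (m + 1)) :
    pair (vel L + lieD (generator g) (L 0)) U =
      pair (vel L) U + pair (lieD (generator g) (L 0)) U :=
  pair_add U (smoothAt_vel hL) (smoothAt_lieD_generator hg hL)

/-- The variation of the integral of a family of top forms, transported by a family of
diffeomorphisms, over a fixed domain. -/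
lemma hasDerivAt_pair_pullback (hg : IsDiffFamily g) (hL : IsSmoothFamily L)
    (U : Chain m M (m + 1)) :
    HasDerivAt (fun τ => pair (pullback (g τ) (L τ)) (preim (g 0) U))
      (pair (vel L + lieD (generator g) (L 0)) U) 0 := by
  have h := hasDerivAt_pair (isSmoothFamily_pullback hg hL) (preim (g 0) U)
  rwa [vel_pullback hg hL, pair_preim, lieM_generator_top hg hL] at h

end Variation

/-! ### Transformation of the field equations, the Lagrangian and the action -/

section Covariance

variable {m : ℕ} {ι : Type*} [Fintype ι] {r : ι → ℕ} {Λ : NaturalLagrangian m r}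
  {M : Type*} [TopologicalSpace M] [ChartedSpace (Model m) M]
  [IsManifold 𝓘(ℝ, Model m) ∞ M]
  {N : Type*} [TopologicalSpace N] [ChartedSpace (Model m) N]
  [IsManifold 𝓘(ℝ, Model m) ∞ N]
  {Φ : Set (Field m M r)} {g : ℝ → Diffeo m N M} {c : ℝ → Field m M r}

lemma IsFieldSpace.lagr_pullField (hΦ : IsFieldSpace Λ Φ) {φ : Field m M r} (hφ : φ ∈ Φ)
    (f : Diffeo m N M) : lagr Λ (pullField f φ) = pullback f (lagr Λ φ) :=
  funext fun x => FieldDiff.lagr_pullField (hΦ.admAt hφ _) (lDiff_diffeo f x)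

lemma IsFieldSpace.isSmoothFamily_lagr (hΦ : IsFieldSpace Λ Φ) (hc : IsCurveIn Φ c) :
    IsSmoothFamily fun τ => lagr Λ (c τ) :=
  FieldDiff.isSmoothFamily_lagr hc.2 fun τ => hΦ.jet_mem _ (hc.1 τ)

lemma IsFieldSpace.vel_lagr (hΦ : IsFieldSpace Λ Φ) (hc : IsCurveIn Φ c) :
    vel (fun τ => lagr Λ (c τ)) = varLagr Λ (c 0) (velocity c) :=
  FieldDiff.vel_lagr hc.2 (hΦ.jet_mem _ (hc.1 0))

lemma IsFieldSpace.hasDerivAt_lagr (hΦ : IsFieldSpace Λ Φ) (hc : IsCurveIn Φ c) (x : M) :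
    HasDerivAt (fun τ => lagr Λ (c τ) x) (varLagr Λ (c 0) (velocity c) x) 0 :=
  FieldDiff.hasDerivAt_lagr hc.2 (hΦ.jet_mem _ (hc.1 0)) x

lemma IsFieldSpace.hasDerivAt_action (hΦ : IsFieldSpace Λ Φ) (hc : IsCurveIn Φ c)
    (U : Chain m M (m + 1)) :
    HasDerivAt (fun τ => pair (lagr Λ (c τ)) U) (pair (varLagr Λ (c 0) (velocity c)) U) 0 := by
  have h := hasDerivAt_pair (hΦ.isSmoothFamily_lagr hc) U
  rwa [hΦ.vel_lagr hc] at h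

lemma IsFieldSpace.varLagr_eq (hΦ : IsFieldSpace Λ Φ) (hc : IsCurveIn Φ c) :
    varLagr Λ (c 0) (velocity c) =
      fieldEq Λ (c 0) (velocity c) + extD (theta Λ (c 0) (velocity c)) := by
  funext x
  have h := fieldEq_eq (hΦ.admAt (hc.1 0) x) (δ := velocity c)
    fun i => (smoothAt_vel (hc.2 i) x).of_le (by simp)
  rw [Pi.add_apply, h, sub_add_cancel]

omit [Fintype ι] in
lemma isCurveIn_transport (hc : IsCurveIn Φ c) (hg : IsDiffFamily g) :
    IsCurveIn (transport N Φ) fun τ => pullField (g τ) (c τ) :=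
  ⟨fun τ => ⟨g τ, c τ, hc.1 τ, rfl⟩, fun i => isSmoothFamily_pullback hg (hc.2 i)⟩

omit [Fintype ι] [IsManifold 𝓘(ℝ, Model m) ∞ N] in
lemma velocity_pullField (hc : IsCurveIn Φ c) (hg : IsDiffFamily g) :
    velocity (fun τ => pullField (g τ) (c τ)) =
      pullField (g 0) (fun i => velocity c i + lieM (generator g) (c 0 i)) :=
  funext fun i => vel_pullback hg (hc.2 i)

/-- `E^g = g^*(E + dE(ι_X φ; φ))`. -/
lemma IsFieldSpace.fieldEq_pullField_family (hΦ : IsFieldSpace Λ Φ) (hc : IsCurveIn Φ c)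
    (hg : IsDiffFamily g) :
    fieldEq Λ (pullField (g 0) (c 0)) (velocity fun τ => pullField (g τ) (c τ)) =
      pullback (g 0) (fieldEq Λ (c 0) (velocity c) +
        extD (fieldEqContract Λ (c 0) (generator g))) := by
  have h1 : fieldEq Λ (c 0) (fun i => velocity c i + lieM (generator g) (c 0 i)) =
      fieldEq Λ (c 0) (velocity c) + extD (fieldEqContract Λ (c 0) (generator g)) := by
    funext y
    have hadm := hΦ.admAt (hc.1 0) y
    -- Noether identity: `dE(ι_X φ; φ)` becomes `E(𝔏_X φ; φ)`, and linearity of `E` in the variation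
    -- adds it to `E(δφ; φ)`.
    rw [Pi.add_apply, extD_fieldEqContract hadm
      (ContDiffAt.of_le (vecSmoothAt_generator hg y) (by simp)), fieldEq, fieldEq,
      eulerLagrange_eq hadm, ← map_add]
    rfl
  rw [velocity_pullField hc hg, ← h1]
  exact funext fun x => fieldEq_pullField _ (hΦ.admAt (hc.1 0) _) (lDiff_diffeo (g 0) x)

/-- `(dL)^g = g^*(dL + 𝔏_X L)`. -/
lemma IsFieldSpace.varLagr_pullField_family (hΦ : IsFieldSpace Λ Φ) (hc : IsCurveIn Φ c)
    (hg : IsDiffFamily g) :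
    varLagr Λ (pullField (g 0) (c 0)) (velocity fun τ => pullField (g τ) (c τ)) =
      pullback (g 0) (varLagr Λ (c 0) (velocity c) + lieD (generator g) (lagr Λ (c 0))) := by
  -- The variation of `L` along the transformed curve is its `τ`-derivative; by covariance the curve
  -- of Lagrangians is `g_τ^* L(c τ)`, to which the pullback formula applies.
  have h1 := hΦ.transport.vel_lagr (isCurveIn_transport hc hg)
  have hL := hΦ.isSmoothFamily_lagr hc
  simp only [hΦ.lagr_pullField (hc.1 _)] at h1
  rw [← h1, vel_pullback hg hL, hΦ.vel_lagr hc, lieM_generator_top hg hL]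

lemma IsFieldSpace.hasDerivAt_action_family (hΦ : IsFieldSpace Λ Φ) (hc : IsCurveIn Φ c)
    (hg : IsDiffFamily g) (U : Chain m M (m + 1)) :
    HasDerivAt (fun τ => pair (lagr Λ (pullField (g τ) (c τ))) (preim (g 0) U))
      (pair (varLagr Λ (c 0) (velocity c) + lieD (generator g) (lagr Λ (c 0))) U) 0 := by
  have h1 := hasDerivAt_pair_pullback hg (hΦ.isSmoothFamily_lagr hc) U
  rw [hΦ.vel_lagr hc] at h1
  simpa only [hΦ.lagr_pullField (hc.1 _)] using h1

omit [IsManifold 𝓘(ℝ, Model m) ∞ N] in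
lemma IsFieldSpace.pair_varLagr_add_lieD (hΦ : IsFieldSpace Λ Φ) (hc : IsCurveIn Φ c)
    (hg : IsDiffFamily g) (U : Chain m M (m + 1)) :
    pair (varLagr Λ (c 0) (velocity c) + lieD (generator g) (lagr Λ (c 0))) U =
      dAction Λ c U + pair (lieD (generator g) (lagr Λ (c 0))) U := by
  rw [dAction, (hΦ.hasDerivAt_action hc U).deriv, ← hΦ.vel_lagr hc]
  exact pair_vel_add_lieD hg (hΦ.isSmoothFamily_lagr hc) U

/-- The transformation of the variations of the Lagrangian and of the action under a
field-dependent diffeomorphism, along a curve of fields. -/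
lemma IsFieldSpace.covariance (hΦ : IsFieldSpace Λ Φ) (hc : IsCurveIn Φ c)
    (hg : IsDiffFamily g) (U : Chain m M (m + 1)) :
    let X := generator g
    let cg := fun τ => pullField (g τ) (c τ)
    HasDerivAt (fun τ => pair (lagr Λ (cg τ)) (preim (g 0) U))
      (dAction Λ c U + pair (lieD X (lagr Λ (c 0))) U) 0 ∧
    dAction Λ cg (preim (g 0) U) = dAction Λ c U + pair (lieD X (lagr Λ (c 0))) U ∧
    dAction Λ cg (preim (g 0) U) = dAction Λ c U + pair (extD (interior X (lagr Λ (c 0)))) U ∧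
    dAction Λ cg (preim (g 0) U) =
      dAction Λ c U + pair (interior X (lagr Λ (c 0))) (boundary U) ∧
    pair (fieldEq Λ (cg 0) (velocity cg) + extD (theta Λ (cg 0) (velocity cg))) (preim (g 0) U) =
      pair (varLagr Λ (c 0) (velocity c) + lieD X (lagr Λ (c 0))) U ∧
    pair (varLagr Λ (cg 0) (velocity cg)) (preim (g 0) U) =
      pair (varLagr Λ (c 0) (velocity c) + lieD X (lagr Λ (c 0))) U ∧
    dAction Λ cg (preim (g 0) U) =
      pair (varLagr Λ (c 0) (velocity c) + lieD X (lagr Λ (c 0))) U := by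
  intro X cg
  have h1 := hΦ.hasDerivAt_action_family hc hg U
  have h2 := hΦ.pair_varLagr_add_lieD hc hg U
  have h3 : dAction Λ cg (preim (g 0) U) = _ := h1.deriv
  have h4 : pair (varLagr Λ (cg 0) (velocity cg)) (preim (g 0) U) =
      pair (varLagr Λ (c 0) (velocity c) + lieD X (lagr Λ (c 0))) U := by
    rw [show varLagr Λ (cg 0) (velocity cg) = _ from hΦ.varLagr_pullField_family hc hg, pair_preim]
  refine ⟨by rw [← h2]; exact h1, h3.trans h2, ?_, ?_, ?_, h4, h3⟩
  · rw [h3, h2, lieD_top]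
  · rw [h3, h2, pair_lieD_generator hg (hΦ.isSmoothFamily_lagr hc)]
  · rw [← h4, show varLagr Λ (cg 0) (velocity cg) = _ from
      hΦ.transport.varLagr_eq (isCurveIn_transport hc hg)]

end Covariance

end FieldDiff

namespace FieldDiff

/-! ### The field equations from variations transported by a local dressing -/

section IntegralExtDeriv

variable {m k : ℕ}

/-- Integration by parts against the constant function `1`. -/
lemma integral_fderiv_eq_zero {f : Model m → ℝ} (hf : ContDiff ℝ 1 f) (hc : HasCompactSupport f)
    (v : Model m) : ∫ z, fderiv ℝ f z v = 0 := by
  have h1 : Integrable fun z => fderiv ℝ f z v :=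
    ((hf.continuous_fderiv (by simp)).clm_apply continuous_const).integrable_of_hasCompactSupport
      (hc.fderiv_apply (𝕜 := ℝ) v)
  have h := integral_mul_fderiv_eq_neg_fderiv_mul_of_integrable (μ := volume)
    (f := fun _ : Model m => (1 : ℝ)) (g := f) (v := v) (by simp) (by simpa using h1)
    (by simpa using hf.continuous.integrable_of_hasCompactSupport hc)
    (fun x _ => differentiableAt_const _) (fun x _ => hf.differentiable (by simp) x)
  simpa using h

/-- The integral of the differential of a compactly supported form vanishes. -/
lemma integral_extDeriv_eq_zero {b : MForm m (Model m) k} (hb : ContDiff ℝ 1 b)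
    (hc : HasCompactSupport b) (v : Fin (k + 1) → Model m) : ∫ z, extDeriv b z v = 0 := by
  have hs : ∀ w : Fin k → Model m, ContDiff ℝ 1 fun z => b z w := fun w =>
    (ContinuousLinearMap.contDiff (𝕜 := ℝ)
      (ContinuousAlternatingMap.apply ℝ (Model m) ℝ w)).comp hb
  have hsc : ∀ w : Fin k → Model m, HasCompactSupport fun z => b z w := fun w =>
    hc.comp_left (g := fun a : Alt m k => a w) rfl
  have h1 : ∀ z, extDeriv b z v = ∑ i : Fin (k + 1), (-1 : ℝ) ^ (i : ℕ) *
      fderiv ℝ (fun z => b z (i.removeNth v)) z (v i) := fun z => by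
    rw [extDeriv_apply (hb.differentiable (by simp) z) v]
    simp [zsmul_eq_mul]
  simp only [h1]
  rw [integral_finsetSum]
  · refine Finset.sum_eq_zero fun i _ => ?_
    rw [integral_const_mul, integral_fderiv_eq_zero (hs _) (hsc _), mul_zero]
  · intro i _
    refine Integrable.const_mul ?_ _
    exact (((hs (i.removeNth v)).continuous_fderiv (by simp)).clm_apply
      continuous_const).integrable_of_hasCompactSupport ((hsc _).fderiv_apply (𝕜 := ℝ) (v i))

end IntegralExtDeriv

/-! ### The fundamental lemma of the calculus of variations for local dressings -/

section Local

variable {m : ℕ} {ι : Type*} [Fintype ι] {r : ι → ℕ} {Λ : NaturalLagrangian m r}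

lemma contDiffAt_fieldEqContract_model {φ : Field m (Model m) r} {X : Model m → Model m}
    {p : Model m} (hφ : AdmAt Λ φ p) (hX : ContDiffAt ℝ 1 X p) :
    ContDiffAt ℝ 1 (fieldEqContract Λ φ X) p := by
  have e1 : fieldEqContract Λ φ X =ᶠ[𝓝 p] fun z => interior X (lagr Λ φ) z -
      theta Λ φ (contractD X φ) z -
      lowerContract (⇑(divL (dMomentum Λ φ z))) (X z) (fun i => φ i z) := by
    filter_upwards [hφ.eventually] with z hz
    exact fieldEqContract_model hz
  refine ContDiffAt.congr_of_eventuallyEq ?_ e1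
  exact ((contDiffAt_interior (hφ.contDiffAt_lagr.of_le (by simp)) hX).sub
    (contDiffAt_theta Λ (by simp) hφ.contDiffAt hφ.mem_dom
      (hφ.contDiffAt_contractD (by simp) hX))).sub (hφ.contDiffAt_lowerContract (by simp) hX)

lemma AdmAt.contDiffAt_eulerModel {φ : Field m (Model m) r} {p : Model m} (hφ : AdmAt Λ φ p) :
    ContDiffAt ℝ ∞ (eulerModel Λ φ) p := by
  refine ContDiffAt.sub ?_ (hφ.contDiffAt_divL le_rfl)
  exact (Λ.contDiffAt_d₀ hφ.mem_dom).comp p hφ.contDiffAt_jet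

variable {M : Type*} [TopologicalSpace M] [ChartedSpace (Model m) M]
  [IsManifold 𝓘(ℝ, Model m) ∞ M]

lemma smoothAt_fieldEqContract {φ : Field m M r} {X : M → Model m} {x : M} (hφ : AdmAt Λ φ x)
    (hX : VecSmoothAt 1 X x) : SmoothAt 1 (fieldEqContract Λ φ X) x := by
  have hx : (ch m x).symm (ch m x x) = x := (ch m x).left_inv (mem_extChartAt_source x)
  have hc : ContinuousAt (ch m x).symm (ch m x x) :=
    (contMDiffAt_ch_symm (mem_extChartAt_target x)).continuousAt
  have h2 : ∀ᶠ z in 𝓝 (ch m x x), AdmAt Λ φ ((ch m x).symm z) :=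
    hc.eventually (by rw [hx]; exact hφ.eventually)
  refine (contDiffAt_fieldEqContract_model hφ.chartField hX).congr_of_eventuallyEq ?_
  filter_upwards [h2, ch_target_mem (mem_extChartAt_target x)] with z hz hz'
  exact (fieldEqContract_pullField hz (lDiff_ch_symm hz') (tmap_ch_symm_vecChart hz' X)).symm

lemma fieldEqContract_of_eq_zero {φ : Field m M r} {X : M → Model m} {x : M} (hφ : AdmAt Λ φ x)
    (hX : X x = 0) : fieldEqContract Λ φ X x = 0 := by
  rw [fieldEqContract, eulerLagrange_eq hφ, lowerContract_eq_sum, hX]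
  refine Finset.sum_eq_zero fun j _ => ?_
  have : (fun i => wedgeContractL (k := r i) (covec m j) 0 (φ i x)) = 0 := by
    funext i
    rw [map_zero]
    rfl
  rw [this, map_zero, map_zero]

/-- If `E(δ) + dβ = 0` with `β` supported in the support of `δ`, then the Euler-Lagrange
expression integrates to zero against the bump function. -/
lemma integral_bump_eulerModel {φ : Field m M r} (hφ : ∀ x, AdmAt Λ φ x) {x₀ : M}
    {g : Model m → ℝ} (hgc : HasCompactSupport g) (hgt : tsupport g ⊆ (ch m x₀).target)
    {a : (i : ι) → Alt m (r i)} {β : MForm m M m} (hβ : ∀ x, SmoothAt 1 β x)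
    (hβ0 : ∀ x ∉ (ch m x₀).symm '' tsupport g, β x = 0)
    (h : fieldEq Λ φ (bumpField x₀ g a) + extD β = 0) (v : Fin (m + 1) → Model m) :
    ∫ z, g z • eulerModel Λ (chartField x₀ φ) z a v = 0 := by
  classical
  -- The chart expression of `β` extended by zero. It is `C^1` on the whole model space because it
  -- vanishes off the support of `g`, which lies inside the chart.
  set b : MForm m (Model m) m := fun z => if z ∈ (ch m x₀).target then inChart x₀ β z else 0
    with hb
  have hb1 : ∀ z ∈ (ch m x₀).target, b =ᶠ[𝓝 z] inChart x₀ β := fun z hz => by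
    filter_upwards [ch_target_mem hz] with w hw
    simp only [hb, if_pos hw]
  have hb0 : ∀ z, z ∉ tsupport g → b z = 0 := fun z hz => by
    simp only [hb]
    split_ifs with hzt
    · have : (ch m x₀).symm z ∉ (ch m x₀).symm '' tsupport g := by
        rintro ⟨w, hw, hwz⟩
        have := (ch m x₀).symm.injOn (hgt hw) hzt hwz
        exact hz (this ▸ hw)
      simp only [inChart, pullback, hβ0 _ this]
      rfl
    · rfl
  have hb2 : ∀ z, z ∉ tsupport g → b =ᶠ[𝓝 z] fun _ => 0 := fun z hz => by
    filter_upwards [(isClosed_tsupport g).isOpen_compl.mem_nhds hz] with w hw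
    exact hb0 w hw
  have hbs : ContDiff ℝ 1 b := by
    rw [contDiff_iff_contDiffAt]
    intro z
    by_cases hz : z ∈ tsupport g
    · have hzt := hgt hz
      refine ContDiffAt.congr_of_eventuallyEq ?_ (hb1 z hzt)
      have := (smoothAt_iff_chart one_add_one_le ((ch m x₀).map_target hzt)).1 (hβ _)
      rwa [(ch m x₀).right_inv hzt] at this
    · exact contDiffAt_const.congr_of_eventuallyEq (hb2 z hz)
  have hbc : HasCompactSupport b := HasCompactSupport.intro hgc hb0
  have key : ∀ z, g z • eulerModel Λ (chartField x₀ φ) z a = - extDeriv b z := fun z => by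
    by_cases hz : z ∈ tsupport g
    · have hzt := hgt hz
      have h1 : inChart x₀ (fieldEq Λ φ (bumpField x₀ g a)) z + inChart x₀ (extD β) z = 0 := by
        change inChart x₀ (fieldEq Λ φ (bumpField x₀ g a) + extD β) z = 0
        rw [h]
        rfl
      have h2 : inChart x₀ (fieldEq Λ φ (bumpField x₀ g a)) z =
          fieldEq Λ (chartField x₀ φ) (chartField x₀ (bumpField x₀ g a)) z :=
        (fieldEq_pullField _ (hφ _) (lDiff_ch_symm hzt)).symm
      have h3 : (fun i => chartField x₀ (bumpField x₀ g a) i z) = g z • a :=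
        funext fun i => inChart_bumpField hzt i
      rw [h2, inChart_extD hzt (hβ _), fieldEq, h3,
        eulerLagrange_model (φ := chartField x₀ φ)
          ((hφ _).pullField (lDiff_ch_symm hzt)), map_smul,
        ← (hb1 z hzt).extDeriv_eq] at h1
      exact eq_neg_of_add_eq_zero_left h1
    · rw [(hb2 z hz).extDeriv_eq, image_eq_zero_of_notMem_tsupport hz, zero_smul]
      have : extDeriv (fun _ : Model m => (0 : Alt m m)) z = 0 := by
        rw [extDeriv_eq_altL]
        simp
      rw [this, neg_zero]
  have h4 : ∀ z, g z • eulerModel Λ (chartField x₀ φ) z a v = - extDeriv b z v := fun z => by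
    have := congrArg (fun w : Alt m (m + 1) => w v) (key z)
    simpa using this
  simp only [h4, integral_neg, integral_extDeriv_eq_zero hbs hbc, neg_zero]

omit [IsManifold 𝓘(ℝ, Model m) ∞ M] in
lemma eqOn_zero_of_integral_bump_eq_zero {U : Set (Model m)} (hU : IsOpen U) {f : Model m → ℝ}
    (hf : ContinuousOn f U)
    (h : ∀ g : Model m → ℝ, ContDiff ℝ ∞ g → HasCompactSupport g → tsupport g ⊆ U →
      ∫ z, g z • f z = 0) : ∀ z ∈ U, f z = 0 := by
  have h1 := hU.ae_eq_zero_of_integral_contDiff_smul_eq_zero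
    (hf.locallyIntegrableOn hU.measurableSet) h
  exact Measure.eqOn_open_of_ae_eq ((ae_restrict_iff' hU.measurableSet).2 h1) hU hf
    continuousOn_const

variable {N : Type*} [TopologicalSpace N] [ChartedSpace (Model m) N]
  [IsManifold 𝓘(ℝ, Model m) ∞ N] {Φ : Set (Field m M r)}

omit [Fintype ι] [IsManifold 𝓘(ℝ, Model m) ∞ M] [IsManifold 𝓘(ℝ, Model m) ∞ N] in
/-- A local dressing moves no points outside the support of the variation. -/
lemma generator_local_eq_zero {u : Field m M r → Diffeo m N M} (hu : IsLocalDressing Φ u)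
    {c : ℝ → Field m M r} (hc : IsCurveIn Φ c) {V : Set M} (hV : IsOpen V)
    (hcV : ∀ τ, ∀ x ∈ V, ∀ i, c τ i x = c 0 i x) {y : M} (hy : y ∈ V) :
    generator (fun τ => u (c τ)) y = 0 := by
  have h1 : (fun τ : ℝ => u (c τ) ((u (c 0)).symm y)) = fun _ => y := by
    funext τ
    rw [← hu (c τ) (hc.1 τ) (c 0) (hc.1 0) V hV (hcV τ) y hy, Diffeomorph.apply_symm_apply]
  simp only [generator]
  rw [h1, mfderiv_const]
  rfl

omit [IsManifold 𝓘(ℝ, Model m) ∞ M] [IsManifold 𝓘(ℝ, Model m) ∞ N] in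
lemma eq_zero_of_pullback_eq_zero {k : ℕ} (f : Diffeo m N M) {η : MForm m M k}
    (h : pullback f η = 0) : η = 0 := by
  funext y
  have h1 : pullback f.symm (pullback f η) y = 0 := by rw [h]; rfl
  have h2 : pullback f.symm (pullback f η) y = η y := by
    simp only [pullback, f.apply_symm_apply]
    change (η y).compContinuousLinearMap
      ((tmap m f (f.symm y)).comp (tmap m f.symm y)) = η y
    rw [tmap_comp_tmap_symm]
    rfl
  rw [← h2, h1]
  rfl

/-- For a bump variation, locality confines the generator `X`, hence `E(ι_X φ; φ)`, to the support
of the bump. So `E^u = 0` equates `E(δφ; φ)` with minus the differential of a compactly supported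
form, and `∫ g E(a; φ) = 0` for all bump functions `g`. -/
lemma IsFieldSpace.mem_solutions_of_localDressing [T2Space M] (hΦ : IsFieldSpace Λ Φ)
    {u : Field m M r → Diffeo m N M} (hu : IsSmoothMap Φ u) (hul : IsLocalDressing Φ u)
    {φ : Field m M r} (hφ : φ ∈ Φ)
    (h : ∀ c, IsCurveIn Φ c → c 0 = φ →
      fieldEq Λ (selfPull u φ) (velocity fun τ => selfPull u (c τ)) = 0) :
    φ ∈ solutions Λ Φ := by
  rw [hΦ.mem_solutions_iff hφ]
  intro x a
  rw [eulerLagrange_eq (hΦ.admAt hφ x)]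
  have hadm : ∀ z ∈ (ch m x).target, AdmAt Λ (chartField x φ) z := fun z hz =>
    (hΦ.admAt hφ _).pullField (lDiff_ch_symm hz)
  ext v
  refine eqOn_zero_of_integral_bump_eq_zero (isOpen_extChartAt_target (I := 𝓘(ℝ, Model m)) x)
    (f := fun z => eulerModel Λ (chartField x φ) z a v) (fun z hz => ?_) (fun g hg hgc hgt => ?_)
    _ (mem_extChartAt_target x)
  · have h1 : ContinuousAt (fun z => eulerModel Λ (chartField x φ) z a) z :=
      (hadm z hz).contDiffAt_eulerModel.continuousAt.clm_apply continuousAt_const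
    exact ((ContinuousAlternatingMap.apply ℝ (Model m) ℝ v).continuous.continuousAt.comp
      h1).continuousWithinAt
  · obtain ⟨s, hc, hs, hv⟩ := hΦ.exists_curve hφ (isSmoothForm_bumpField hg hgc hgt a)
      ⟨_, isCompact_symm_image hgc hgt, fun y hy => bumpField_eq_zero hy⟩
    have hc0 : φ + s 0 • bumpField x g a = φ := by rw [hs, zero_smul, add_zero]
    set X := generator (fun τ => u (φ + s τ • bumpField x g a)) with hX
    have hg' : IsDiffFamily fun τ => u (φ + s τ • bumpField x g a) := hu _ hc
    have h1 := hΦ.fieldEq_pullField_family hc hg'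
    have h2 : fieldEq Λ φ (bumpField x g a) + extD (fieldEqContract Λ φ X) = 0 := by
      refine eq_zero_of_pullback_eq_zero (u φ) ?_
      have h3 := h _ hc hc0
      rw [hv, ← hX] at h1
      simp only [hc0] at h1
      rw [← h1]
      exact h3
    refine integral_bump_eulerModel (hΦ.admAt hφ) hgc hgt (fun y => ?_) (fun y hy => ?_) h2 v
    · exact smoothAt_fieldEqContract (hΦ.admAt hφ y)
        (ContDiffAt.of_le (vecSmoothAt_generator hg' y) (by simp))
    · refine fieldEqContract_of_eq_zero (hΦ.admAt hφ y) ?_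
      refine generator_local_eq_zero hul hc (isCompact_symm_image hgc hgt).isClosed.isOpen_compl
        (fun τ y hy i => ?_) hy
      simp [bumpField_eq_zero hy]

end Local

end FieldDiff

namespace FieldDiff

/-! ### Dressing fields -/

section Dressing

variable {m : ℕ} {ι : Type*} [Fintype ι] {r : ι → ℕ} {Λ : NaturalLagrangian m r}
  {M : Type*} [TopologicalSpace M] [ChartedSpace (Model m) M]
  {N : Type*} [TopologicalSpace N] [ChartedSpace (Model m) N]
  {Φ : Set (Field m M r)}

omit [Fintype ι] in
/-- Dressed fields agree exactly along the orbits of the diffeomorphisms. -/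
lemma IsDressing.selfPull_eq_iff {u : Field m M r → Diffeo m N M} (hu : IsDressing Φ u)
    {φ φ' : Field m M r} (hφ : φ ∈ Φ) :
    selfPull u φ = selfPull u φ' ↔ ∃ ψ : Diffeo m M M, φ' = pullField ψ φ := by
  constructor
  · intro h
    -- Undoing the second dressing in `u(φ)^* φ = u(φ')^* φ'` dictates the witness `ψ = u(φ) ∘
    -- u(φ')⁻¹`.
    refine ⟨(u φ').symm.trans (u φ), ?_⟩
    rw [← pullField_pullField]
    change φ' = pullField (u φ').symm (selfPull u φ)
    rw [h, selfPull, pullField_symm_pullField]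
  · rintro ⟨ψ, rfl⟩
    rw [selfPull, selfPull, hu.2 ψ φ hφ, ← pullField_pullField, pullField_symm_pullField]

/-- The fields all of whose transformed variations satisfy the field equations are the
solutions, if the transformation is invertible. -/
lemma IsFieldSpace.mem_solutions_of_generatesVerticalDiffeo [IsManifold 𝓘(ℝ, Model m) ∞ M]
    [T2Space M] (hΦ : IsFieldSpace Λ Φ) {ψ : Field m M r → Diffeo m M M}
    (hψ : GeneratesVerticalDiffeo Φ ψ) {φ : Field m M r} (hφ : φ ∈ Φ)
    (h : ∀ c, IsCurveIn Φ c → c 0 = φ →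
      fieldEq Λ (selfPull ψ φ) (velocity fun τ => selfPull ψ (c τ)) = 0) :
    φ ∈ solutions Λ Φ := by
  obtain ⟨-, Θ, -, hl, hr, hc⟩ := hψ
  rw [← hΦ.mem_solutions_pullField_iff hφ (ψ φ)]
  refine ⟨hΦ.stable _ _ hφ, fun c' hc' h0 => ?_⟩
  -- A curve `c'` through `Ξ(φ)` is the image under `Ξ` of the curve `Θ ∘ c'` through `φ`, so the
  -- hypothesis reaches all variations at `Ξ(φ)`.
  have h1 := h _ (hc c' hc') (by rw [h0]; exact hl φ hφ)
  simp only [hr _ (hc'.1 _)] at h1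
  exact h1

end Dressing

end FieldDiff

/-! ### Assembly of the theorem -/

open FieldDiff in
theorem mainTheorem7 {m : ℕ} {ι : Type*} [Fintype ι] {r : ι → ℕ}
    {M : Type*} [TopologicalSpace M] [ChartedSpace (Model m) M]
    [IsManifold 𝓘(ℝ, Model m) ∞ M] [T2Space M] [SecondCountableTopology M]
    {N : Type*} [TopologicalSpace N] [ChartedSpace (Model m) N]
    [IsManifold 𝓘(ℝ, Model m) ∞ N] [T2Space N] [SecondCountableTopology N]
    (Λ : NaturalLagrangian m r) (Φ : Set (Field m M r)) (hΦ : IsFieldSpace Λ Φ) :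
    -- `Diff(M)`-covariance of the Lagrangian
    (∀ ψ : Diffeo m M M, ∀ φ ∈ Φ, lagr Λ (pullField ψ φ) = pullback ψ (lagr Λ φ)) ∧
    -- `dL = E + dθ` and `dS = ⟨dL, U⟩`
    (∀ c, IsCurveIn Φ c →
      (∀ x, HasDerivAt (fun τ => lagr Λ (c τ) x) (varLagr Λ (c 0) (velocity c) x) 0) ∧
      varLagr Λ (c 0) (velocity c) =
        fieldEq Λ (c 0) (velocity c) + extD (theta Λ (c 0) (velocity c)) ∧
      ∀ U, HasDerivAt (fun τ => pair (lagr Λ (c τ)) U)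
        (pair (varLagr Λ (c 0) (velocity c)) U) 0) ∧
    -- field-dependent diffeomorphisms `ψ ∈ C^∞(Φ, Diff(M))`, `Ξ = selfPull ψ`
    (∀ ψ : Field m M r → Diffeo m M M, IsSmoothMap Φ ψ →
      -- covariance: `L^ψ = ψ^* L` and `S^ψ = S`
      (∀ φ ∈ Φ, selfPull ψ φ ∈ Φ ∧
        lagr Λ (selfPull ψ φ) = pullback (ψ φ) (lagr Λ φ) ∧
        ∀ U, pair (lagr Λ (selfPull ψ φ)) (preim (ψ φ) U) = pair (lagr Λ φ) U) ∧
      (∀ c, IsCurveIn Φ c →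
        let φ := c 0
        let δ := velocity c
        let X := generator (fun τ => ψ (c τ))
        let cψ := fun τ => selfPull ψ (c τ)
        let φψ := cψ 0
        let δψ := velocity cψ
        IsCurveIn Φ cψ ∧
        -- `E^ψ = ψ^*(E + dE(ι_{dψ∘ψ⁻¹} φ; φ))`
        fieldEq Λ φψ δψ =
          pullback (ψ φ) (fieldEq Λ φ δ + extD (fieldEqContract Λ φ X)) ∧
        -- `(dL)^ψ = d(L^ψ) = ψ^*(dL + 𝔏_{dψ∘ψ⁻¹} L)`
        varLagr Λ φψ δψ = pullback (ψ φ) (varLagr Λ φ δ + lieD X (lagr Λ φ)) ∧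
        (∀ x, HasDerivAt (fun τ => pullback (ψ (c τ)) (lagr Λ (c τ)) x)
          (varLagr Λ φψ δψ x) 0) ∧
        ∀ U : Chain m M (m + 1),
          -- `(dS)^ψ = dS + ⟨𝔏 L, U⟩ = dS + ⟨dι L, U⟩ = dS + ⟨ι L, ∂U⟩`
          dAction Λ cψ (preim (ψ φ) U) = dAction Λ c U + pair (lieD X (lagr Λ φ)) U ∧
          dAction Λ cψ (preim (ψ φ) U) =
            dAction Λ c U + pair (extD (interior X (lagr Λ φ))) U ∧
          dAction Λ cψ (preim (ψ φ) U) =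
            dAction Λ c U + pair (interior X (lagr Λ φ)) (boundary U) ∧
          -- `⟨E^ψ + dθ^ψ, ψ⁻¹(U)⟩ = ⟨dL + 𝔏 L, U⟩ = ⟨dL^ψ, ψ⁻¹(U)⟩ = (dS)^ψ`
          pair (fieldEq Λ φψ δψ + extD (theta Λ φψ δψ)) (preim (ψ φ) U) =
            pair (varLagr Λ φ δ + lieD X (lagr Λ φ)) U ∧
          pair (varLagr Λ φψ δψ) (preim (ψ φ) U) =
            pair (varLagr Λ φ δ + lieD X (lagr Λ φ)) U ∧
          dAction Λ cψ (preim (ψ φ) U) =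
            pair (varLagr Λ φ δ + lieD X (lagr Λ φ)) U) ∧
      -- the space of solutions is preserved
      (∀ φ ∈ Φ, φ ∈ solutions Λ Φ ↔ selfPull ψ φ ∈ solutions Λ Φ) ∧
      (∀ φ ∈ solutions Λ Φ, ∀ c, IsCurveIn Φ c → c 0 = φ →
        fieldEq Λ (selfPull ψ φ) (velocity fun τ => selfPull ψ (c τ)) = 0) ∧
      (GeneratesVerticalDiffeo Φ ψ →
        selfPull ψ '' solutions Λ Φ = solutions Λ Φ ∧
        {φ ∈ Φ | ∀ c, IsCurveIn Φ c → c 0 = φ →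
          fieldEq Λ (selfPull ψ φ) (velocity fun τ => selfPull ψ (c τ)) = 0} =
            solutions Λ Φ)) ∧
    -- dressing fields `u : Φ → Diff(N, M)`
    (∀ u : Field m M r → Diffeo m N M, IsDressing Φ u →
      (∀ φ ∈ Φ, selfPull u φ ∈ transport N Φ ∧
        lagr Λ (selfPull u φ) = pullback (u φ) (lagr Λ φ) ∧
        ∀ U, pair (lagr Λ (selfPull u φ)) (preim (u φ) U) = pair (lagr Λ φ) U) ∧
      (∀ c, IsCurveIn Φ c →
        let φ := c 0
        let δ := velocity c
        let X := generator (fun τ => u (c τ))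
        let cu := fun τ => selfPull u (c τ)
        let φu := cu 0
        let δu := velocity cu
        IsCurveIn (transport N Φ) cu ∧
        -- `E^u = u^*(E + dE(ι_{du∘u⁻¹} φ; φ))`
        fieldEq Λ φu δu =
          pullback (u φ) (fieldEq Λ φ δ + extD (fieldEqContract Λ φ X)) ∧
        -- `(dL)^u = d(L^u) = u^*(dL + 𝔏_{du∘u⁻¹} L)`
        varLagr Λ φu δu = pullback (u φ) (varLagr Λ φ δ + lieD X (lagr Λ φ)) ∧
        (∀ x, HasDerivAt (fun τ => lagr Λ (cu τ) x) (varLagr Λ φu δu x) 0) ∧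
        ∀ U : Chain m M (m + 1),
          HasDerivAt (fun τ => pair (lagr Λ (cu τ)) (preim (u φ) U))
            (dAction Λ c U + pair (lieD X (lagr Λ φ)) U) 0 ∧
          dAction Λ cu (preim (u φ) U) = dAction Λ c U + pair (lieD X (lagr Λ φ)) U ∧
          dAction Λ cu (preim (u φ) U) =
            dAction Λ c U + pair (extD (interior X (lagr Λ φ))) U ∧
          dAction Λ cu (preim (u φ) U) =
            dAction Λ c U + pair (interior X (lagr Λ φ)) (boundary U) ∧
          pair (fieldEq Λ φu δu + extD (theta Λ φu δu)) (preim (u φ) U) =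
            pair (varLagr Λ φ δ + lieD X (lagr Λ φ)) U ∧
          pair (varLagr Λ φu δu) (preim (u φ) U) =
            pair (varLagr Λ φ δ + lieD X (lagr Λ φ)) U ∧
          dAction Λ cu (preim (u φ) U) =
            pair (varLagr Λ φ δ + lieD X (lagr Λ φ)) U) ∧
      -- `φ` solves the field equations iff the dressed field `φ^u` solves the same equations on `N`,
      -- and the dressed solutions are the `Diff(M)`-orbits of solutions
      (∀ φ ∈ Φ, φ ∈ solutions Λ Φ ↔ selfPull u φ ∈ solutions Λ (transport N Φ)) ∧
      selfPull u '' solutions Λ Φ = selfPull u '' Φ ∩ solutions Λ (transport N Φ) ∧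
      (∀ φ ∈ Φ, ∀ φ' ∈ Φ, selfPull u φ = selfPull u φ' ↔
        ∃ ψ : Diffeo m M M, φ' = pullField ψ φ) ∧
      -- `E = 0` implies `E^u = 0`, and they are equivalent for locally built dressings
      (∀ φ ∈ solutions Λ Φ, ∀ c, IsCurveIn Φ c → c 0 = φ →
        fieldEq Λ (selfPull u φ) (velocity fun τ => selfPull u (c τ)) = 0) ∧
      (IsLocalDressing Φ u →
        {φ ∈ Φ | ∀ c, IsCurveIn Φ c → c 0 = φ →
          fieldEq Λ (selfPull u φ) (velocity fun τ => selfPull u (c τ)) = 0} =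
            solutions Λ Φ)) ∧
    -- `(dS)^ψ = dS + ⟨ι L, ∂U⟩` for any `Diff(M)`-covariant Lagrangian on any kind of fields
    (∀ (F : DiffSpace m M) (L : F.Point → MForm m M (m + 1)),
      (∀ ψ φ, L (F.act ψ φ) = pullback ψ (L φ)) →
      (∀ c ∈ F.curves, IsSmoothFamily fun τ => L (c τ)) →
      ∀ ψ : F.Point → Diffeo m M M, (∀ c ∈ F.curves, IsDiffFamily fun τ => ψ (c τ)) →
      (∀ φ U, pair (L (F.act (ψ φ) φ)) (preim (ψ φ) U) = pair (L φ) U) ∧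
      ∀ c ∈ F.curves, ∀ U : Chain m M (m + 1),
        let X := generator (fun τ => ψ (c τ))
        ∃ dS : ℝ, HasDerivAt (fun τ => pair (L (c τ)) U) dS 0 ∧
          HasDerivAt (fun τ => pair (L (F.act (ψ (c τ)) (c τ))) (preim (ψ (c 0)) U))
            (dS + pair (interior X (L (c 0))) (boundary U)) 0 ∧
          pair (interior X (L (c 0))) (boundary U) = pair (lieD X (L (c 0))) U ∧
          pair (interior X (L (c 0))) (boundary U) =
            pair (extD (interior X (L (c 0)))) U) := by
  -- For `N = M` the transformed curve stays in `Φ` itself, by stability under `Diff(M)`; for a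
  -- dressing it lies in the transported field space.
  have hcov : ∀ {g : ℝ → Diffeo m M M} {c : ℝ → Field m M r}, IsCurveIn Φ c →
      IsDiffFamily g → IsCurveIn Φ fun τ => pullField (g τ) (c τ) := fun hc hg =>
    ⟨fun τ => hΦ.stable _ _ (hc.1 τ), fun i => isSmoothFamily_pullback hg (hc.2 i)⟩
  refine ⟨fun ψ φ hφ => hΦ.lagr_pullField hφ ψ, fun c hc => ⟨hΦ.hasDerivAt_lagr hc,
    hΦ.varLagr_eq hc, hΦ.hasDerivAt_action hc⟩, fun ψ hψ => ⟨fun φ hφ => ?_, fun c hc => ?_,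
    fun φ hφ => (hΦ.mem_solutions_pullField_iff hφ (ψ φ)).symm,
    fun φ hφ c _ _ => hΦ.fieldEq_eq_zero hφ (ψ φ) _, fun hv => ⟨?_, ?_⟩⟩,
    fun u hu => ⟨fun φ hφ => ?_, fun c hc => ?_,
    fun φ hφ => (hΦ.mem_solutions_transport_iff hφ (u φ)).symm, ?_,
    fun φ hφ φ' _ => hu.selfPull_eq_iff hφ,
    fun φ hφ c _ _ => hΦ.fieldEq_eq_zero hφ (u φ) _, fun hl => ?_⟩,
    fun F L hL hLs ψ hψ => ⟨fun φ U => ?_, fun c hc U => ?_⟩⟩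
  · have h1 := hΦ.lagr_pullField hφ (ψ φ)
    exact ⟨hΦ.stable _ _ hφ, h1, fun U => by rw [selfPull, h1, pair_preim]⟩
  · have hg := hψ c hc
    have hcg := hcov (g := fun τ => ψ (c τ)) hc hg
    have h1 := hΦ.fieldEq_pullField_family (g := fun τ => ψ (c τ)) hc hg
    have h2 := hΦ.varLagr_pullField_family (g := fun τ => ψ (c τ)) hc hg
    have h3 := fun U => (hΦ.covariance (g := fun τ => ψ (c τ)) hc hg U).2
    refine ⟨hcg, h1, h2, fun x => ?_, h3⟩
    have h4 := hΦ.hasDerivAt_lagr hcg x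
    simp only [hΦ.lagr_pullField (hc.1 _)] at h4
    exact h4
  · ext χ
    constructor
    · rintro ⟨φ, hφ, rfl⟩
      exact (hΦ.mem_solutions_pullField_iff hφ.1 (ψ φ)).2 hφ
    · intro hχ
      obtain ⟨-, Θ, hΘ, -, hr, -⟩ := hv
      refine ⟨Θ χ, (hΦ.mem_solutions_pullField_iff (hΘ hχ.1) (ψ (Θ χ))).1 ?_, hr χ hχ.1⟩
      have h1 := hr χ hχ.1
      rw [selfPull] at h1
      rwa [h1]
  · ext φ
    exact ⟨fun h => hΦ.mem_solutions_of_generatesVerticalDiffeo hv h.1 h.2,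
      fun h => ⟨h.1, fun c _ _ => hΦ.fieldEq_eq_zero h (ψ φ) _⟩⟩
  · have h1 := hΦ.lagr_pullField hφ (u φ)
    exact ⟨⟨u φ, φ, hφ, rfl⟩, h1, fun U => by rw [selfPull, h1, pair_preim]⟩
  · have hg := hu.1 c hc
    have hcg := isCurveIn_transport (g := fun τ => u (c τ)) hc hg
    have h1 := hΦ.fieldEq_pullField_family (g := fun τ => u (c τ)) hc hg
    have h2 := hΦ.varLagr_pullField_family (g := fun τ => u (c τ)) hc hg
    have h3 := hΦ.covariance (g := fun τ => u (c τ)) hc hg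
    exact ⟨hcg, h1, h2, hΦ.transport.hasDerivAt_lagr hcg, h3⟩
  · ext χ
    constructor
    · rintro ⟨φ, hφ, rfl⟩
      exact ⟨⟨φ, hφ.1, rfl⟩, (hΦ.mem_solutions_transport_iff hφ.1 (u φ)).2 hφ⟩
    · rintro ⟨⟨φ, hφ, rfl⟩, h⟩
      exact ⟨φ, (hΦ.mem_solutions_transport_iff hφ (u φ)).1 h, rfl⟩
  · ext φ
    exact ⟨fun h => hΦ.mem_solutions_of_localDressing hu.1 hl h.1 h.2,
      fun h => ⟨h.1, fun c _ _ => hΦ.fieldEq_eq_zero h (u φ) _⟩⟩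
  · rw [hL, pair_preim]
  · intro X
    have hg := hψ c hc
    have hLc := hLs c hc
    -- Covariance makes the transformed Lagrangian a pulled-back family of top forms, so neither the
    -- order of the Lagrangian nor the kind of fields matters.
    have h1 := hasDerivAt_pair_pullback hg hLc U
    rw [pair_vel_add_lieD hg hLc] at h1
    have h2 := pair_lieD_generator hg hLc U
    refine ⟨_, hasDerivAt_pair hLc U, ?_, h2.symm, by rw [← h2, lieD_top]⟩
    rw [← h2]
    simpa only [hL] using h1
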